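/- **Setting.** Let $\mathbb T=\mathbb R^2/\mathbb Z^2$ be the flat torus and let $S$ be the set of integers $n\ge 0$ of the form $n=a^2+b^2$ with $a,b\in\mathbb Z$. For $n\in S$ put $$\Lambda_n=\{\lambda\in\mathbb Z^2:\lambda_1^2+\lambda_2^2=n\},\qquad \mathcal N_n=|\Lambda_n|,\qquad E_n=4\pi^2 n,\qquad e_\lambda(x)=e^{2\pi i\langle\lambda,x\rangle}.$$ Let $(v_\lambda)_{\lambda\in\mathbb Z^2}$ be independent, identically distributed complex random variables on a probability space $(\Omega,\mathscr F,\mathbb P)$ such that $\mathrm{Re}\,v_\lambda$ and $\mathrm{Im}\,v_\lambda$ are independent standard real Gaussian variables. The complex arithmetic random wave of order $n$ is $$\Theta_n(x)=\frac1{\sqrt{\mathcal N_n}}\sum_{\lambda\in\Lambda_n}v_\lambda\,e_\lambda(x),\qquad x\in\mathbb T,$$ and $I_n$ is the number of zeros of $\Theta_n$ in $\mathbb T$. Let $$r_n(x)=\frac1{\mathcal N_n}\sum_{\lambda\in\Lambda_n}\cos(2\pi\langle\lambda,x\rangle),\qquad R_n(6)=\int_{\mathbb T}r_n(x)^6\,dx.$$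 Put $a_\lambda=\frac12\big(v_\lambda+\overline{v_{-\lambda}}\big)$ and $\widehat a_\lambda=\frac1{2i}\big(v_\lambda-\overline{v_{-\lambda}}\big)$, so that $\mathrm{Re}\,\Theta_n=\mathcal N_n^{-1/2}\sum_{\lambda\in\Lambda_n}a_\lambda e_\lambda$ and $\mathrm{Im}\,\Theta_n=\mathcal N_n^{-1/2}\sum_{\lambda\in\Lambda_n}\widehat a_\lambda e_\lambda$. Let $\mathbf A$ be the closure in $L^2(\mathbb P)$ of the real linear span of the variables $c_1(z a_\lambda+\bar z a_{-\lambda})+c_2(u\widehat a_\tau+\bar u\widehat a_{-\tau})$ with $\lambda,\tau\in\mathbb Z^2$, $z,u\in\mathbb C$, $c_1,c_2\in\mathbb R$. For $q\ge 0$, let the $q$-th Wiener chaos $C_q$ be the closure in $L^2(\mathbb P)$ of the real linear span of the products $\prod_{j=1}^k H_{p_j}(\xi_j)$, where $k\ge1$, $p_1+\dots+p_k=q$, $(\xi_1,\dots,\xi_k)$ is a standard Gaussian vector with entries in $\mathbf A$, and $H_p$ is the $p$-th Hermite polynomial ($H_0=1$, $H_p(t)=tH_{p-1}(t)-H_{p-1}'(t)$).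 For $F\in L^2(\mathbb P)$ let $F[q]$ be the orthogonal projection of $F$ onto $C_q$. **Proposition 3.2.** For every $n\in S$, the zero set of $\Theta_n$ is almost surely finite, $I_n\in L^2(\mathbb P)$, and $\sum_{q\ge3}\mathrm{Var}(I_n[2q])<\infty$. As $\mathcal N_n\to\infty$, $$\sum_{q\ge 3}\mathrm{Var}\big(I_n[2q]\big)=O\big(E_n^2\,R_n(6)\big),$$ that is, there are absolute constants $C$ and $K$ such that $\sum_{q\ge 3}\mathrm{Var}(I_n[2q])\le C\,E_n^2\,R_n(6)$ for every $n\in S$ with $\mathcal N_n\ge K$. -/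

import Mathlib

open MeasureTheory ProbabilityTheory

open scoped ENNReal ComplexConjugate

noncomputable section

namespace ArithWave

/-- The flat torus `ℝ² / ℤ²`. -/
abbrev Torus : Type := UnitAddTorus (Fin 2)

/-- Integers that are a sum of two squares. -/
def sumTwoSq : Set ℕ := {n | ∃ a b : ℤ, a ^ 2 + b ^ 2 = (n : ℤ)}

/-- The energy levels `Λ_n = {l ∈ ℤ² : l₁² + l₂² = n}` (a finite set; see `mem_freq`). -/
def freq (n : ℕ) : Finset (Fin 2 → ℤ) :=
  (Fintype.piFinset fun _ => Finset.Icc (-(n : ℤ)) n).filter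
    fun l => l 0 ^ 2 + l 1 ^ 2 = (n : ℤ)

theorem mem_freq (n : ℕ) (l : Fin 2 → ℤ) :
    l ∈ freq n ↔ l 0 ^ 2 + l 1 ^ 2 = (n : ℤ) := by
  simp only [freq, Finset.mem_filter, Fintype.mem_piFinset, Finset.mem_Icc, and_iff_right_iff_imp]
  intro h i
  have key : ∀ a : ℤ, a ^ 2 ≤ (n : ℤ) → -(n : ℤ) ≤ a ∧ a ≤ n := by
    intro a ha
    constructor
    · nlinarith [Int.le_self_sq (-a)]
    · nlinarith [Int.le_self_sq a]
  apply key
  fin_cases i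
  · simp only [Fin.zero_eta]
    nlinarith [sq_nonneg (l 1)]
  · simp only [Fin.mk_one]
    nlinarith [sq_nonneg (l 0)]

/-- `𝒩_n = |Λ_n|`. -/
def numFreq (n : ℕ) : ℕ := (freq n).card

/-- The eigenvalue `E_n = 4 π² n`. -/
def energy (n : ℕ) : ℝ := 4 * Real.pi ^ 2 * n

/-- `r_n(x) = 𝒩_n⁻¹ ∑_{l ∈ Λ_n} cos (2π⟨l, x⟩)`; here `mFourier l x = exp (2πi⟨l, x⟩)`. -/
def covFun (n : ℕ) (x : Torus) : ℝ :=
  (1 / (numFreq n : ℝ)) * ∑ l ∈ freq n, (UnitAddTorus.mFourier l x).re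

/-- `R_n(6) = ∫_𝕋 r_n(x)⁶ dx`. -/
def sixthMoment (n : ℕ) : ℝ := ∫ x : Torus, covFun n x ^ 6

variable {Ω : Type*}

/-- The complex arithmetic random wave
`Θ_n(x) = 𝒩_n^{-1/2} ∑_{l ∈ Λ_n} v_l exp (2πi⟨l, x⟩)`. -/
def wave (v : (Fin 2 → ℤ) → Ω → ℂ) (n : ℕ) (ω : Ω) (x : Torus) : ℂ :=
  (1 / (Real.sqrt (numFreq n) : ℂ)) * ∑ l ∈ freq n, v l ω * UnitAddTorus.mFourier l x

/-- The phase singularities, i.e. the zeros of `Θ_n` on the torus. -/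
def zeroSet (v : (Fin 2 → ℤ) → Ω → ℂ) (n : ℕ) (ω : Ω) : Set Torus :=
  {x | wave v n ω x = 0}

/-- `I_n`, the number of zeros of `Θ_n`. -/
def numZeros (v : (Fin 2 → ℤ) → Ω → ℂ) (n : ℕ) (ω : Ω) : ℝ :=
  ((zeroSet v n ω).ncard : ℝ)

/-- The Fourier coefficients of the real part:
`Re Θ_n(x) = 𝒩_n^{-1/2} ∑_{l ∈ Λ_n} a_l exp (2πi⟨l, x⟩)`. -/
def reCoeff (v : (Fin 2 → ℤ) → Ω → ℂ) (l : Fin 2 → ℤ) (ω : Ω) : ℂ :=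
  (v l ω + conj (v (-l) ω)) / 2

/-- The Fourier coefficients of the imaginary part:
`Im Θ_n(x) = 𝒩_n^{-1/2} ∑_{l ∈ Λ_n} â_l exp (2πi⟨l, x⟩)`. -/
def imCoeff (v : (Fin 2 → ℤ) → Ω → ℂ) (l : Fin 2 → ℤ) (ω : Ω) : ℂ :=
  (v l ω - conj (v (-l) ω)) / (2 * Complex.I)

variable [MeasurableSpace Ω]

/-- The `v_l`, `l ∈ ℤ²` (the union of the sets `Λ_n`), are i.i.d. complex Gaussian variables whose
real and imaginary parts are independent standard real Gaussian variables. -/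
structure IsGaussianFamily (P : Measure Ω) (v : (Fin 2 → ℤ) → Ω → ℂ) : Prop where
  measurable : ∀ l, Measurable (v l)
  indep : iIndepFun v P
  indep_re_im : ∀ l, IndepFun (fun ω => (v l ω).re) (fun ω => (v l ω).im) P
  law_re : ∀ l, P.map (fun ω => (v l ω).re) = gaussianReal 0 1
  law_im : ∀ l, P.map (fun ω => (v l ω).im) = gaussianReal 0 1

/-- The real Gaussian Hilbert space `𝐀`: the closure in `L²(P)` of the real linear span of the
variables `c₁ (z a_l + z̄ a_{-l}) + c₂ (u â_t + ū â_{-t})`. -/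
def gaussianSpace (P : Measure Ω) (v : (Fin 2 → ℤ) → Ω → ℂ) : Submodule ℝ (Lp ℝ 2 P) :=
  (Submodule.span ℝ {ξ : Lp ℝ 2 P | ∃ (l t : Fin 2 → ℤ) (z u : ℂ) (c₁ c₂ : ℝ),
    (fun ω => ((ξ ω : ℝ) : ℂ)) =ᵐ[P] fun ω =>
      (c₁ : ℂ) * (z * reCoeff v l ω + conj z * reCoeff v (-l) ω) +
      (c₂ : ℂ) * (u * imCoeff v t ω + conj u * imCoeff v (-t) ω)}).topologicalClosure

/-- The `q`-th Wiener chaos `C_q` of `𝐀`: the closure in `L²(P)` of the real linear span of the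
products `∏_j H_{p_j}(ξ_j)` with `∑_j p_j = q`, where `(ξ_1, …, ξ_k)` is a standard Gaussian vector
with entries in `𝐀` and `H_p` is the (probabilists') Hermite polynomial. -/
def chaos (P : Measure Ω) (v : (Fin 2 → ℤ) → Ω → ℂ) (q : ℕ) : Submodule ℝ (Lp ℝ 2 P) :=
  (Submodule.span ℝ {F : Lp ℝ 2 P | ∃ (k : ℕ) (p : Fin k → ℕ) (ξ : Fin k → Lp ℝ 2 P),
    1 ≤ k ∧ ∑ j, p j = q ∧ (∀ j, ξ j ∈ gaussianSpace P v) ∧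
    P.map (fun ω j => ξ j ω) = Measure.pi (fun _ : Fin k => gaussianReal 0 1) ∧
    F =ᵐ[P] fun ω => ∏ j, Polynomial.aeval (ξ j ω) (Polynomial.hermite (p j))}).topologicalClosure

instance (P : Measure Ω) (v : (Fin 2 → ℤ) → Ω → ℂ) (q : ℕ) :
    (chaos P v q).HasOrthogonalProjection := by
  unfold chaos
  infer_instance

/-- `F[q] = proj(F | C_q)`, the orthogonal projection in `L²(P)`. -/
def chaosProj (P : Measure Ω) (v : (Fin 2 → ℤ) → Ω → ℂ) (q : ℕ) (F : Lp ℝ 2 P) : Lp ℝ 2 P :=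
  (chaos P v q).starProjection F

end ArithWave

end

/-! Formally `I_n` is the integral over the torus of `δ_0(Θ_n(x)) |Jac Θ_n(x)|`, a fixed functional
of the one-jet of the wave at `x`. With the gradient rescaled, the jet is a standard Gaussian vector
at every point (`isCoisometry_jet`). The q-th chaos components of functionals of the jets at `x` and
`y` therefore have covariance at most `ρ^q` times the product of their norms, where `ρ` bounds the
correlation of the jets (Gebelein's inequality, `abs_inner_gaussProj_pull_le`). A Dirac mass is not
in `L²`, but the Mehler operator at 1/2 smooths its approximations of width `ε` into a family
bounded in `L²`, so their q-th components are at most `C 2^q`, uniformly in `ε`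
(`exists_norm_gaussProj_zeroKernel_le`). Where `ρ` is small, the geometric series over `q ≥ 6` is
`O(E_n² ρ^6)`. The integral of `ρ^6` is `O(R_n(6))`: a sixth moment of a trigonometric polynomial is
a sum over resonant sextuples of frequencies, so it is controlled by the moduli of the coefficients
(`integral_norm_pow_six_le`).

Where `ρ` is not small, the series gives nothing. The unit square is cut into cells of side
comparable to `E_n^(-1/2)`. If a pair of cells contains one strongly correlated pair of points, the
correlation is bounded below on the whole pair of cells, which thus contributes at least a constant
to `E_n² ∫∫ ρ^6`. Its covariance is at most a constant, by Cauchy-Schwarz, Bessel and a uniform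
second moment bound for the approximate count in one cell (`exists_lintegral_sq_cell_le`). That
bound rests on the two-point estimate `exists_lintegral_zeroKernel_mul_le`: if the wave is small at
two nearby points, Taylor's formula makes one directional derivative small, and the resulting
smallness of the Jacobians compensates the high probability of the event.

To remove `ε`: almost surely no zero is degenerate (`ae_notMem_degenerateSet`), so the approximate
count equals the true one for all small `ε` (`eventually_zeroMass_eq`). The uniform bounds then give
`I_n ∈ L²` by Fatou, and the chaos estimate passes to the weak limit.

All chaos estimates are made on the Gaussian law of the finite coefficient vector, where the q-th
chaos is the common eigenspace of the Mehler operators. A Hermite product generating `C_q`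
correlates only with the q-th eigenspace, so `‖I_n[q]‖` is dominated by the norm of the
corresponding component (`IsGaussianFamily.norm_chaosProj_le`). Only orthogonality and Bessel's
inequality are used, not completeness of the decomposition. -/

noncomputable section

namespace ArithWave

set_option linter.unusedSectionVars false

/-! ### Jointly Gaussian pairs, the Mehler semigroup and its eigenspaces -/

section GaussianPairs

open scoped RealInnerProductSpace

variable {Ω Ω' E F : Type*} [MeasurableSpace Ω] [MeasurableSpace Ω'] {P : Measure Ω}
  {P' : Measure Ω'}
  [NormedAddCommGroup E] [InnerProductSpace ℝ E] [FiniteDimensional ℝ E] [MeasurableSpace E]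
  [BorelSpace E]
  [NormedAddCommGroup F] [InnerProductSpace ℝ F] [FiniteDimensional ℝ F] [MeasurableSpace F]
  [BorelSpace F]

/-- Composition with a measure preserving map, as an isometry of `L²` spaces. -/
def pull {α β : Type*} [MeasurableSpace α] [MeasurableSpace β] {μ : Measure α} {ν : Measure β}
    {f : α → β} (hf : MeasurePreserving f μ ν) : Lp ℝ 2 ν →ₗᵢ[ℝ] Lp ℝ 2 μ :=
  Lp.compMeasurePreservingₗᵢ ℝ f hf

theorem coeFn_pull {α β : Type*} [MeasurableSpace α] [MeasurableSpace β] {μ : Measure α}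
    {ν : Measure β} {f : α → β} (hf : MeasurePreserving f μ ν) (g : Lp ℝ 2 ν) :
    pull hf g =ᵐ[μ] g ∘ f :=
  Lp.coeFn_compMeasurePreserving g hf

theorem inner_pull_pull {α β γ : Type*} [MeasurableSpace α] [MeasurableSpace β] [MeasurableSpace γ]
    {μ : Measure α} {ν : Measure β} {κ : Measure γ} {φ : α → β} {ψ : α → γ}
    (hφ : MeasurePreserving φ μ ν) (hψ : MeasurePreserving ψ μ κ) (f : Lp ℝ 2 ν) (g : Lp ℝ 2 κ) :
    ⟪pull hφ f, pull hψ g⟫ = ∫ x, f (φ x) * g (ψ x) ∂μ := by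
  rw [L2.inner_def]
  refine integral_congr_ae ?_
  filter_upwards [coeFn_pull hφ f, coeFn_pull hψ g] with x h1 h2
  simp [h1, h2, mul_comm]

theorem inner_pull_pull_congr {α α' β γ : Type*} [MeasurableSpace α] [MeasurableSpace α']
    [MeasurableSpace β] [MeasurableSpace γ]
    {μ : Measure α} {μ' : Measure α'} {ν : Measure β} {κ : Measure γ} {φ : α → β} {ψ : α → γ}
    {φ' : α' → β} {ψ' : α' → γ}
    (hφ : MeasurePreserving φ μ ν) (hψ : MeasurePreserving ψ μ κ)
    (hφ' : MeasurePreserving φ' μ' ν) (hψ' : MeasurePreserving ψ' μ' κ)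
    (h : μ.map (fun x => (φ x, ψ x)) = μ'.map (fun x => (φ' x, ψ' x)))
    (f : Lp ℝ 2 ν) (g : Lp ℝ 2 κ) :
    ⟪pull hφ f, pull hψ g⟫ = ⟪pull hφ' f, pull hψ' g⟫ := by
  rw [inner_pull_pull, inner_pull_pull]
  have hm : StronglyMeasurable fun z : β × γ => f z.1 * g z.2 :=
    ((Lp.stronglyMeasurable f).comp_measurable measurable_fst).mul
      ((Lp.stronglyMeasurable g).comp_measurable measurable_snd)
  have h1 := integral_map (hφ.measurable.prodMk hψ.measurable).aemeasurable
    hm.aestronglyMeasurable (μ := μ)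
  have h2 := integral_map (hφ'.measurable.prodMk hψ'.measurable).aemeasurable
    hm.aestronglyMeasurable (μ := μ')
  rw [← h1, ← h2, h]

/-- The law of a pair of random vectors is determined by its joint characteristic function. -/
theorem map_prodMk_ext [IsFiniteMeasure P] [IsFiniteMeasure P'] {φ : Ω → E} {ψ : Ω → F}
    {φ' : Ω' → E} {ψ' : Ω' → F} (hφ : Measurable φ) (hψ : Measurable ψ) (hφ' : Measurable φ')
    (hψ' : Measurable ψ')
    (h : ∀ t τ, ∫ ω, Complex.exp (((⟪φ ω, t⟫ + ⟪ψ ω, τ⟫ : ℝ) : ℂ) * Complex.I) ∂P =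
      ∫ ω, Complex.exp (((⟪φ' ω, t⟫ + ⟪ψ' ω, τ⟫ : ℝ) : ℂ) * Complex.I) ∂P') :
    P.map (fun x => (φ x, ψ x)) = P'.map (fun x => (φ' x, ψ' x)) := by
  apply Measure.ext_of_charFunDual
  funext L
  have hL : ∀ x : E × F, L x =
      ⟪x.1, (InnerProductSpace.toDual ℝ E).symm (L.comp (ContinuousLinearMap.inl ℝ E F))⟫ +
      ⟪x.2, (InnerProductSpace.toDual ℝ F).symm (L.comp (ContinuousLinearMap.inr ℝ E F))⟫ := by
    intro x
    rw [real_inner_comm, InnerProductSpace.toDual_symm_apply, real_inner_comm,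
      InnerProductSpace.toDual_symm_apply]
    simp [← map_add]
  rw [charFunDual_apply, charFunDual_apply, integral_map, integral_map]
  · simp_rw [hL]
    exact h _ _
  · exact (hφ'.prodMk hψ').aemeasurable
  · exact Continuous.aestronglyMeasurable (by fun_prop)
  · exact (hφ.prodMk hψ).aemeasurable
  · exact Continuous.aestronglyMeasurable (by fun_prop)

/-- A pair of standard Gaussian vectors which are jointly Gaussian with cross covariance `B`. -/
structure IsGaussPair (P : Measure Ω) (φ : Ω → E) (ψ : Ω → F) (B : E → F → ℝ) : Prop where
  left : MeasurePreserving φ P (stdGaussian E)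
  right : MeasurePreserving ψ P (stdGaussian F)
  charFun_eq : ∀ t τ, ∫ ω, Complex.exp (((⟪φ ω, t⟫ + ⟪ψ ω, τ⟫ : ℝ) : ℂ) * Complex.I) ∂P =
    Complex.exp ((-(‖t‖ ^ 2 + 2 * B t τ + ‖τ‖ ^ 2) / 2 : ℝ) : ℂ)

theorem IsGaussPair.symm {φ : Ω → E} {ψ : Ω → F} {B : E → F → ℝ} (h : IsGaussPair P φ ψ B) :
    IsGaussPair P ψ φ (fun τ t => B t τ) := by
  refine ⟨h.right, h.left, fun τ t => ?_⟩
  have := h.charFun_eq t τ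
  simp_rw [add_comm ⟪φ _, t⟫] at this
  rw [this]
  congr 3
  ring

/-- The cross covariance determines the joint characteristic function and so the joint law.
Covariances may therefore be computed in any convenient coupling, on any probability space. -/
theorem IsGaussPair.inner_eq [IsFiniteMeasure P] [IsFiniteMeasure P'] {φ : Ω → E} {ψ : Ω → F}
    {φ' : Ω' → E} {ψ' : Ω' → F} {B : E → F → ℝ}
    (h : IsGaussPair P φ ψ B) (h' : IsGaussPair P' φ' ψ' B)
    (f : Lp ℝ 2 (stdGaussian E)) (g : Lp ℝ 2 (stdGaussian F)) :
    ⟪pull h.left f, pull h.right g⟫ = ⟪pull h'.left f, pull h'.right g⟫ := by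
  apply inner_pull_pull_congr
  apply map_prodMk_ext h.left.measurable h.right.measurable h'.left.measurable h'.right.measurable
  intro t τ
  rw [h.charFun_eq, h'.charFun_eq]

theorem integral_exp_stdGaussian (t : E) :
    ∫ x, Complex.exp ((⟪x, t⟫ : ℂ) * Complex.I) ∂(stdGaussian E) =
      Complex.exp ((-‖t‖ ^ 2 / 2 : ℝ) : ℂ) := by
  have := charFun_stdGaussian t
  rw [charFun_apply] at this
  rw [this]
  push_cast
  ring_nf

theorem measurePreserving_stdGaussian_of_charFun [IsFiniteMeasure P] {φ : Ω → E} (hφ : Measurable φ)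
    (h : ∀ t, ∫ ω, Complex.exp ((⟪φ ω, t⟫ : ℂ) * Complex.I) ∂P =
      Complex.exp ((-‖t‖ ^ 2 / 2 : ℝ) : ℂ)) : MeasurePreserving φ P (stdGaussian E) := by
  refine ⟨hφ, ?_⟩
  apply Measure.ext_of_charFun
  funext t
  rw [charFun_apply, integral_map hφ.aemeasurable
    (Continuous.aestronglyMeasurable (by fun_prop)), charFun_stdGaussian, h t]
  push_cast
  ring_nf

theorem IsGaussPair.of_charFun [IsFiniteMeasure P] {φ : Ω → E} {ψ : Ω → F} {B : E → F → ℝ}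
    (hφ : Measurable φ) (hψ : Measurable ψ) (h0 : ∀ t, B t 0 = 0) (h0' : ∀ τ, B 0 τ = 0)
    (h : ∀ t τ, ∫ ω, Complex.exp (((⟪φ ω, t⟫ + ⟪ψ ω, τ⟫ : ℝ) : ℂ) * Complex.I) ∂P =
    Complex.exp ((-(‖t‖ ^ 2 + 2 * B t τ + ‖τ‖ ^ 2) / 2 : ℝ) : ℂ)) : IsGaussPair P φ ψ B := by
  refine ⟨measurePreserving_stdGaussian_of_charFun hφ fun t => ?_,
    measurePreserving_stdGaussian_of_charFun hψ fun t => ?_, h⟩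
  · simpa [h0] using h t 0
  · simpa [h0'] using h 0 t

/-- The noise operator `(x, y) ↦ s x + √(1 - s²) y`. -/
def mix (s : unitInterval) (z : E × E) : E := (s : ℝ) • z.1 + √(1 - (s : ℝ) ^ 2) • z.2

theorem sq_sqrt_one_sub_sq (s : unitInterval) : √(1 - (s : ℝ) ^ 2) ^ 2 = 1 - (s : ℝ) ^ 2 :=
  Real.sq_sqrt (by nlinarith [s.2.1, s.2.2])

theorem continuous_mix (s : unitInterval) : Continuous (mix s : E × E → E) := by
  unfold mix; fun_prop

/-- Diluting one vector with fresh independent noise, scaled to keep it standard, multiplies the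
cross covariance by `s`. -/
theorem IsGaussPair.mix [IsProbabilityMeasure P] {φ : Ω → E} {ψ : Ω → F} {B : E → F → ℝ}
    (h : IsGaussPair P φ ψ B)
    (hB : ∀ t τ (c : ℝ), B t (c • τ) = c * B t τ) (h0 : ∀ τ, B 0 τ = 0) (s : unitInterval) :
    IsGaussPair (P.prod (stdGaussian F)) (fun z => φ z.1) (fun z => mix s (ψ z.1, z.2))
      (fun t τ => s * B t τ) := by
  apply IsGaussPair.of_charFun
  · exact h.left.measurable.comp measurable_fst
  · exact (continuous_mix s).measurable.comp
      ((h.right.measurable.comp measurable_fst).prodMk measurable_snd)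
  · intro t
    have := hB t 0 0
    simp only [zero_smul, zero_mul] at this
    simp [this]
  · simp [h0]
  intro t τ
  have h1 : ∀ z : Ω × F, Complex.exp (((⟪φ z.1, t⟫ + ⟪ArithWave.mix s (ψ z.1, z.2), τ⟫ : ℝ) : ℂ) *
        Complex.I) =
      Complex.exp (((⟪φ z.1, t⟫ + ⟪ψ z.1, (s : ℝ) • τ⟫ : ℝ) : ℂ) * Complex.I) *
      Complex.exp ((⟪z.2, √(1 - (s : ℝ) ^ 2) • τ⟫ : ℂ) * Complex.I) := by
    intro z
    rw [← Complex.exp_add]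
    congr 1
    simp only [ArithWave.mix, inner_add_left, inner_smul_left, inner_smul_right]
    push_cast
    simp
    ring
  simp_rw [h1]
  rw [integral_prod_mul (fun ω => Complex.exp (((⟪φ ω, t⟫ + ⟪ψ ω, (s : ℝ) • τ⟫ : ℝ) : ℂ) *
    Complex.I)) (fun y => Complex.exp ((⟪y, √(1 - (s : ℝ) ^ 2) • τ⟫ : ℂ) * Complex.I)),
    h.charFun_eq, integral_exp_stdGaussian, ← Complex.exp_add, ← Complex.ofReal_add]
  congr 2
  rw [hB, norm_smul, norm_smul, mul_pow, mul_pow, Real.norm_eq_abs, Real.norm_eq_abs, sq_abs,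
    sq_abs, sq_sqrt_one_sub_sq]
  ring

theorem isGaussPair_id : IsGaussPair (stdGaussian E) (id : E → E) id (fun t τ => ⟪t, τ⟫) := by
  apply IsGaussPair.of_charFun measurable_id measurable_id (by simp) (by simp)
  intro t τ
  simp only [id, ← inner_add_right]
  rw [integral_exp_stdGaussian, norm_add_sq_real]

theorem measurePreserving_mix (s : unitInterval) :
    MeasurePreserving (mix s : E × E → E) ((stdGaussian E).prod (stdGaussian E)) (stdGaussian E) :=
  (isGaussPair_id.mix (by simp [inner_smul_right]) (by simp) s).right

/-- The Mehler operator on `L²` of the standard Gaussian measure. -/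
def mehlerOp (s : unitInterval) : Lp ℝ 2 (stdGaussian E) →L[ℝ] Lp ℝ 2 (stdGaussian E) :=
  (ContinuousLinearMap.adjoint (pull (measurePreserving_fst (μ := stdGaussian E)
    (ν := stdGaussian E))).toContinuousLinearMap).comp
    (pull (measurePreserving_mix s)).toContinuousLinearMap

theorem integrable_pull_mul [IsFiniteMeasure P] {φ : Ω → E} {κ : Measure E}
    (hφ : MeasurePreserving φ P κ) (u : Lp ℝ 2 P) (g : Lp ℝ 2 κ) :
    Integrable (fun ω => u ω * g (φ ω)) P := by
  have := L2.integrable_inner (𝕜 := ℝ) (pull hφ g) u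
  refine this.congr ?_
  filter_upwards [coeFn_pull hφ g] with x h1
  simp [h1]

theorem inner_fst_mix {s : unitInterval} [IsProbabilityMeasure P] {ψ : Ω → E}
    (hψ : MeasurePreserving (fun z : Ω × E => mix s (ψ z.1, z.2)) (P.prod (stdGaussian E))
      (stdGaussian E)) (u : Lp ℝ 2 P) (g : Lp ℝ 2 (stdGaussian E)) :
    ⟪pull (measurePreserving_fst (μ := P) (ν := stdGaussian E)) u, pull hψ g⟫ =
      ∫ ω, u ω * ∫ y, g (mix s (ψ ω, y)) ∂(stdGaussian E) ∂P := by
  rw [inner_pull_pull, integral_prod]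
  · simp_rw [integral_const_mul]
  · have := integrable_pull_mul hψ (pull (measurePreserving_fst (μ := P) (ν := stdGaussian E)) u) g
    refine this.congr ?_
    filter_upwards [coeFn_pull (measurePreserving_fst (μ := P) (ν := stdGaussian E)) u] with x h1
    simp [h1]

/-- The adjoint of pulling back along the first projection integrates out the second variable; this
recovers the usual integral formula from the abstract definition. -/
theorem coeFn_mehlerOp (s : unitInterval) (g : Lp ℝ 2 (stdGaussian E)) :
    mehlerOp s g =ᵐ[stdGaussian E] fun x => ∫ y, g (mix s (x, y)) ∂(stdGaussian E) := by
  have hint : Integrable (fun z : E × E => g (mix s z)) ((stdGaussian E).prod (stdGaussian E)) :=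
    (measurePreserving_mix s).integrable_comp_of_integrable ((Lp.memLp g).integrable (by norm_num))
  refine Integrable.ae_eq_of_forall_setIntegral_eq _ _ ((Lp.memLp _).integrable (by norm_num))
    hint.integral_prod_left fun A hA hA' => ?_
  -- A set integral is an inner product with an indicator, against which the adjoint can be moved.
  rw [← L2.inner_indicatorConstLp_one (𝕜 := ℝ) hA hA'.ne]
  unfold mehlerOp
  rw [ContinuousLinearMap.comp_apply, ContinuousLinearMap.adjoint_inner_right]
  have := inner_fst_mix (ψ := (id : E → E)) (measurePreserving_mix s)
    (indicatorConstLp 2 hA hA'.ne (1 : ℝ)) g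
  refine this.trans ?_
  rw [← integral_indicator hA]
  refine integral_congr_ae ?_
  filter_upwards [indicatorConstLp_coeFn (p := 2) (hs := hA) (hμs := hA'.ne) (c := (1 : ℝ))]
    with x hx
  rw [hx]
  by_cases hxA : x ∈ A <;> simp [hxA]

theorem inner_fst_mix_eq {s : unitInterval} [IsProbabilityMeasure P] {ψ : Ω → E}
    (hψ : MeasurePreserving ψ P (stdGaussian E))
    (hψ' : MeasurePreserving (fun z : Ω × E => mix s (ψ z.1, z.2)) (P.prod (stdGaussian E))
      (stdGaussian E)) (u : Lp ℝ 2 P) (g : Lp ℝ 2 (stdGaussian E)) :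
    ⟪pull (measurePreserving_fst (μ := P) (ν := stdGaussian E)) u, pull hψ' g⟫ =
      ⟪u, pull hψ (mehlerOp s g)⟫ := by
  rw [inner_fst_mix, L2.inner_def]
  refine integral_congr_ae ?_
  filter_upwards [coeFn_pull hψ (mehlerOp s g), hψ.quasiMeasurePreserving.ae (coeFn_mehlerOp s g)]
    with x h1 h2
  simp [h1, h2, mul_comm]

/-- Integrating out the noise that the Mehler operator adds to `ψ` is the same as testing `f` and
`g` on the diluted pair, whose law is fixed by the cross covariance `s B`. -/
theorem IsGaussPair.inner_mehlerOp_right [IsProbabilityMeasure P] [IsFiniteMeasure P']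
    {φ : Ω → E} {ψ : Ω → F} {φ' : Ω' → E} {ψ' : Ω' → F} {B : E → F → ℝ} {s : unitInterval}
    (h : IsGaussPair P φ ψ B) (h' : IsGaussPair P' φ' ψ' (fun t τ => s * B t τ))
    (hB : ∀ t τ (c : ℝ), B t (c • τ) = c * B t τ) (h0 : ∀ τ, B 0 τ = 0)
    (f : Lp ℝ 2 (stdGaussian E)) (g : Lp ℝ 2 (stdGaussian F)) :
    ⟪pull h.left f, pull h.right (mehlerOp s g)⟫ = ⟪pull h'.left f, pull h'.right g⟫ := by
  rw [h'.inner_eq (h.mix hB h0 s), ← inner_fst_mix_eq h.right (h.mix hB h0 s).right]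
  congr 1
  refine Lp.ext ?_
  have hf := measurePreserving_fst (μ := P) (ν := stdGaussian F)
  filter_upwards [coeFn_pull hf (pull h.left f), coeFn_pull (h.mix hB h0 s).left f,
    hf.quasiMeasurePreserving.ae (coeFn_pull h.left f)] with x h1 h2 h3
  simp [h1, h2, h3]

/-- Diluting either vector turns `B` into the same covariance `s B`, so the operator can be carried
across the pair. This is the source both of self-adjointness and of the orthogonality of different
chaoses for correlated vectors. -/
theorem IsGaussPair.inner_mehlerOp_comm [IsProbabilityMeasure P]
    {φ : Ω → E} {ψ : Ω → F} {B : E → F → ℝ}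
    (h : IsGaussPair P φ ψ B) (hB : ∀ t τ (c : ℝ), B t (c • τ) = c * B t τ)
    (hB' : ∀ t τ (c : ℝ), B (c • t) τ = c * B t τ) (s : unitInterval)
    (f : Lp ℝ 2 (stdGaussian E)) (g : Lp ℝ 2 (stdGaussian F)) :
    ⟪pull h.left f, pull h.right (mehlerOp s g)⟫ =
      ⟪pull h.left (mehlerOp s f), pull h.right g⟫ := by
  have h0 : ∀ τ, B 0 τ = 0 := fun τ => by simpa using hB' 0 τ 0
  have h0' : ∀ t, B t 0 = 0 := fun t => by simpa using hB t 0 0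
  rw [h.inner_mehlerOp_right (h.mix hB h0 s) hB h0, real_inner_comm (pull h.right g),
    h.symm.inner_mehlerOp_right (h.mix hB h0 s).symm (fun t τ c => hB' τ t c) h0', real_inner_comm]

theorem pull_id (f : Lp ℝ 2 P) : pull (MeasurePreserving.id P) f = f := by
  refine Lp.ext ?_
  filter_upwards [coeFn_pull (MeasurePreserving.id P) f] with x hx
  simp [hx]

theorem inner_mehlerOp_comm (s : unitInterval) (f g : Lp ℝ 2 (stdGaussian E)) :
    ⟪f, mehlerOp s g⟫ = ⟪mehlerOp s f, g⟫ := by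
  have := (isGaussPair_id (E := E)).inner_mehlerOp_comm (by simp [inner_smul_right])
    (by simp [inner_smul_left]) s f g
  simpa only [pull_id] using this

/-- The `q`-th eigenspace of the Mehler semigroup, that is the `q`-th chaos of the standard
Gaussian measure. -/
def gaussChaos (E : Type*) [NormedAddCommGroup E] [InnerProductSpace ℝ E] [FiniteDimensional ℝ E]
    [MeasurableSpace E] [BorelSpace E] (q : ℕ) : Submodule ℝ (Lp ℝ 2 (stdGaussian E)) :=
  ⨅ s : unitInterval, LinearMap.ker (mehlerOp s - ((s : ℝ) ^ q) • ContinuousLinearMap.id ℝ _ :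
    Lp ℝ 2 (stdGaussian E) →L[ℝ] Lp ℝ 2 (stdGaussian E)).toLinearMap

theorem mem_gaussChaos {q : ℕ} {f : Lp ℝ 2 (stdGaussian E)} :
    f ∈ gaussChaos E q ↔ ∀ s : unitInterval, mehlerOp s f = ((s : ℝ) ^ q) • f := by
  simp [gaussChaos, Submodule.mem_iInf, sub_eq_zero]

theorem isClosed_gaussChaos (q : ℕ) :
    IsClosed (gaussChaos E q : Set (Lp ℝ 2 (stdGaussian E))) := by
  unfold gaussChaos
  rw [Submodule.coe_iInf]
  exact isClosed_iInter fun s => ContinuousLinearMap.isClosed_ker _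

instance (q : ℕ) : (gaussChaos E q).HasOrthogonalProjection := by
  have : CompleteSpace (gaussChaos E q) := (isClosed_gaussChaos q).completeSpace_coe
  infer_instance

/-- The orthogonal projection onto the `q`-th chaos. -/
def gaussProj (q : ℕ) : Lp ℝ 2 (stdGaussian E) →L[ℝ] Lp ℝ 2 (stdGaussian E) :=
  (gaussChaos E q).starProjection

theorem gaussProj_mem (q : ℕ) (f : Lp ℝ 2 (stdGaussian E)) : gaussProj q f ∈ gaussChaos E q :=
  Submodule.starProjection_apply_mem _ _

theorem inner_gaussProj {q : ℕ} (f : Lp ℝ 2 (stdGaussian E)) {g : Lp ℝ 2 (stdGaussian E)}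
    (hg : g ∈ gaussChaos E q) : ⟪gaussProj q f, g⟫ = ⟪f, g⟫ := by
  have h := Submodule.inner_starProjection_left_eq_right (gaussChaos E q) f g
  rw [Submodule.starProjection_eq_self_iff.2 hg] at h
  exact h

theorem inner_gaussProj_self (q : ℕ) (f : Lp ℝ 2 (stdGaussian E)) :
    ⟪gaussProj q f, f⟫ = ‖gaussProj q f‖ ^ 2 := by
  rw [real_inner_comm, ← inner_gaussProj f (gaussProj_mem q f), real_inner_self_eq_norm_sq]

theorem inner_gaussChaos_of_ne {p q : ℕ} (hpq : p ≠ q) {f g : Lp ℝ 2 (stdGaussian E)}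
    (hf : f ∈ gaussChaos E p) (hg : g ∈ gaussChaos E q) : ⟪f, g⟫ = 0 := by
  -- One value of `s` suffices: the powers of 1/2 are distinct, and eigenvectors of a self-adjoint
  -- operator with distinct eigenvalues are orthogonal.
  have h := inner_mehlerOp_comm ⟨1 / 2, by norm_num, by norm_num⟩ f g
  rw [mem_gaussChaos.1 hf, mem_gaussChaos.1 hg, inner_smul_left, inner_smul_right] at h
  have h2 : ((1 : ℝ) / 2) ^ q ≠ (1 / 2) ^ p := fun h =>
    hpq (pow_right_injective₀ (by norm_num) (by norm_num) h).symm
  have h3 : (((1 : ℝ) / 2) ^ q - (1 / 2) ^ p) * ⟪f, g⟫ = 0 := by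
    simp only [RCLike.conj_to_real] at h
    linear_combination h
  exact (mul_eq_zero.1 h3).resolve_left (sub_ne_zero.2 h2)

theorem norm_sum_gaussProj_sq (S : Finset ℕ) (f : Lp ℝ 2 (stdGaussian E)) :
    ‖∑ q ∈ S, gaussProj q f‖ ^ 2 = ∑ q ∈ S, ‖gaussProj q f‖ ^ 2 := by
  rw [← real_inner_self_eq_norm_sq, sum_inner]
  refine Finset.sum_congr rfl fun p hp => ?_
  rw [inner_sum, Finset.sum_eq_single p, real_inner_self_eq_norm_sq]
  · intro q _ hqp
    exact inner_gaussChaos_of_ne hqp.symm (gaussProj_mem p f) (gaussProj_mem q f)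
  · exact fun h => absurd hp h

/-- Bessel's inequality for the chaos projections. -/
theorem norm_sum_gaussProj_le (S : Finset ℕ) (f : Lp ℝ 2 (stdGaussian E)) :
    ‖∑ q ∈ S, gaussProj q f‖ ≤ ‖f‖ := by
  have h1 : ‖∑ q ∈ S, gaussProj q f‖ ^ 2 = ⟪∑ q ∈ S, gaussProj q f, f⟫ := by
    rw [norm_sum_gaussProj_sq, sum_inner]
    simp_rw [inner_gaussProj_self]
  have h2 := real_inner_le_norm (∑ q ∈ S, gaussProj q f) f
  by_contra! h
  nlinarith [norm_nonneg f]

/-- Jointly Gaussian vectors respect the chaos decomposition. -/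
theorem IsGaussPair.adjoint_pull_mem [IsProbabilityMeasure P]
    {φ : Ω → E} {ψ : Ω → F} {B : E → F → ℝ}
    (h : IsGaussPair P φ ψ B) (hB : ∀ t τ (c : ℝ), B t (c • τ) = c * B t τ)
    (hB' : ∀ t τ (c : ℝ), B (c • t) τ = c * B t τ) {q : ℕ} {g : Lp ℝ 2 (stdGaussian F)}
    (hg : g ∈ gaussChaos F q) :
    ContinuousLinearMap.adjoint (pull h.left).toContinuousLinearMap (pull h.right g) ∈
      gaussChaos E q := by
  rw [mem_gaussChaos] at hg ⊢
  intro s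
  refine ext_inner_left ℝ fun f => ?_
  -- Tested against an arbitrary `f`, the operator travels from `f` across the pair to `g`, where it
  -- acts as `s ^ q`.
  rw [ArithWave.inner_mehlerOp_comm, ContinuousLinearMap.adjoint_inner_right, inner_smul_right,
    ContinuousLinearMap.adjoint_inner_right]
  refine (h.inner_mehlerOp_comm hB hB' s f g).symm.trans ?_
  rw [hg, map_smul, inner_smul_right]
  rfl

/-- For jointly Gaussian vectors, only equal chaoses interact. -/
theorem IsGaussPair.inner_gaussProj [IsProbabilityMeasure P]
    {φ : Ω → E} {ψ : Ω → F} {B : E → F → ℝ}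
    (h : IsGaussPair P φ ψ B) (hB : ∀ t τ (c : ℝ), B t (c • τ) = c * B t τ)
    (hB' : ∀ t τ (c : ℝ), B (c • t) τ = c * B t τ) {q : ℕ} (f : Lp ℝ 2 (stdGaussian E))
    {g : Lp ℝ 2 (stdGaussian F)} (hg : g ∈ gaussChaos F q) :
    ⟪pull h.left (gaussProj q f), pull h.right g⟫ = ⟪pull h.left f, pull h.right g⟫ := by
  have key : ∀ f, ⟪f, ContinuousLinearMap.adjoint (pull h.left).toContinuousLinearMap
      (pull h.right g)⟫ = ⟪pull h.left f, pull h.right g⟫ := fun f =>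
    ContinuousLinearMap.adjoint_inner_right _ _ _
  rw [← key, ← key, ArithWave.inner_gaussProj f (h.adjoint_pull_mem hB hB' hg)]

end GaussianPairs

/-! ### Gebelein's inequality and decay of chaos covariances -/

section Coupling

open scoped RealInnerProductSpace

variable {Ω : Type*} [MeasurableSpace Ω] {P : Measure Ω}
  {E F G : Type*}
  [NormedAddCommGroup E] [InnerProductSpace ℝ E] [FiniteDimensional ℝ E] [MeasurableSpace E]
  [BorelSpace E]
  [NormedAddCommGroup F] [InnerProductSpace ℝ F] [FiniteDimensional ℝ F] [MeasurableSpace F]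
  [BorelSpace F]
  [NormedAddCommGroup G] [InnerProductSpace ℝ G] [FiniteDimensional ℝ G] [MeasurableSpace G]
  [BorelSpace G]

/-- The square root is taken in an eigenbasis. Symmetry and the norm identity are all that the
characteristic function computation of the coupling requires. -/
theorem exists_symmetric_sqrt (T : F →ₗ[ℝ] F) (hT : T.IsSymmetric) (h0 : ∀ τ, 0 ≤ ⟪T τ, τ⟫) :
    ∃ C : F →ₗ[ℝ] F, (∀ x y, ⟪C x, y⟫ = ⟪x, C y⟫) ∧ ∀ τ, ‖C τ‖ ^ 2 = ⟪T τ, τ⟫ := by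
  set b := hT.eigenvectorBasis rfl
  set ev := hT.eigenvalues rfl
  have hev : ∀ i, T (b i) = ev i • b i := fun i => hT.apply_eigenvectorBasis rfl i
  have hpos : ∀ i, 0 ≤ ev i := fun i => by
    have := h0 (b i)
    rw [hev, inner_smul_left, real_inner_self_eq_norm_sq, b.norm_eq_one] at this
    simpa using this
  let C : F →ₗ[ℝ] F := ∑ i, √(ev i) • (innerₛₗ ℝ (b i)).smulRight (b i)
  have hC : ∀ x, C x = ∑ i, √(ev i) • ⟪b i, x⟫ • b i := fun x => by
    simp [C, LinearMap.sum_apply]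
  refine ⟨C, fun x y => ?_, fun τ => ?_⟩
  · rw [hC, hC, sum_inner, inner_sum]
    refine Finset.sum_congr rfl fun i _ => ?_
    simp only [inner_smul_left, inner_smul_right, real_inner_comm x (b i), conj_trivial]
    ring
  · have h1 : ∀ i, ⟪b i, C τ⟫ = √(ev i) * ⟪b i, τ⟫ := by
      intro i
      rw [hC, inner_sum, Finset.sum_eq_single i]
      · simp [inner_smul_right]
      · intro j _ hj
        rw [inner_smul_right, inner_smul_right, b.inner_eq_zero hj.symm]; simp
      · simp
    have h2 : ∀ i, ⟪b i, T τ⟫ = ev i * ⟪b i, τ⟫ := by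
      intro i
      rw [← hT, hev, inner_smul_left]; simp
    rw [← b.sum_sq_norm_inner_right, ← b.sum_inner_mul_inner]
    refine Finset.sum_congr rfl fun i _ => ?_
    rw [h1, real_inner_comm (b i), h2, Real.norm_eq_abs, sq_abs, mul_pow, Real.sq_sqrt (hpos i)]
    ring

/-- Every contraction is the cross covariance of two jointly Gaussian vectors. -/
theorem exists_isGaussPair (A : E →L[ℝ] F) (hA : ‖A‖ ≤ 1) :
    ∃ ψ : E × F → F, IsGaussPair ((stdGaussian E).prod (stdGaussian F)) Prod.fst ψ
      (fun t τ => ⟪A t, τ⟫) := by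
  set A' := ContinuousLinearMap.adjoint A
  have hA' : ‖A'‖ ≤ 1 := by simpa [A'] using hA
  -- The second vector will be `A x + C y` with `y` independent noise; `C` is a root of `1 - A A*`,
  -- exactly the covariance that `A x` lacks to be standard.
  obtain ⟨C, hC, hC'⟩ := exists_symmetric_sqrt (LinearMap.id - (A.comp A').toLinearMap)
    (by
      intro x y
      simp [inner_sub_left, inner_sub_right, A', ← ContinuousLinearMap.adjoint_inner_left])
    (by
      intro τ
      have h1 : ⟪A (A' τ), τ⟫ = ‖A' τ‖ ^ 2 := by
        rw [← real_inner_self_eq_norm_sq]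
        exact (ContinuousLinearMap.adjoint_inner_right A (A' τ) τ).symm
      have h2 : ‖A' τ‖ ≤ ‖τ‖ := by
        simpa using A'.le_of_opNorm_le hA' τ
      simp only [LinearMap.sub_apply, inner_sub_left, LinearMap.id_apply,
        ContinuousLinearMap.coe_coe, ContinuousLinearMap.comp_apply, h1,
        real_inner_self_eq_norm_sq]
      nlinarith [norm_nonneg (A' τ)])
  have hCc : Continuous C := C.continuous_of_finiteDimensional
  refine ⟨fun z => A z.1 + C z.2, IsGaussPair.of_charFun measurable_fst
    (Continuous.measurable (by fun_prop)) (by simp) (by simp) fun t τ => ?_⟩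
  have h1 : ∀ z : E × F, Complex.exp (((⟪z.1, t⟫ + ⟪A z.1 + C z.2, τ⟫ : ℝ) : ℂ) * Complex.I) =
      Complex.exp ((⟪z.1, t + A' τ⟫ : ℂ) * Complex.I) *
      Complex.exp ((⟪z.2, C τ⟫ : ℂ) * Complex.I) := by
    intro z
    rw [← Complex.exp_add, ← hC, inner_add_right, inner_add_left,
      ContinuousLinearMap.adjoint_inner_right]
    push_cast
    ring_nf
  simp_rw [h1]
  rw [integral_prod_mul (fun x => Complex.exp ((⟪x, t + A' τ⟫ : ℂ) * Complex.I))
    (fun y => Complex.exp ((⟪y, C τ⟫ : ℂ) * Complex.I)), integral_exp_stdGaussian,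
    integral_exp_stdGaussian, ← Complex.exp_add, ← Complex.ofReal_add, hC']
  congr 2
  have h2 : ⟪A (A' τ), τ⟫ = ‖A' τ‖ ^ 2 := by
    rw [← real_inner_self_eq_norm_sq]
    exact (ContinuousLinearMap.adjoint_inner_right A (A' τ) τ).symm
  simp only [LinearMap.sub_apply, inner_sub_left, LinearMap.id_apply,
        ContinuousLinearMap.coe_coe, ContinuousLinearMap.comp_apply, h2,
        real_inner_self_eq_norm_sq]
  rw [norm_add_sq_real, ContinuousLinearMap.adjoint_inner_right]
  ring

/-- Gebelein's inequality on the `q`-th chaos. -/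
theorem IsGaussPair.abs_inner_le [IsProbabilityMeasure P] {φ : Ω → E} {ψ : Ω → F}
    {s : unitInterval} {A : E →L[ℝ] F} (hA : ‖A‖ ≤ 1)
    (h : IsGaussPair P φ ψ (fun t τ => s * ⟪A t, τ⟫)) {q : ℕ}
    (f : Lp ℝ 2 (stdGaussian E)) {g : Lp ℝ 2 (stdGaussian F)} (hg : g ∈ gaussChaos F q) :
    |⟪pull h.left f, pull h.right g⟫| ≤ (s : ℝ) ^ q * (‖f‖ * ‖g‖) := by
  -- The pair with covariance `s A` is the pair with covariance `A` after the Mehler operator acts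
  -- on `g`. On the q-th chaos this is the factor `s ^ q`, and Cauchy-Schwarz handles the rest.
  obtain ⟨ψ', h'⟩ := exists_isGaussPair A hA
  have := h'.inner_mehlerOp_right h (by simp [inner_smul_right]) (by simp) f g
  rw [← this, mem_gaussChaos.1 hg, map_smul, inner_smul_right, abs_mul,
    abs_of_nonneg (pow_nonneg s.2.1 q)]
  refine mul_le_mul_of_nonneg_left ?_ (pow_nonneg s.2.1 q)
  refine (abs_real_inner_le_norm _ _).trans ?_
  simp

/-- By self-adjointness, `s^q ‖Pf‖²` is the inner product of `M_s f` with `Pf`. Thus a bound on the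
smoothed function alone limits the growth of the chaos components to `s^(-q)`, even for families
that are unbounded in `L²`. -/
theorem norm_gaussProj_le (s : unitInterval) (q : ℕ) (f : Lp ℝ 2 (stdGaussian E)) :
    (s : ℝ) ^ q * ‖gaussProj q f‖ ≤ ‖mehlerOp s f‖ := by
  have h1 : (s : ℝ) ^ q * ‖gaussProj q f‖ ^ 2 = ⟪mehlerOp s f, gaussProj q f⟫ := by
    rw [← inner_mehlerOp_comm, mem_gaussChaos.1 (gaussProj_mem q f), inner_smul_right,
      real_inner_comm, inner_gaussProj_self]
  have h2 := real_inner_le_norm (mehlerOp s f) (gaussProj q f)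
  rcases (norm_nonneg (gaussProj q f)).eq_or_lt with h | h
  · rw [← h]; simp
  · refine le_of_mul_le_mul_right ?_ h
    nlinarith

/-- `L` is a co-isometry. -/
def IsCoisometry (L : E →L[ℝ] F) : Prop := ∀ τ, ‖ContinuousLinearMap.adjoint L τ‖ = ‖τ‖

/-- Each marginal is standard because `L L* = 1`, and the cross covariance of two linear images of
one Gaussian vector is `M L*`. -/
theorem isGaussPair_of_coisometry {L : E →L[ℝ] F} {M : E →L[ℝ] G} (hL : IsCoisometry L)
    (hM : IsCoisometry M) : IsGaussPair (stdGaussian E) L M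
      (fun t τ => ⟪(M.comp (ContinuousLinearMap.adjoint L)) t, τ⟫) := by
  refine IsGaussPair.of_charFun (by fun_prop) (by fun_prop) (by simp) (by simp) fun t τ => ?_
  have h1 : ∀ x : E, ⟪L x, t⟫ + ⟪M x, τ⟫ =
      ⟪x, ContinuousLinearMap.adjoint L t + ContinuousLinearMap.adjoint M τ⟫ := by
    intro x
    rw [inner_add_right, ContinuousLinearMap.adjoint_inner_right,
      ContinuousLinearMap.adjoint_inner_right]
  simp_rw [h1]
  rw [integral_exp_stdGaussian, norm_add_sq_real, hL, hM, ContinuousLinearMap.adjoint_inner_right]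
  rfl

theorem isCoisometry_id : IsCoisometry (ContinuousLinearMap.id ℝ E) := fun τ => by
  rw [← ContinuousLinearMap.one_def, ← ContinuousLinearMap.star_eq_adjoint, star_one]
  rfl

theorem IsCoisometry.measurePreserving {L : E →L[ℝ] F} (hL : IsCoisometry L) :
    MeasurePreserving L (stdGaussian E) (stdGaussian F) :=
  (isGaussPair_of_coisometry hL hL).left

/-- The identity and `L` form a Gaussian pair. Hence pulling back sends the q-th chaos into the q-th
chaos, and the pullback of the remainder stays orthogonal to it. -/
theorem gaussProj_pull {L : E →L[ℝ] F} (hL : IsCoisometry L) (q : ℕ)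
    (f : Lp ℝ 2 (stdGaussian F)) :
    gaussProj q (pull hL.measurePreserving f) = pull hL.measurePreserving (gaussProj q f) := by
  have h := isGaussPair_of_coisometry (isCoisometry_id (E := E)) hL
  apply Submodule.eq_starProjection_of_mem_orthogonal
  · have := h.adjoint_pull_mem (by simp [inner_smul_right]) (by simp [inner_smul_left])
      (gaussProj_mem q f)
    convert this using 1
    refine ext_inner_left ℝ fun g => ?_
    rw [ContinuousLinearMap.adjoint_inner_right]
    conv_lhs => rw [← pull_id g]
    rfl
  · rw [Submodule.mem_orthogonal']
    intro g hg
    rw [inner_sub_left, sub_eq_zero]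
    have := h.symm.inner_gaussProj (fun t τ c => by simp [inner_smul_left])
      (fun t τ c => by simp [inner_smul_right]) f hg
    have h2 : pull h.left g = g := pull_id g
    rw [h2] at this
    exact this.symm

/-- The covariance of the chaos components of functions of two jointly Gaussian vectors decays
geometrically in the correlation. -/
theorem abs_inner_gaussProj_pull_le {L M : E →L[ℝ] F} (hL : IsCoisometry L) (hM : IsCoisometry M)
    {ρ : unitInterval} (hρ : ‖M.comp (ContinuousLinearMap.adjoint L)‖ ≤ ρ) (q : ℕ)
    (f g : Lp ℝ 2 (stdGaussian F)) :
    |⟪gaussProj q (pull hL.measurePreserving f), pull hM.measurePreserving g⟫| ≤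
      (ρ : ℝ) ^ q * (‖gaussProj q f‖ * ‖gaussProj q g‖) := by
  have h0 : ⟪gaussProj q (pull hL.measurePreserving f), pull hM.measurePreserving g⟫ =
      ⟪pull hL.measurePreserving (gaussProj q f), pull hM.measurePreserving (gaussProj q g)⟫ := by
    rw [← gaussProj_pull hM, ← gaussProj_pull hL, real_inner_comm,
      real_inner_comm (gaussProj q (pull hM.measurePreserving g)),
      ArithWave.inner_gaussProj _ (gaussProj_mem _ _)]
  rw [h0]
  set A := M.comp (ContinuousLinearMap.adjoint L)
  -- The correlation is written as `ρ` times a contraction, the form required by Gebelein's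
  -- inequality. The case `ρ = 0` cannot be divided out and is treated apart.
  obtain ⟨A', hA', hA⟩ : ∃ A' : F →L[ℝ] F, ‖A'‖ ≤ 1 ∧ A = (ρ : ℝ) • A' := by
    rcases ρ.2.1.eq_or_lt with h | h
    · refine ⟨0, by simp, ?_⟩
      rw [← h, norm_le_zero_iff] at hρ
      simp [hρ]
    · refine ⟨(ρ : ℝ)⁻¹ • A, ?_, ?_⟩
      · rw [norm_smul, norm_inv, Real.norm_of_nonneg h.le]
        rw [inv_mul_le_iff₀ h]; simpa using hρ
      · rw [smul_smul, mul_inv_cancel₀ h.ne', one_smul]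
  have h := isGaussPair_of_coisometry hL hM
  have hB : (fun t τ => ⟪(M.comp (ContinuousLinearMap.adjoint L)) t, τ⟫) =
      fun t τ => (ρ : ℝ) * ⟪A' t, τ⟫ := by
    funext t τ
    change ⟪A t, τ⟫ = _
    rw [hA]
    simp [inner_smul_left]
  rw [hB] at h
  exact h.abs_inner_le hA' _ (gaussProj_mem q g)

end Coupling

/-! ### Hermite polynomials as Mehler eigenfunctions -/

section HermiteChaos

open Polynomial

theorem integrable_eval_gaussianReal (Q : ℝ[X]) :
    Integrable (fun y => Q.eval y) (gaussianReal 0 1) := by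
  simp_rw [Polynomial.eval_eq_sum_range]
  refine integrable_finsetSum _ fun i _ => ?_
  refine Integrable.const_mul ?_ _
  exact integrable_pow_of_mem_interior_integrableExpSet
    (by simp [integrableExpSet_fun_id_gaussianReal]) i

/-- Gaussian integration by parts for polynomials. -/
theorem integral_mul_eval_gaussianReal (Q : ℝ[X]) :
    ∫ y, y * Q.eval y ∂(gaussianReal 0 1) = ∫ y, (derivative Q).eval y ∂(gaussianReal 0 1) := by
  have hi : ∀ R : ℝ[X], Integrable (fun y => gaussianPDFReal 0 1 y • R.eval y) := by
    intro R
    have := integrable_eval_gaussianReal R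
    rw [gaussianReal_of_var_ne_zero _ one_ne_zero, integrable_withDensity_iff_integrable_smul'
      (measurable_gaussianPDF 0 1) (by simp [gaussianPDF_lt_top])] at this
    simpa only [toReal_gaussianPDF] using this
  have hd : ∀ y, HasDerivAt (gaussianPDFReal 0 1) (-(y * gaussianPDFReal 0 1 y)) y := by
    intro y
    have h1 : gaussianPDFReal 0 1 = fun y => (√(2 * Real.pi * 1))⁻¹ * Real.exp (-y ^ 2 / 2) := by
      funext y
      simp [gaussianPDFReal]
    have h2 : HasDerivAt (fun y : ℝ => -y ^ 2 / 2) (-y) y :=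
      (((hasDerivAt_pow 2 y).neg).div_const 2).congr_deriv (by norm_num; ring)
    rw [h1]
    exact ((h2.exp).const_mul ((√(2 * Real.pi * 1))⁻¹)).congr_deriv (by ring)
  have key := integral_eq_zero_of_hasDerivAt_of_integrable
    (f := fun y => gaussianPDFReal 0 1 y • Q.eval y)
    (f' := fun y => gaussianPDFReal 0 1 y • (derivative Q - X * Q).eval y) (fun y =>
      ((hd y).mul (Q.hasDerivAt y)).congr_deriv (by
        rw [eval_sub, eval_mul, eval_X, smul_eq_mul]; ring)) (hi _) (hi _)
  rw [← integral_gaussianReal_eq_integral_smul one_ne_zero] at key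
  simp only [eval_sub, eval_mul, eval_X] at key
  rw [integral_sub (integrable_eval_gaussianReal _)] at key
  · linarith
  · exact (integrable_eval_gaussianReal (X * Q)).congr
      (Filter.Eventually.of_forall fun y => by simp only [eval_mul, eval_X])

theorem derivative_hermite_succ (p : ℕ) :
    derivative (hermite (p + 1)) = (p + 1 : ℤ[X]) * hermite p := by
  induction p with
  | zero => simp
  | succ p ih =>
    rw [hermite_succ (p + 1), derivative_sub, derivative_mul, ih, derivative_X, hermite_succ p]
    simp only [derivative_mul, derivative_add, derivative_natCast, derivative_one]
    push_cast
    ring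

/-- Mehler's formula for Hermite polynomials. -/
theorem integral_hermite_mix {s r : ℝ} (h : r ^ 2 = 1 - s ^ 2) (p : ℕ) (t : ℝ) :
    ∫ y, aeval (s * t + r * y) (hermite p) ∂(gaussianReal 0 1) =
      s ^ p * aeval t (hermite p) := by
  have hint : ∀ p, Integrable (fun y => aeval (s * t + r * y) (hermite p)) (gaussianReal 0 1) := by
    intro p
    have := integrable_eval_gaussianReal
      (((hermite p).map (Int.castRingHom ℝ)).comp (C (s * t) + C r * X))
    refine this.congr (Filter.Eventually.of_forall fun y => ?_)
    simp [aeval_def, eval_map, algebraMap_int_eq]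
  induction p using Nat.twoStepInduction with
  | zero => simp
  | one =>
    simp only [hermite_one, aeval_X, pow_one]
    have h2 : Integrable (fun y : ℝ => y) (gaussianReal 0 1) := by
      simpa using integrable_eval_gaussianReal X
    rw [integral_add (integrable_const _) (h2.const_mul r), integral_const,
      integral_const_mul r (fun y : ℝ => y), integral_id_gaussianReal]
    simp
  | more p ih0 ih1 =>
    -- In the three-term recurrence, the part `s t` of the argument gives `s t` times the hypothesis
    -- for `p + 1`; integration by parts turns the part `r y` into `r² (p + 1)` times the hypothesis
    -- for `p`. Since `r² - 1 = -s²`, the sum is again the recurrence, multiplied by `s ^ (p + 2)`.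
    have e : ∀ x : ℝ, aeval x (hermite (p + 2)) =
        x * aeval x (hermite (p + 1)) - (p + 1) * aeval x (hermite p) := by
      intro x
      rw [hermite_succ (p + 1), derivative_hermite_succ]
      simp
    have stein := integral_mul_eval_gaussianReal
      (((hermite (p + 1)).map (Int.castRingHom ℝ)).comp (C (s * t) + C r * X))
    have e1 : ∀ y, eval y (((hermite (p + 1)).map (Int.castRingHom ℝ)).comp
        (C (s * t) + C r * X)) = aeval (s * t + r * y) (hermite (p + 1)) := fun y => by
      simp [aeval_def, eval_map, algebraMap_int_eq]
    have e2 : ∀ y, eval y (derivative (((hermite (p + 1)).map (Int.castRingHom ℝ)).comp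
        (C (s * t) + C r * X))) = r * (p + 1) * aeval (s * t + r * y) (hermite p) := fun y => by
      rw [derivative_comp, derivative_map, derivative_hermite_succ]
      simp [aeval_def, eval_map, algebraMap_int_eq]
      ring
    simp_rw [e1, e2] at stein
    have hy : Integrable (fun y => y * aeval (s * t + r * y) (hermite (p + 1)))
        (gaussianReal 0 1) := by
      have := integrable_eval_gaussianReal
        (X * ((hermite (p + 1)).map (Int.castRingHom ℝ)).comp (C (s * t) + C r * X))
      refine this.congr (Filter.Eventually.of_forall fun y => ?_)
      simp only [eval_mul, e1, eval_X]
    simp_rw [e, add_mul _ _ (aeval _ (hermite (p + 1))), mul_assoc r]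
    rw [integral_sub, integral_add, integral_const_mul, integral_const_mul, integral_const_mul,
      stein, integral_const_mul, ih0, ih1]
    · linear_combination ((p : ℝ) + 1) * s ^ p * aeval t (hermite p) * h
    · exact (hint _).const_mul _
    · exact hy.const_mul _
    · exact ((hint _).const_mul _).add (hy.const_mul _)
    · exact (hint _).const_mul _

/-- The multivariate Hermite polynomials `∏_j H_{p_j}(x_j)`. -/
def hermiteProd {k : ℕ} (p : Fin k → ℕ) (x : EuclideanSpace ℝ (Fin k)) : ℝ :=
  ∏ j, aeval (x j) (hermite (p j))

theorem continuous_hermiteProd {k : ℕ} (p : Fin k → ℕ) : Continuous (hermiteProd p) := by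
  unfold hermiteProd
  exact continuous_finsetProd _ fun j _ => by fun_prop

/-- The Mehler integral factorises over the coordinates, and the factors `s ^ p j` multiply to `s ^
∑ p j`. -/
theorem hermiteProd_mem_gaussChaos {k : ℕ} (p : Fin k → ℕ)
    (h : MemLp (hermiteProd p) 2 (stdGaussian (EuclideanSpace ℝ (Fin k)))) :
    h.toLp ∈ gaussChaos (EuclideanSpace ℝ (Fin k)) (∑ j, p j) := by
  rw [mem_gaussChaos]
  intro s
  refine Lp.ext ?_
  have h1 : ∀ᵐ x ∂(stdGaussian (EuclideanSpace ℝ (Fin k))),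
      ∀ᵐ y ∂(stdGaussian (EuclideanSpace ℝ (Fin k))),
        h.toLp _ (mix s (x, y)) = hermiteProd p (mix s (x, y)) :=
    Measure.ae_ae_of_ae_prod ((measurePreserving_mix s).quasiMeasurePreserving.ae h.coeFn_toLp)
  filter_upwards [coeFn_mehlerOp s h.toLp, h1, Lp.coeFn_smul ((s : ℝ) ^ (∑ j, p j)) h.toLp,
    h.coeFn_toLp] with x hx1 hx2 hx3 hx4
  have hc : Continuous fun y => hermiteProd p (mix s (x, y)) :=
    (continuous_hermiteProd p).comp ((continuous_mix s).comp (by fun_prop))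
  rw [hx1, hx3, integral_congr_ae hx2, Pi.smul_apply, hx4, ← map_pi_eq_stdGaussian, integral_map
    (by fun_prop) hc.aestronglyMeasurable]
  simp only [hermiteProd, mix, PiLp.add_apply, PiLp.smul_apply, smul_eq_mul]
  rw [integral_fintype_prod_eq_prod (fun j (y : ℝ) =>
    aeval ((s : ℝ) * x j + √(1 - (s : ℝ) ^ 2) * y) (hermite (p j)))]
  simp_rw [integral_hermite_mix (sq_sqrt_one_sub_sq s)]
  rw [Finset.prod_mul_distrib, Finset.prod_pow_eq_pow_sum]

end HermiteChaos

/-! ### The Gaussian Hilbert space consists of centred Gaussian variables -/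

section GaussianHilbert

open scoped RealInnerProductSpace

variable {Ω : Type*} [MeasurableSpace Ω] {P : Measure Ω}

theorem norm_exp_mul_I_sub_le (a b : ℝ) :
    ‖Complex.exp (a * Complex.I) - Complex.exp (b * Complex.I)‖ ≤ |a - b| := by
  have h : Complex.exp (a * Complex.I) - Complex.exp (b * Complex.I) =
      Complex.exp (b * Complex.I) * (Complex.exp (Complex.I * ((a - b : ℝ) : ℂ)) - 1) := by
    rw [mul_sub, ← Complex.exp_add]
    push_cast
    ring_nf
  rw [h, norm_mul, Complex.norm_exp_ofReal_mul_I, one_mul]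
  exact Real.norm_exp_I_mul_ofReal_sub_one_le

theorem integral_abs_le_norm [IsProbabilityMeasure P] (f : Lp ℝ 2 P) : ∫ ω, |f ω| ∂P ≤ ‖f‖ := by
  have h1 : ∫ ω, |f ω| ∂P = (eLpNorm f 1 P).toReal := by
    rw [eLpNorm_one_eq_lintegral_enorm]
    exact integral_norm_eq_lintegral_enorm (Lp.aestronglyMeasurable f)
  rw [h1, Lp.norm_def]
  exact ENNReal.toReal_mono (Lp.eLpNorm_ne_top f)
    (eLpNorm_le_eLpNorm_of_exponent_le (by norm_num) (Lp.aestronglyMeasurable f))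

theorem integrable_exp_mul_I [IsFiniteMeasure P] {f : Ω → ℝ} (hf : AEStronglyMeasurable f P) :
    Integrable (fun ω => Complex.exp (f ω * Complex.I)) P := by
  refine Integrable.of_bound (C := 1) ?_ (Filter.Eventually.of_forall fun ω => ?_)
  · exact (by fun_prop : Continuous fun x : ℝ => Complex.exp (x * Complex.I)).comp_aestronglyMeasurable
      hf
  · rw [Complex.norm_exp_ofReal_mul_I]

/-- Makes "has the characteristic function of a centred Gaussian" a closed condition in `L²`, so
that it passes from the span to its closure. -/
theorem continuous_integral_exp [IsProbabilityMeasure P] :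
    Continuous fun f : Lp ℝ 2 P => ∫ ω, Complex.exp (f ω * Complex.I) ∂P := by
  refine LipschitzWith.continuous (K := 1) (LipschitzWith.of_dist_le_mul fun f g => ?_)
  rw [dist_eq_norm, dist_eq_norm, ← integral_sub (integrable_exp_mul_I (Lp.aestronglyMeasurable f))
    (integrable_exp_mul_I (Lp.aestronglyMeasurable g))]
  refine (norm_integral_le_integral_norm _).trans ?_
  rw [NNReal.coe_one, one_mul]
  have h1 : ∫ ω, |f ω - g ω| ∂P = ∫ ω, |(f - g) ω| ∂P := by
    refine integral_congr_ae ?_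
    filter_upwards [Lp.coeFn_sub f g] with ω h
    rw [h, Pi.sub_apply]
  refine le_trans ?_ (h1.le.trans (integral_abs_le_norm (f - g)))
  refine integral_mono ?_ ?_ fun ω => norm_exp_mul_I_sub_le _ _
  · exact ((integrable_exp_mul_I (Lp.aestronglyMeasurable f)).sub
        (integrable_exp_mul_I (Lp.aestronglyMeasurable g))).norm
  · exact ((Lp.memLp f).integrable (by norm_num) |>.sub
        ((Lp.memLp g).integrable (by norm_num))).abs

theorem integral_exp_of_hasGaussianLaw {X : Ω → ℝ} (hX : HasGaussianLaw X P)
    (h0 : ∫ ω, X ω ∂P = 0) (f : Lp ℝ 2 P) (hf : f =ᵐ[P] X) :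
    ∫ ω, Complex.exp (f ω * Complex.I) ∂P = Complex.exp ((-‖f‖ ^ 2 / 2 : ℝ) : ℂ) := by
  have := hX.isProbabilityMeasure
  have h1 : Var[X; P] = ‖f‖ ^ 2 := by
    rw [variance_of_integral_eq_zero hX.aemeasurable h0, ← real_inner_self_eq_norm_sq, L2.inner_def]
    refine integral_congr_ae ?_
    filter_upwards [hf] with ω h
    simp [h, sq]
  have h2 := charFun_gaussianReal (μ := 0) (v := Var[X; P].toNNReal) 1
  rw [← h0, ← hX.map_eq_gaussianReal, h0, charFun_apply, integral_map hX.aemeasurable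
    (Continuous.aestronglyMeasurable (by fun_prop))] at h2
  calc ∫ ω, Complex.exp (f ω * Complex.I) ∂P
      = ∫ ω, Complex.exp ((⟪X ω, 1⟫ : ℝ) * Complex.I) ∂P := by
        refine integral_congr_ae ?_
        filter_upwards [hf] with ω h
        simp [h]
    _ = _ := by
        rw [h2, h1]
        congr 1
        rw [Real.coe_toNNReal _ (sq_nonneg _)]
        push_cast
        ring

namespace IsGaussianFamily

variable {v : (Fin 2 → ℤ) → Ω → ℂ}

theorem hasGaussianLaw [IsProbabilityMeasure P] (hv : IsGaussianFamily P v) (l : Fin 2 → ℤ) :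
    HasGaussianLaw (v l) P := by
  have h1 : HasGaussianLaw (fun ω => (v l ω).re) P :=
    ⟨by rw [hv.law_re]; infer_instance⟩
  have h2 : HasGaussianLaw (fun ω => (v l ω).im) P :=
    ⟨by rw [hv.law_im]; infer_instance⟩
  have h3 := (IndepFun.hasGaussianLaw h1 h2 (hv.indep_re_im l)).map_fun
    (Complex.equivRealProdCLM.symm : ℝ × ℝ →L[ℝ] ℂ)
  refine h3.congr (Filter.Eventually.of_forall fun ω => ?_)
  simp [Complex.ext_iff]

/-- The real and imaginary parts of the coefficients. -/
def part (v : (Fin 2 → ℤ) → Ω → ℂ) (t : (Fin 2 → ℤ) × Bool) (ω : Ω) : ℝ :=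
  if t.2 then (v t.1 ω).re else (v t.1 ω).im

theorem isGaussianProcess_part [IsProbabilityMeasure P] (hv : IsGaussianFamily P v) :
    IsGaussianProcess (part v) P := by
  have h1 : IsGaussianProcess v P := ⟨fun I =>
    iIndepFun.hasGaussianLaw (fun i : I => hv.hasGaussianLaw i)
      (hv.indep.precomp Subtype.val_injective)⟩
  have h2 := (h1.comp_right (Prod.fst : (Fin 2 → ℤ) × Bool → (Fin 2 → ℤ))).comp_left
    (fun t => if t.2 then Complex.reCLM else Complex.imCLM)
  have h3 : part v = fun t ω => (if t.2 then Complex.reCLM else Complex.imCLM : ℂ →L[ℝ] ℝ)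
      ((v ∘ Prod.fst) t ω) := by
    funext t ω
    unfold part
    split_ifs <;> simp
  rw [h3]
  exact h2

theorem integral_part [IsProbabilityMeasure P] (hv : IsGaussianFamily P v)
    (t : (Fin 2 → ℤ) × Bool) : ∫ ω, part v t ω ∂P = 0 := by
  have key : ∀ X : Ω → ℝ, Measurable X → P.map X = gaussianReal 0 1 → ∫ ω, X ω ∂P = 0 := by
    intro X hX h
    have := integral_map hX.aemeasurable (f := id) (μ := P) (by fun_prop)
    rw [h] at this
    simpa using this.symm
  obtain ⟨l, b⟩ := t
  cases b
  · simpa [part] using key _ (Complex.measurable_im.comp (hv.measurable l)) (hv.law_im l)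
  · simpa [part] using key _ (Complex.measurable_re.comp (hv.measurable l)) (hv.law_re l)

theorem hasGaussianLaw_of_mem_span [IsProbabilityMeasure P] (hv : IsGaussianFamily P v) {f : Ω → ℝ}
    (hf : f ∈ Submodule.span ℝ (Set.range (part v))) :
    HasGaussianLaw f P ∧ ∫ ω, f ω ∂P = 0 := by
  obtain ⟨c, rfl⟩ := Finsupp.mem_span_range_iff_exists_finsupp.1 hf
  have h1 := ((hv.isGaussianProcess_part).smul (fun t => c t)).hasGaussianLaw_sum (I := c.support)
  have h2 : (c.sum fun i a => a • part v i) = ∑ i ∈ c.support, fun ω => c i • part v i ω := rfl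
  rw [h2]
  refine ⟨h1, ?_⟩
  have h3 : ∀ ω, (∑ i ∈ c.support, fun ω => c i • part v i ω) ω =
      ∑ i ∈ c.support, c i • part v i ω := fun ω => by simp
  simp_rw [h3]
  rw [integral_finsetSum (f := fun i ω => c i • part v i ω) _ fun i _ =>
    ((hv.isGaussianProcess_part.hasGaussianLaw_eval i).integrable.smul (c i))]
  simp [integral_const_mul, hv.integral_part]

/-- A generator is real almost surely, so it equals its real part, which is a real combination of
the real and imaginary parts of the `v` at `±l` and `±t`. -/
theorem exists_mem_span_of_generator {ξ : Lp ℝ 2 P}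
    (h : ∃ (l t : Fin 2 → ℤ) (z u : ℂ) (c₁ c₂ : ℝ),
    (fun ω => ((ξ ω : ℝ) : ℂ)) =ᵐ[P] fun ω =>
      (c₁ : ℂ) * (z * reCoeff v l ω + conj z * reCoeff v (-l) ω) +
      (c₂ : ℂ) * (u * imCoeff v t ω + conj u * imCoeff v (-t) ω)) :
    ∃ f ∈ Submodule.span ℝ (Set.range (part v)), ξ =ᵐ[P] f := by
  obtain ⟨l, t, z, u, c₁, c₂, h⟩ := h
  have hp : ∀ s, part v s ∈ Submodule.span ℝ (Set.range (part v)) := fun s =>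
    Submodule.subset_span ⟨s, rfl⟩
  refine ⟨c₁ • (z.re • part v (l, true) - z.im • part v (l, false) + z.re • part v (-l, true) +
    z.im • part v (-l, false)) + c₂ • (u.re • part v (t, false) + u.im • part v (t, true) -
    u.im • part v (-t, true) + u.re • part v (-t, false)), ?_, ?_⟩
  · refine Submodule.add_mem _ (Submodule.smul_mem _ _ (Submodule.add_mem _ (Submodule.add_mem _
      (Submodule.sub_mem _ ?_ ?_) ?_) ?_)) (Submodule.smul_mem _ _ (Submodule.add_mem _
      (Submodule.sub_mem _ (Submodule.add_mem _ ?_ ?_) ?_) ?_)) <;>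
    exact Submodule.smul_mem _ _ (hp _)
  · filter_upwards [h] with ω h
    have h' := congrArg Complex.re h
    rw [Complex.ofReal_re] at h'
    rw [h']
    have hI : ∀ w : ℂ, w / (2 * Complex.I) = -(Complex.I / 2) * w := fun w => by
      field_simp
      rw [Complex.I_sq]
      ring
    have h2 : ∀ w : ℂ, w / 2 = ((1 / 2 : ℝ) : ℂ) * w := fun w => by push_cast; ring
    simp only [reCoeff, imCoeff, hI, h2, neg_neg, part, Pi.add_apply, Pi.smul_apply, Pi.sub_apply,
      smul_eq_mul, if_true, Complex.add_re, Complex.mul_re, Complex.mul_im, Complex.sub_re,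
      Complex.sub_im, Complex.add_im, Complex.conj_re, Complex.conj_im, Complex.ofReal_re,
      Complex.ofReal_im, Complex.neg_re, Complex.neg_im, Complex.I_re, Complex.I_im]
    simp
    ring

theorem integral_exp_of_mem_gaussianSpace [IsProbabilityMeasure P] (hv : IsGaussianFamily P v)
    {f : Lp ℝ 2 P} (hf : f ∈ gaussianSpace P v) :
    ∫ ω, Complex.exp (f ω * Complex.I) ∂P = Complex.exp ((-‖f‖ ^ 2 / 2 : ℝ) : ℂ) := by
  have hc : IsClosed {f : Lp ℝ 2 P | ∫ ω, Complex.exp (f ω * Complex.I) ∂P =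
      Complex.exp ((-‖f‖ ^ 2 / 2 : ℝ) : ℂ)} :=
    isClosed_eq continuous_integral_exp (by fun_prop)
  refine closure_minimal ?_ hc hf
  intro f hf
  obtain ⟨g, hg, hfg⟩ : ∃ g ∈ Submodule.span ℝ (Set.range (part v)), f =ᵐ[P] g := by
    induction hf using Submodule.span_induction with
    | mem x hx => exact exists_mem_span_of_generator hx
    | zero => exact ⟨0, Submodule.zero_mem _, Lp.coeFn_zero _ _ _⟩
    | add x y _ _ hx hy =>
      obtain ⟨g1, h1, h1'⟩ := hx
      obtain ⟨g2, h2, h2'⟩ := hy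
      refine ⟨g1 + g2, Submodule.add_mem _ h1 h2, (Lp.coeFn_add x y).trans (h1'.add h2')⟩
    | smul c x _ hx =>
      obtain ⟨g1, h1, h1'⟩ := hx
      exact ⟨c • g1, Submodule.smul_mem _ _ h1, (Lp.coeFn_smul c x).trans (h1'.const_smul c)⟩
  obtain ⟨h1, h2⟩ := hv.hasGaussianLaw_of_mem_span hg
  exact integral_exp_of_hasGaussianLaw h1 h2 f hfg

/-- The coefficient `part v t` as an element of `L²`. -/
def partLp [IsProbabilityMeasure P] (hv : IsGaussianFamily P v) (t : (Fin 2 → ℤ) × Bool) :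
    Lp ℝ 2 P :=
  (hv.isGaussianProcess_part.hasGaussianLaw_eval t).memLp_two.toLp

theorem coeFn_partLp [IsProbabilityMeasure P] (hv : IsGaussianFamily P v)
    (t : (Fin 2 → ℤ) × Bool) : hv.partLp t =ᵐ[P] part v t :=
  MemLp.coeFn_toLp _

theorem partLp_mem [IsProbabilityMeasure P] (hv : IsGaussianFamily P v) (t : (Fin 2 → ℤ) × Bool) :
    hv.partLp t ∈ gaussianSpace P v := by
  refine Submodule.le_topologicalClosure _ (Submodule.subset_span ?_)
  have hI : ∀ w : ℂ, w / (2 * Complex.I) = -(Complex.I / 2) * w := fun w => by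
      field_simp
      rw [Complex.I_sq]
      ring
  have h2 : ∀ w : ℂ, w / 2 = ((1 / 2 : ℝ) : ℂ) * w := fun w => by push_cast; ring
  obtain ⟨l, b⟩ := t
  cases b
  -- Since `v_l = a_l + i â_l`, one has `Im v_l = Im a_l + Re â_l` and `Re v_l = Re a_l - Im â_l`.
  -- As `a_{-l}` and `â_{-l}` are the conjugates, these `z` and `u` extract the required parts.
  · refine ⟨l, l, -Complex.I / 2, 1 / 2, 1, 1, ?_⟩
    filter_upwards [hv.coeFn_partLp (l, false)] with ω h
    rw [h]
    apply Complex.ext <;>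
    simp [reCoeff, imCoeff, hI, h2, part] <;> ring
  · refine ⟨l, l, 1 / 2, Complex.I / 2, 1, 1, ?_⟩
    filter_upwards [hv.coeFn_partLp (l, true)] with ω h
    rw [h]
    apply Complex.ext <;>
    simp [reCoeff, imCoeff, hI, h2, part] <;> ring

end IsGaussianFamily

end GaussianHilbert

/-! ### Transfer from the chaoses of `P` to those of the coefficient vector -/

section CoefficientVector

open scoped RealInnerProductSpace

variable {Ω : Type*} [MeasurableSpace Ω] {P : Measure Ω}

/-- The space of coefficient vectors of waves of order `n`. -/
abbrev CoeffSpace (n : ℕ) : Type := EuclideanSpace ℂ (freq n)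

/-- The random coefficient vector. -/
def coeffVec (v : (Fin 2 → ℤ) → Ω → ℂ) (n : ℕ) (ω : Ω) : CoeffSpace n :=
  WithLp.toLp 2 fun l => v l ω

theorem real_inner_coeffSpace {ι : Type*} [Fintype ι] (x y : EuclideanSpace ℂ ι) :
    ⟪x, y⟫ = ∑ l, ((x l).re * (y l).re + (x l).im * (y l).im) := by
  rw [PiLp.inner_apply]
  refine Finset.sum_congr rfl fun l _ => ?_
  rw [Complex.inner]
  simp
  ring

namespace IsGaussianFamily

variable {v : (Fin 2 → ℤ) → Ω → ℂ}

theorem map_eq_stdGaussian [IsProbabilityMeasure P] (hv : IsGaussianFamily P v)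
    (l : Fin 2 → ℤ) : P.map (v l) = stdGaussian ℂ := by
  refine (measurePreserving_stdGaussian_of_charFun (hv.measurable l) fun t => ?_).map_eq
  have hre := Complex.measurable_re.comp (hv.measurable l)
  have him := Complex.measurable_im.comp (hv.measurable l)
  have h1 := (indepFun_iff_map_prod_eq_prod_map_map hre.aemeasurable him.aemeasurable).1
    (hv.indep_re_im l)
  set g : ℝ × ℝ → ℂ := fun z => Complex.exp ((t.re * z.1 : ℂ) * Complex.I) *
    Complex.exp ((t.im * z.2 : ℂ) * Complex.I) with hg
  have h2 : ∀ ω, Complex.exp ((⟪v l ω, t⟫ : ℝ) * Complex.I) =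
      g ((Complex.re ∘ v l) ω, (Complex.im ∘ v l) ω) := by
    intro ω
    simp only [hg]
    rw [← Complex.exp_add, Complex.inner]
    congr 1
    simp
    ring
  rw [integral_congr_ae (Filter.Eventually.of_forall h2), ← integral_map (f := g)
    (hre.prodMk him).aemeasurable (Continuous.aestronglyMeasurable (by fun_prop)) (μ := P)]
  rw [h1, integral_prod_mul (fun x : ℝ => Complex.exp ((t.re * x : ℂ) * Complex.I))
    (fun x : ℝ => Complex.exp ((t.im * x : ℂ) * Complex.I))]
  have h3 : P.map (Complex.re ∘ v l) = gaussianReal 0 1 := hv.law_re l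
  have h4 : P.map (Complex.im ∘ v l) = gaussianReal 0 1 := hv.law_im l
  have h5 := charFun_gaussianReal (μ := 0) (v := 1) t.re
  have h6 := charFun_gaussianReal (μ := 0) (v := 1) t.im
  rw [charFun_apply_real] at h5 h6
  rw [h3, h4, h5, h6, ← Complex.exp_add]
  congr 1
  rw [Complex.sq_norm, Complex.normSq_apply]
  push_cast
  simp
  ring

theorem measurable_coeffVec (hv : IsGaussianFamily P v) (n : ℕ) : Measurable (coeffVec v n) := by
  unfold coeffVec
  have : Measurable fun ω => fun l : freq n => v l ω :=
    measurable_pi_lambda _ fun l => hv.measurable l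
  exact (by fun_prop : Measurable (WithLp.toLp 2 : (freq n → ℂ) → CoeffSpace n)).comp this

theorem measurePreserving_coeffVec [IsProbabilityMeasure P] (hv : IsGaussianFamily P v) (n : ℕ) :
    MeasurePreserving (coeffVec v n) P (stdGaussian (CoeffSpace n)) := by
  refine ⟨hv.measurable_coeffVec n, ?_⟩
  have h1 : Measurable fun ω => fun l : freq n => v l ω :=
    measurable_pi_lambda _ fun l => hv.measurable l
  have h2 : P.map (coeffVec v n) = (P.map fun ω => fun l : freq n => v l ω).map (WithLp.toLp 2) := by
    rw [Measure.map_map (by fun_prop) h1]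
    rfl
  rw [h2, (iIndepFun_iff_map_fun_eq_pi_map (f := fun l : freq n => v l)
    fun l => (hv.measurable l).aemeasurable).1 (hv.indep.precomp Subtype.val_injective)]
  apply Measure.ext_of_charFun
  funext t
  rw [charFun_pi]
  simp_rw [hv.map_eq_stdGaussian, charFun_stdGaussian]
  rw [← Complex.exp_sum]
  congr 1
  have := EuclideanSpace.norm_sq_eq t
  rw [← Complex.ofReal_pow, this]
  push_cast
  rw [← Finset.sum_div, ← Finset.sum_neg_distrib]

/-- The real linear functionals of the coefficient vector, as elements of `L²`. -/
def dualLp [IsProbabilityMeasure P] (hv : IsGaussianFamily P v) (n : ℕ) (t : CoeffSpace n) :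
    Lp ℝ 2 P :=
  ∑ l, ((t l).re • hv.partLp (l, true) + (t l).im • hv.partLp (l, false))

theorem coeFn_dualLp [IsProbabilityMeasure P] (hv : IsGaussianFamily P v) (n : ℕ)
    (t : CoeffSpace n) : hv.dualLp n t =ᵐ[P] fun ω => ⟪coeffVec v n ω, t⟫ := by
  have h1 : ∀ᵐ ω ∂P, ∀ s : freq n × Bool, hv.partLp (s.1, s.2) ω = part v (s.1, s.2) ω :=
    ae_all_iff.2 fun s => hv.coeFn_partLp _
  have h2 : ∀ᵐ ω ∂P, ∀ l : freq n, ((t l).re • hv.partLp (l, true) +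
      (t l).im • hv.partLp (l, false) : Lp ℝ 2 P) ω =
      (t l).re * hv.partLp (l, true) ω + (t l).im * hv.partLp (l, false) ω := by
    refine ae_all_iff.2 fun l => ?_
    filter_upwards [Lp.coeFn_add ((t l).re • hv.partLp (l, true)) ((t l).im • hv.partLp (l, false)),
      Lp.coeFn_smul (t l).re (hv.partLp (l, true)), Lp.coeFn_smul (t l).im (hv.partLp (l, false))]
      with ω a1 a2 a3
    rw [a1, Pi.add_apply, a2, a3]
    rfl
  filter_upwards [h1, h2, Lp.coeFn_finsetSum Finset.univ fun l : freq n =>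
    ((t l).re • hv.partLp (l, true) + (t l).im • hv.partLp (l, false))] with ω a1 a2 a3
  rw [dualLp, a3, real_inner_coeffSpace, Finset.sum_apply]
  refine Finset.sum_congr rfl fun l _ => ?_
  rw [a2, a1 (l, true), a1 (l, false)]
  simp [part, coeffVec]
  ring

theorem dualLp_mem [IsProbabilityMeasure P] (hv : IsGaussianFamily P v) (n : ℕ)
    (t : CoeffSpace n) : hv.dualLp n t ∈ gaussianSpace P v :=
  Submodule.sum_mem _ fun _ _ => Submodule.add_mem _ (Submodule.smul_mem _ _ (hv.partLp_mem _))
    (Submodule.smul_mem _ _ (hv.partLp_mem _))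

theorem dualLp_smul [IsProbabilityMeasure P] (hv : IsGaussianFamily P v) (n : ℕ) (c : ℝ)
    (t : CoeffSpace n) : hv.dualLp n (c • t) = c • hv.dualLp n t := by
  simp [dualLp, Finset.smul_sum, smul_smul]

theorem norm_eq_of_exp_eq {a b : ℝ} (ha : 0 ≤ a) (hb : 0 ≤ b)
    (h : Complex.exp ((-a ^ 2 / 2 : ℝ) : ℂ) = Complex.exp ((-b ^ 2 / 2 : ℝ) : ℂ)) : a = b := by
  rw [← Complex.ofReal_exp, ← Complex.ofReal_exp, Complex.ofReal_inj, Real.exp_eq_exp] at h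
  have : a ^ 2 = b ^ 2 := by linarith
  exact (sq_eq_sq₀ ha hb).1 this

/-- Vectors with entries in the Gaussian Hilbert space are jointly Gaussian with the coefficient
vector. -/
theorem isGaussPair [IsProbabilityMeasure P] (hv : IsGaussianFamily P v) (n : ℕ) {k : ℕ}
    {ξ : Fin k → Lp ℝ 2 P} (hξ : ∀ j, ξ j ∈ gaussianSpace P v)
    (hm : P.map (fun ω j => ξ j ω) = Measure.pi (fun _ : Fin k => gaussianReal 0 1)) :
    IsGaussPair P (coeffVec v n)
      (fun ω => (WithLp.toLp 2 fun j => ξ j ω : EuclideanSpace ℝ (Fin k)))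
      (fun t τ => ⟪hv.dualLp n t, ∑ j, τ j • ξ j⟫) := by
  have hξm : Measurable fun ω => fun j => ξ j ω :=
    measurable_pi_lambda _ fun j => (Lp.stronglyMeasurable (ξ j)).measurable
  have hright : MeasurePreserving (fun ω => (WithLp.toLp 2 fun j => ξ j ω :
      EuclideanSpace ℝ (Fin k))) P (stdGaussian _) := by
    refine ⟨(by fun_prop : Measurable (WithLp.toLp 2 : (Fin k → ℝ) → _)).comp hξm, ?_⟩
    rw [← map_pi_eq_stdGaussian, ← hm, Measure.map_map (by fun_prop) hξm]
    rfl
  have hleft := hv.measurePreserving_coeffVec n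
  have hτ : ∀ τ : EuclideanSpace ℝ (Fin k), (∑ j, τ j • ξ j : Lp ℝ 2 P) =ᵐ[P]
      fun ω => ⟪(WithLp.toLp 2 fun j => ξ j ω : EuclideanSpace ℝ (Fin k)), τ⟫ := by
    intro τ
    have h2 : ∀ᵐ ω ∂P, ∀ j, (τ j • ξ j : Lp ℝ 2 P) ω = τ j * ξ j ω :=
      ae_all_iff.2 fun j => Lp.coeFn_smul _ _
    filter_upwards [h2, Lp.coeFn_finsetSum Finset.univ fun j => τ j • ξ j] with ω a1 a2
    rw [a2, PiLp.inner_apply, Finset.sum_apply]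
    refine Finset.sum_congr rfl fun j _ => ?_
    rw [a1]
    simp
  have hτm : ∀ τ : EuclideanSpace ℝ (Fin k), (∑ j, τ j • ξ j : Lp ℝ 2 P) ∈ gaussianSpace P v :=
    fun τ => Submodule.sum_mem _ fun j _ => Submodule.smul_mem _ _ (hξ j)
  -- A variable of the Gaussian Hilbert space that is also a linear functional of a standard
  -- Gaussian vector has two expressions for its characteristic function; comparing them identifies
  -- its norm.
  have hgauss : ∀ {E : Type _} [NormedAddCommGroup E] [InnerProductSpace ℝ E]
      [FiniteDimensional ℝ E] [MeasurableSpace E] [BorelSpace E] {X : Ω → E} {f : Lp ℝ 2 P} {t : E},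
      MeasurePreserving X P (stdGaussian E) → f ∈ gaussianSpace P v →
      f =ᵐ[P] (fun ω => ⟪X ω, t⟫) → ‖f‖ = ‖t‖ := by
    intro E _ _ _ _ _ X f t hX hf hfX
    refine norm_eq_of_exp_eq (norm_nonneg _) (norm_nonneg _) ?_
    rw [← hv.integral_exp_of_mem_gaussianSpace hf, ← integral_exp_stdGaussian, ← hX.map_eq,
      integral_map hX.aemeasurable (Continuous.aestronglyMeasurable (by fun_prop))]
    refine integral_congr_ae ?_
    filter_upwards [hfX] with ω h
    rw [h]
  refine ⟨hleft, hright, fun t τ => ?_⟩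
  -- The sum of the two functionals stays in the Gaussian Hilbert space, so it is Gaussian with
  -- variance its squared norm, and expanding the square shows the cross covariance.
  rw [← hgauss hleft (hv.dualLp_mem n t) (hv.coeFn_dualLp n t), ← hgauss hright (hτm τ) (hτ τ),
    ← norm_add_sq_real, ← hv.integral_exp_of_mem_gaussianSpace
      (Submodule.add_mem _ (hv.dualLp_mem n t) (hτm τ))]
  refine integral_congr_ae ?_
  filter_upwards [hv.coeFn_dualLp n t, hτ τ, Lp.coeFn_add (hv.dualLp n t) (∑ j, τ j • ξ j)]
    with ω a1 a2 a3
  rw [a3, Pi.add_apply, a1, a2]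

/-- The chaos projections of a function of the coefficient vector are controlled by its
projections onto the chaos of the standard Gaussian measure. -/
theorem norm_chaosProj_le [IsProbabilityMeasure P] (hv : IsGaussianFamily P v) (n q : ℕ)
    (f : Lp ℝ 2 (stdGaussian (CoeffSpace n))) :
    ‖chaosProj P v q (pull (hv.measurePreserving_coeffVec n) f)‖ ≤ ‖gaussProj q f‖ := by
  set V := hv.measurePreserving_coeffVec n
  -- Every generator of `C_q` is a Hermite product of a vector jointly Gaussian with the
  -- coefficients, hence does not see the part of `f` outside the q-th eigenspace. Orthogonality to
  -- one vector is closed, so it extends to all of `C_q`.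
  have key : chaos P v q ≤ (Submodule.span ℝ {pull V f - pull V (gaussProj q f)})ᗮ := by
    refine Submodule.topologicalClosure_minimal _ (Submodule.span_le.2 ?_)
      (Submodule.isClosed_orthogonal _)
    rintro G ⟨k, p, ξ, -, hp, hξ, hm, hG⟩
    have hpair := hv.isGaussPair n hξ hm
    rw [SetLike.mem_coe, Submodule.mem_orthogonal_singleton_iff_inner_right, inner_sub_left,
      sub_eq_zero]
    have hmem : MemLp (hermiteProd p) 2 (stdGaussian (EuclideanSpace ℝ (Fin k))) := by
      rw [← hpair.right.map_eq, memLp_map_measure_iff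
        (continuous_hermiteProd p).aestronglyMeasurable hpair.right.aemeasurable]
      exact (memLp_congr_ae hG).1 (Lp.memLp G)
    have hG' : G = pull hpair.right hmem.toLp := by
      refine Lp.ext ?_
      filter_upwards [hG, coeFn_pull hpair.right hmem.toLp,
        hpair.right.quasiMeasurePreserving.ae hmem.coeFn_toLp] with ω a1 a2 a3
      rw [a1, a2, Function.comp_apply, a3]
      rfl
    have := hpair.inner_gaussProj (fun t τ c => ?_) (fun t τ c => ?_) (q := q) f
      (hp ▸ hermiteProd_mem_gaussChaos p hmem)
    · rw [hG']
      exact this.symm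
    · rw [← inner_smul_right]
      simp [Finset.smul_sum, smul_smul]
    · rw [dualLp_smul, inner_smul_left]
      rfl
  set G := chaosProj P v q (pull V f)
  have hG : G ∈ chaos P v q := Submodule.starProjection_apply_mem _ _
  have h1 : ⟪pull V f, G⟫ = ⟪pull V (gaussProj q f), G⟫ := by
    have := Submodule.mem_orthogonal_singleton_iff_inner_right.1 (key hG)
    rwa [inner_sub_left, sub_eq_zero] at this
  have h2 : ‖G‖ ^ 2 = ⟪pull V f, G⟫ := by
    have h := Submodule.inner_starProjection_left_eq_right (chaos P v q) (pull V f) G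
    rw [Submodule.starProjection_eq_self_iff.2 hG] at h
    rw [← h, ← real_inner_self_eq_norm_sq]
    rfl
  -- Now `‖G‖²` is the inner product of `G` with the pullback of `gaussProj q f`, and Cauchy-Schwarz
  -- concludes.
  have h3 := real_inner_le_norm (pull V (gaussProj q f)) G
  rw [LinearIsometry.norm_map, ← h1, ← h2] at h3
  rcases (norm_nonneg G).eq_or_lt with h | h
  · rw [← h]; exact norm_nonneg _
  · exact le_of_mul_le_mul_right (by linarith) h

theorem variance_chaosProj_le [IsProbabilityMeasure P] (hv : IsGaussianFamily P v) (n q : ℕ)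
    (f : Lp ℝ 2 (stdGaussian (CoeffSpace n))) :
    variance (chaosProj P v q (pull (hv.measurePreserving_coeffVec n) f)) P ≤
      ‖gaussProj q f‖ ^ 2 := by
  set G := chaosProj P v q (pull (hv.measurePreserving_coeffVec n) f) with hG
  have h1 : variance G P ≤ ‖G‖ ^ 2 := by
    refine (variance_le_expectation_sq (Lp.aestronglyMeasurable G)).trans (le_of_eq ?_)
    rw [← real_inner_self_eq_norm_sq, L2.inner_def]
    simp [sq]
  exact h1.trans (pow_le_pow_left₀ (norm_nonneg _) (hv.norm_chaosProj_le n q f) 2)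

end IsGaussianFamily

end CoefficientVector

/-! ### Fourier analysis on the torus -/

section Torus

/-- The covering map `ℝ² → 𝕋`. -/
def tmk (x : Fin 2 → ℝ) : Torus := fun i => (x i : UnitAddCircle)

/-- The fundamental domain of the torus with lower left corner `t`. -/
def box (t : Fin 2 → ℝ) : Set (Fin 2 → ℝ) := Set.univ.pi fun i => Set.Ioc (t i) (t i + 1)

theorem measurableSet_box (t : Fin 2 → ℝ) : MeasurableSet (box t) :=
  MeasurableSet.univ_pi fun _ => measurableSet_Ioc

theorem measurePreserving_tmk (t : Fin 2 → ℝ) :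
    MeasurePreserving tmk (volume.restrict (box t)) volume := by
  have h := measurePreserving_pi (fun i => (volume : Measure ℝ).restrict (Set.Ioc (t i) (t i + 1)))
    (fun _ : Fin 2 => (volume : Measure UnitAddCircle))
    (fun i => UnitAddCircle.measurePreserving_mk (t i))
  rw [← Measure.restrict_pi_pi] at h
  exact h

theorem tmk_sub (x y : Fin 2 → ℝ) : tmk (x - y) = tmk x - tmk y := by
  funext i
  simp [tmk]

theorem tmk_add (x y : Fin 2 → ℝ) : tmk (x + y) = tmk x + tmk y := by
  funext i
  simp [tmk]

theorem tmk_zero : tmk 0 = 0 := by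
  funext i
  simp [tmk]

theorem continuous_tmk : Continuous tmk :=
  continuous_pi fun i => (AddCircle.continuous_mk' 1).comp (continuous_apply i)

theorem volume_box (t : Fin 2 → ℝ) : volume (box t) = 1 := by
  rw [box, volume_pi_pi]
  simp

/-- The phase `2π⟨l, x⟩`. -/
def phase (l : Fin 2 → ℤ) (x : Fin 2 → ℝ) : ℝ := 2 * Real.pi * (l 0 * x 0 + l 1 * x 1)

theorem mFourier_tmk (l : Fin 2 → ℤ) (x : Fin 2 → ℝ) :
    UnitAddTorus.mFourier l (tmk x) = Complex.exp (phase l x * Complex.I) := by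
  have h : UnitAddTorus.mFourier l (tmk x) = ∏ i, fourier (l i) (tmk x i) := rfl
  rw [h, Fin.prod_univ_two]
  unfold tmk
  rw [fourier_coe_apply, fourier_coe_apply, ← Complex.exp_add]
  congr 1
  simp only [phase]
  push_cast
  ring

theorem mFourier_add_point (l : Fin 2 → ℤ) (x y : Torus) :
    UnitAddTorus.mFourier l (x + y) = UnitAddTorus.mFourier l x * UnitAddTorus.mFourier l y := by
  have h : ∀ x : Torus, UnitAddTorus.mFourier l x = ∏ i, fourier (l i) (x i) := fun _ => rfl
  rw [h, h, h, ← Finset.prod_mul_distrib]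
  refine Finset.prod_congr rfl fun i _ => ?_
  simp [fourier_apply, smul_add, AddCircle.toCircle_add]

theorem norm_mFourier_apply (l : Fin 2 → ℤ) (x : Torus) : ‖UnitAddTorus.mFourier l x‖ = 1 := by
  have h : UnitAddTorus.mFourier l x = ∏ i, fourier (l i) (x i) := rfl
  rw [h, norm_prod]
  exact Finset.prod_eq_one fun i _ => Circle.norm_coe _

theorem conj_mFourier (l : Fin 2 → ℤ) (x : Torus) :
    conj (UnitAddTorus.mFourier l x) = UnitAddTorus.mFourier l (-x) := by
  have h1 : UnitAddTorus.mFourier l x * UnitAddTorus.mFourier l (-x) = 1 := by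
    rw [← mFourier_add_point]
    have := mFourier_tmk l 0
    simp [tmk_zero, phase] at this
    simp [this]
  have h2 : UnitAddTorus.mFourier l x * conj (UnitAddTorus.mFourier l x) = 1 := by
    rw [Complex.mul_conj, Complex.normSq_eq_norm_sq, norm_mFourier_apply]
    simp
  have h3 : UnitAddTorus.mFourier l x ≠ 0 := left_ne_zero_of_mul_eq_one h1
  exact mul_left_cancel₀ h3 (h2.trans h1.symm)

theorem mFourier_sub_point (l : Fin 2 → ℤ) (x y : Torus) :
    UnitAddTorus.mFourier l (x - y) =
      UnitAddTorus.mFourier l x * conj (UnitAddTorus.mFourier l y) := by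
  rw [sub_eq_add_neg, mFourier_add_point, conj_mFourier]

instance : IsProbabilityMeasure (volume : Measure Torus) := by
  refine ⟨?_⟩
  rw [← (measurePreserving_tmk 0).map_eq, Measure.map_apply continuous_tmk.measurable
    MeasurableSet.univ]
  simp [volume_box]

theorem integral_mFourier (l : Fin 2 → ℤ) :
    ∫ x : Torus, UnitAddTorus.mFourier l x = if l = 0 then 1 else 0 := by
  split_ifs with h
  · simp [h, UnitAddTorus.mFourier_zero]
  obtain ⟨i, hi⟩ := Function.ne_iff.1 h
  have hli : (l i : ℝ) ≠ 0 := by exact_mod_cast hi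
  -- Translation by half a period of the character changes its sign but not its integral.
  set a : Fin 2 → ℝ := Pi.single i (1 / (2 * l i))
  have h1 : UnitAddTorus.mFourier l (tmk a) = -1 := by
    rw [mFourier_tmk]
    have : phase l a = Real.pi := by
      unfold phase
      fin_cases i <;> simp [a] at hli ⊢ <;> field_simp
    rw [this, Complex.exp_pi_mul_I]
  have h2 : ∫ x : Torus, UnitAddTorus.mFourier l (x + tmk a) =
      ∫ x : Torus, UnitAddTorus.mFourier l x :=
    integral_add_right_eq_self (fun x : Torus => UnitAddTorus.mFourier l x) (tmk a)
  simp_rw [mFourier_add_point, h1] at h2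
  rw [integral_mul_const] at h2
  linear_combination -(1 / 2 : ℂ) * h2

theorem integrable_of_continuous_torus {E : Type*} [NormedAddCommGroup E] {f : Torus → E}
    (hf : Continuous f) : Integrable f := by
  exact hf.integrable_of_hasCompactSupport (HasCompactSupport.of_compactSpace f)

/-- Parseval's identity for a trigonometric polynomial with repetitions. -/
theorem integral_norm_sq_trigPoly {T : Type*} (S : Finset T) (σ : T → Fin 2 → ℤ) (c : T → ℂ) :
    ∫ x : Torus, ‖∑ t ∈ S, c t * UnitAddTorus.mFourier (σ t) x‖ ^ 2 =
      ∑ t ∈ S, ∑ t' ∈ S, if σ t = σ t' then (c t * conj (c t')).re else 0 := by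
  have h1 : ∀ x : Torus, ‖∑ t ∈ S, c t * UnitAddTorus.mFourier (σ t) x‖ ^ 2 =
      ∑ t ∈ S, ∑ t' ∈ S, (c t * conj (c t') * UnitAddTorus.mFourier (σ t - σ t') x).re := by
    intro x
    have : ((‖∑ t ∈ S, c t * UnitAddTorus.mFourier (σ t) x‖ ^ 2 : ℝ) : ℂ) =
        ∑ t ∈ S, ∑ t' ∈ S, c t * conj (c t') * UnitAddTorus.mFourier (σ t - σ t') x := by
      rw [← Complex.normSq_eq_norm_sq, ← Complex.mul_conj, map_sum, Finset.sum_mul_sum]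
      refine Finset.sum_congr rfl fun t _ => Finset.sum_congr rfl fun t' _ => ?_
      rw [sub_eq_add_neg, UnitAddTorus.mFourier_add, UnitAddTorus.mFourier_neg, map_mul]
      ring
    have h2 := congrArg Complex.re this
    rw [Complex.ofReal_re] at h2
    rw [h2]
    simp only [Complex.re_sum]
  simp_rw [h1]
  have hc : ∀ t t', Continuous fun x : Torus =>
      (c t * conj (c t') * UnitAddTorus.mFourier (σ t - σ t') x).re := fun t t' =>
    Complex.continuous_re.comp (continuous_const.mul (ContinuousMap.continuous _))
  rw [integral_finsetSum _ fun t _ => integrable_of_continuous_torus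
    (continuous_finsetSum _ fun t' _ => hc t t')]
  refine Finset.sum_congr rfl fun t _ => ?_
  rw [integral_finsetSum _ fun t' _ => integrable_of_continuous_torus (hc t t')]
  refine Finset.sum_congr rfl fun t' _ => ?_
  have h3 : ∫ x : Torus, (c t * conj (c t') * UnitAddTorus.mFourier (σ t - σ t') x).re =
      (∫ x : Torus, c t * conj (c t') * UnitAddTorus.mFourier (σ t - σ t') x).re :=
    integral_re (𝕜 := ℂ) (integrable_of_continuous_torus
      (continuous_const.mul (ContinuousMap.continuous _)))
  rw [h3, integral_const_mul, integral_mFourier]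
  by_cases h : σ t = σ t' <;> simp [h, sub_eq_zero]

theorem pow_three_trigPoly (S : Finset (Fin 2 → ℤ)) (c : (Fin 2 → ℤ) → ℂ) (x : Torus) :
    (∑ l ∈ S, c l * UnitAddTorus.mFourier l x) ^ 3 =
      ∑ t ∈ S ×ˢ S ×ˢ S, c t.1 * c t.2.1 * c t.2.2 *
        UnitAddTorus.mFourier (t.1 + t.2.1 + t.2.2) x := by
  rw [pow_succ, sq, mul_assoc, Finset.sum_mul_sum, Finset.sum_product, Finset.sum_mul_sum]
  refine Finset.sum_congr rfl fun a _ => ?_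
  rw [Finset.sum_product]
  refine Finset.sum_congr rfl fun b _ => ?_
  rw [Finset.mul_sum]
  refine Finset.sum_congr rfl fun d _ => ?_
  rw [UnitAddTorus.mFourier_add, UnitAddTorus.mFourier_add]
  ring

/-- Sixth moments of trigonometric polynomials are monotone in the size of the coefficients. -/
theorem integral_norm_pow_six_le (S : Finset (Fin 2 → ℤ)) (c : (Fin 2 → ℤ) → ℂ) {B : ℝ}
    (hB : ∀ l ∈ S, ‖c l‖ ≤ B) (hB0 : 0 ≤ B) :
    ∫ x : Torus, ‖∑ l ∈ S, c l * UnitAddTorus.mFourier l x‖ ^ 6 ≤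
      B ^ 6 * ∫ x : Torus, ‖∑ l ∈ S, UnitAddTorus.mFourier l x‖ ^ 6 := by
  have h : ∀ c : (Fin 2 → ℤ) → ℂ, ∫ x : Torus, ‖∑ l ∈ S, c l * UnitAddTorus.mFourier l x‖ ^ 6 =
      ∑ t ∈ S ×ˢ S ×ˢ S, ∑ t' ∈ S ×ˢ S ×ˢ S,
        if t.1 + t.2.1 + t.2.2 = t'.1 + t'.2.1 + t'.2.2 then
          (c t.1 * c t.2.1 * c t.2.2 * conj (c t'.1 * c t'.2.1 * c t'.2.2)).re else 0 := by
    intro c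
    rw [← integral_norm_sq_trigPoly (S ×ˢ S ×ˢ S) (fun t => t.1 + t.2.1 + t.2.2)
      (fun t => c t.1 * c t.2.1 * c t.2.2)]
    simp_rw [← pow_three_trigPoly, norm_pow]
    refine integral_congr_ae (Filter.Eventually.of_forall fun x => ?_)
    simp only
    ring
  have h1 := h fun _ => 1
  simp only [one_mul, map_one, mul_one] at h1
  rw [h, h1, Finset.mul_sum]
  refine Finset.sum_le_sum fun t ht => ?_
  rw [Finset.mul_sum]
  refine Finset.sum_le_sum fun t' ht' => ?_
  simp only [Finset.mem_product] at ht ht'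
  -- By Parseval applied to the cube only the resonant terms survive; replacing each coefficient by
  -- `B` can only increase them.
  split_ifs with hσ
  · refine (Complex.re_le_norm _).trans ?_
    simp only [norm_mul, Complex.norm_conj, map_mul, Complex.one_re, mul_one]
    calc ‖c t.1‖ * ‖c t.2.1‖ * ‖c t.2.2‖ * (‖c t'.1‖ * ‖c t'.2.1‖ * ‖c t'.2.2‖)
        ≤ B * B * B * (B * B * B) := by
          gcongr
          exacts [hB _ ht.1, hB _ ht.2.1, hB _ ht.2.2, hB _ ht'.1, hB _ ht'.2.1, hB _ ht'.2.2]
      _ = B ^ 6 := by ring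
  · simp

end Torus

/-! ### The normalised one-jet of the wave and its covariances -/

section Jets

open scoped RealInnerProductSpace

theorem sum_freq_neg {M : Type*} [AddCommMonoid M] (n : ℕ) (f : (Fin 2 → ℤ) → M) :
    ∑ l ∈ freq n, f (-l) = ∑ l ∈ freq n, f l :=
  Finset.sum_nbij' (fun l => -l) (fun l => -l) (by simp [mem_freq]) (by simp [mem_freq])
    (by simp) (by simp) (by simp)

theorem sum_freq_swap {M : Type*} [AddCommMonoid M] (n : ℕ) (f : (Fin 2 → ℤ) → M) :
    ∑ l ∈ freq n, f ![l 1, l 0] = ∑ l ∈ freq n, f l :=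
  Finset.sum_nbij' (fun l => ![l 1, l 0]) (fun l => ![l 1, l 0])
    (by simp [mem_freq, add_comm]) (by simp [mem_freq, add_comm])
    (fun l _ => by ext i; fin_cases i <;> simp) (fun l _ => by ext i; fin_cases i <;> simp) (by simp)

theorem sum_freq_reflect {M : Type*} [AddCommMonoid M] (n : ℕ) (f : (Fin 2 → ℤ) → M) :
    ∑ l ∈ freq n, f ![-l 0, l 1] = ∑ l ∈ freq n, f l :=
  Finset.sum_nbij' (fun l => ![-l 0, l 1]) (fun l => ![-l 0, l 1])
    (by simp [mem_freq]) (by simp [mem_freq])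
    (fun l _ => by ext i; fin_cases i <;> simp) (fun l _ => by ext i; fin_cases i <;> simp) (by simp)

theorem sum_freq_coord (n : ℕ) (i : Fin 2) : ∑ l ∈ freq n, (l i : ℝ) = 0 := by
  have := sum_freq_neg n fun l => (l i : ℝ)
  simp only [Pi.neg_apply, Int.cast_neg, Finset.sum_neg_distrib] at this
  linarith

theorem sum_freq_mul (n : ℕ) : ∑ l ∈ freq n, (l 0 : ℝ) * l 1 = 0 := by
  have := sum_freq_reflect n fun l => (l 0 : ℝ) * l 1
  simp only [Matrix.cons_val_zero, Matrix.cons_val_one, Int.cast_neg, neg_mul,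
    Finset.sum_neg_distrib] at this
  linarith

theorem sum_freq_sq (n : ℕ) (i : Fin 2) :
    ∑ l ∈ freq n, (l i : ℝ) ^ 2 = (n : ℝ) * numFreq n / 2 := by
  have h1 : ∑ l ∈ freq n, (l 1 : ℝ) ^ 2 = ∑ l ∈ freq n, (l 0 : ℝ) ^ 2 := by
    simpa using sum_freq_swap n fun l => (l 0 : ℝ) ^ 2
  have h2 : ∑ l ∈ freq n, ((l 0 : ℝ) ^ 2 + (l 1 : ℝ) ^ 2) = (n : ℝ) * numFreq n := by
    rw [Finset.sum_congr rfl (g := fun _ => (n : ℝ))]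
    · simp [numFreq, mul_comm]
    · intro l hl
      rw [mem_freq] at hl
      exact_mod_cast hl
  rw [Finset.sum_add_distrib] at h2
  fin_cases i
  · simp only [Fin.zero_eta]; linarith
  · simp only [Fin.mk_one]; linarith

theorem numFreq_pos {n : ℕ} (hn : n ∈ sumTwoSq) : 0 < numFreq n := by
  obtain ⟨a, b, h⟩ := hn
  exact Finset.card_pos.2 ⟨![a, b], by rw [mem_freq]; simpa using h⟩

theorem abs_coord_le {n : ℕ} {l : Fin 2 → ℤ} (hl : l ∈ freq n) (i : Fin 2) :
    |(l i : ℝ)| ≤ √n := by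
  rw [mem_freq] at hl
  have h : (l 0 : ℝ) ^ 2 + (l 1 : ℝ) ^ 2 = n := by exact_mod_cast hl
  apply Real.abs_le_sqrt
  fin_cases i
  · simp only [Fin.zero_eta]; nlinarith [sq_nonneg (l 1 : ℝ)]
  · simp only [Fin.mk_one]; nlinarith [sq_nonneg (l 0 : ℝ)]

/-- The symbols of the identity and of the two normalised partial derivatives. -/
def jetCoeff (n : ℕ) (a : Fin 3) (l : Fin 2 → ℤ) : ℂ :=
  ![1, Complex.I * (√2 * l 0 / √n : ℝ), Complex.I * (√2 * l 1 / √n : ℝ)] a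

theorem norm_jetCoeff_le {n : ℕ} (a : Fin 3) {l : Fin 2 → ℤ} (hl : l ∈ freq n) :
    ‖jetCoeff n a l‖ ≤ √2 := by
  have h1 : (1 : ℝ) ≤ √2 := Real.one_le_sqrt.2 (by norm_num)
  have key : ∀ i, ‖Complex.I * ((√2 * l i / √n : ℝ) : ℂ)‖ ≤ √2 := by
    intro i
    rw [norm_mul, Complex.norm_I, one_mul, Complex.norm_real, Real.norm_eq_abs, abs_div, abs_mul,
      abs_of_nonneg (Real.sqrt_nonneg 2), abs_of_nonneg (Real.sqrt_nonneg n)]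
    exact div_le_of_le_mul₀ (Real.sqrt_nonneg _) (Real.sqrt_nonneg _)
      (mul_le_mul_of_nonneg_left (abs_coord_le hl i) (Real.sqrt_nonneg _))
  fin_cases a
  · simp [jetCoeff]
  · exact key 0
  · exact key 1

/-- The coefficients of the normalised one-jet of the wave at a point. -/
def jetAt (n : ℕ) (x : Torus) (a : Fin 3) (l : Fin 2 → ℤ) : ℂ :=
  jetCoeff n a l * UnitAddTorus.mFourier l x / √(numFreq n)

/-- The value and the normalised gradient at `x` of the wave, as a function of its coefficients. -/
def jet (n : ℕ) (x : Torus) : CoeffSpace n →L[ℝ] EuclideanSpace ℂ (Fin 3) :=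
  LinearMap.toContinuousLinearMap
    { toFun := fun w => WithLp.toLp 2 fun a => ∑ l : freq n, jetAt n x a l * w l
      map_add' := fun w w' => by
        ext a; simp [mul_add, Finset.sum_add_distrib]
      map_smul' := fun c w => by
        ext a; simp [Finset.mul_sum, mul_left_comm] }

theorem jet_apply (n : ℕ) (x : Torus) (w : CoeffSpace n) (a : Fin 3) :
    jet n x w a = ∑ l : freq n, jetAt n x a l * w l := rfl

/-- The adjoint of `jet`. -/
def jetAdj (n : ℕ) (x : Torus) : EuclideanSpace ℂ (Fin 3) →L[ℝ] CoeffSpace n :=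
  LinearMap.toContinuousLinearMap
    { toFun := fun t => WithLp.toLp 2 fun l => ∑ a, conj (jetAt n x a l) * t a
      map_add' := fun w w' => by
        ext a; simp [mul_add, Finset.sum_add_distrib]
      map_smul' := fun c w => by
        ext a; simp [Finset.mul_sum, mul_left_comm] }

theorem jetAdj_apply (n : ℕ) (x : Torus) (t : EuclideanSpace ℂ (Fin 3)) (l : freq n) :
    jetAdj n x t l = ∑ a, conj (jetAt n x a l) * t a := rfl

theorem real_inner_eq_re {ι : Type*} [Fintype ι] (x y : EuclideanSpace ℂ ι) :
    ⟪x, y⟫ = (∑ l, conj (x l) * y l).re := by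
  rw [real_inner_coeffSpace, Complex.re_sum]
  refine Finset.sum_congr rfl fun l _ => ?_
  simp

theorem adjoint_jet (n : ℕ) (x : Torus) : ContinuousLinearMap.adjoint (jet n x) = jetAdj n x := by
  symm
  rw [ContinuousLinearMap.eq_adjoint_iff]
  intro t w
  rw [real_inner_eq_re, real_inner_eq_re]
  congr 1
  simp only [jetAdj_apply, jet_apply, map_sum, map_mul, Complex.conj_conj, Finset.sum_mul,
    Finset.mul_sum]
  rw [Finset.sum_comm]
  refine Finset.sum_congr rfl fun a _ => Finset.sum_congr rfl fun l _ => ?_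
  ring

/-- The covariance functions of the one-jet of the wave. -/
def crossCov (n : ℕ) (a b : Fin 3) (x : Torus) : ℂ :=
  (1 / (numFreq n : ℂ)) * ∑ l ∈ freq n, jetCoeff n a l * conj (jetCoeff n b l) *
    UnitAddTorus.mFourier l x

theorem sum_jetAt_mul_conj (n : ℕ) (x y : Torus) (a b : Fin 3) :
    ∑ l : freq n, jetAt n y a l * conj (jetAt n x b l) = crossCov n a b (y - x) := by
  rw [crossCov, Finset.mul_sum, Finset.sum_coe_sort (freq n)
    (fun l => jetAt n y a l * conj (jetAt n x b l))]
  refine Finset.sum_congr rfl fun l _ => ?_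
  simp only [jetAt, mFourier_sub_point, map_div₀, map_mul, Complex.conj_ofReal]
  have h : (1 / (numFreq n : ℂ)) = 1 / (√(numFreq n) : ℂ) * (1 / (√(numFreq n) : ℂ)) := by
    rw [one_div_mul_one_div_rev, ← Complex.ofReal_mul, Real.mul_self_sqrt (Nat.cast_nonneg _)]
    simp
  rw [h]
  ring

theorem jet_adjoint_apply (n : ℕ) (x y : Torus) (t : EuclideanSpace ℂ (Fin 3)) (a : Fin 3) :
    ((jet n y).comp (ContinuousLinearMap.adjoint (jet n x))) t a =
      ∑ b, crossCov n a b (y - x) * t b := by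
  rw [adjoint_jet, ContinuousLinearMap.comp_apply, jet_apply]
  simp_rw [jetAdj_apply, ← sum_jetAt_mul_conj, Finset.mul_sum, Finset.sum_mul]
  rw [Finset.sum_comm]
  refine Finset.sum_congr rfl fun a _ => Finset.sum_congr rfl fun l _ => ?_
  ring

theorem mFourier_zero_point (l : Fin 2 → ℤ) : UnitAddTorus.mFourier l (0 : Torus) = 1 := by
  have := mFourier_tmk l 0
  simpa [tmk_zero, phase] using this

/-- The symmetries of `Λ_n` (negation, reflection, exchange of coordinates) kill the off-diagonal
entries and split `∑ |l|²` evenly between the two coordinates; the factor `√2` in the symbols makes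
the diagonal equal to 1. -/
theorem crossCov_zero {n : ℕ} (hn : n ∈ sumTwoSq) (hn0 : n ≠ 0) (a b : Fin 3) :
    crossCov n a b 0 = if a = b then 1 else 0 := by
  have hN : (numFreq n : ℝ) ≠ 0 := by exact_mod_cast (numFreq_pos hn).ne'
  have hNc : (numFreq n : ℂ) ≠ 0 := by exact_mod_cast hN
  have hn' : (0 : ℝ) < n := by exact_mod_cast Nat.pos_of_ne_zero hn0
  have hs : √(n : ℝ) ^ 2 = n := Real.sq_sqrt hn'.le
  have hs0 : √(n : ℝ) ≠ 0 := (Real.sqrt_pos.2 hn').ne'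
  have h2 : √(2 : ℝ) ^ 2 = 2 := Real.sq_sqrt (by norm_num)
  have key : ∀ f : (Fin 2 → ℤ) → ℝ, ∀ r : ℝ, ∑ l ∈ freq n, f l = r * numFreq n →
      (1 / (numFreq n : ℂ)) * ∑ l ∈ freq n, ((f l : ℝ) : ℂ) = r := by
    intro f r h
    rw [← Complex.ofReal_sum, h]
    push_cast
    field_simp
  have key' : ∀ f : (Fin 2 → ℤ) → ℝ, ∑ l ∈ freq n, f l = 0 → ∀ z : ℂ,
      (1 / (numFreq n : ℂ)) * ∑ l ∈ freq n, z * ((f l : ℝ) : ℂ) = 0 := by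
    intro f h z
    rw [← Finset.mul_sum, ← Complex.ofReal_sum, h]
    simp
  have sq : ∀ i : Fin 2, (1 / (numFreq n : ℂ)) * ∑ l ∈ freq n,
      Complex.I * ((√2 * l i / √n : ℝ) : ℂ) * conj (Complex.I * ((√2 * l i / √n : ℝ) : ℂ)) = 1 := by
    intro i
    refine Eq.trans ?_ ((key (fun l => 2 / n * (l i : ℝ) ^ 2) 1 ?_).trans (by simp))
    · congr 1
      refine Finset.sum_congr rfl fun l _ => ?_
      rw [Complex.mul_conj, Complex.normSq_mul, Complex.normSq_I, one_mul, Complex.normSq_ofReal]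
      norm_cast
      rw [← sq, div_pow, mul_pow, h2, hs]
      push_cast
      ring
    · rw [← Finset.mul_sum, sum_freq_sq]
      field_simp
  have cross : ∀ i j : Fin 2, i ≠ j → (1 / (numFreq n : ℂ)) * ∑ l ∈ freq n,
      Complex.I * ((√2 * l i / √n : ℝ) : ℂ) * conj (Complex.I * ((√2 * l j / √n : ℝ) : ℂ)) = 0 := by
    intro i j hij
    rw [← key' (fun l => (l i : ℝ) * l j) ?_ (2 / n)]
    · congr 1
      refine Finset.sum_congr rfl fun l _ => ?_
      have e1 : Complex.I * ((√2 * l i / √n : ℝ) : ℂ) * conj (Complex.I * ((√2 * l j / √n : ℝ) : ℂ))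
        = ((√2 * l i / √n * (√2 * l j / √n) : ℝ) : ℂ) := by
        rw [map_mul, Complex.conj_I, Complex.conj_ofReal]
        push_cast
        linear_combination -((√2 : ℂ) * l i / √n * ((√2 : ℂ) * l j / √n)) * Complex.I_sq
      rw [e1]
      have e2 : √2 * l i / √n * (√2 * l j / √n) = 2 / n * (l i * l j) := by
        field_simp
        rw [h2, hs]
        ring
      rw [e2]
      push_cast
      ring
    · fin_cases i <;> fin_cases j <;> simp at hij ⊢
      · exact sum_freq_mul n
      · simp_rw [mul_comm]; exact sum_freq_mul n
  have lin : ∀ i : Fin 2, ∀ z : ℂ, (1 / (numFreq n : ℂ)) * ∑ l ∈ freq n,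
      z * ((√2 * l i / √n : ℝ) : ℂ) = 0 := by
    intro i z
    refine key' _ ?_ z
    rw [← Finset.sum_div, ← Finset.mul_sum, sum_freq_coord]
    simp
  unfold crossCov
  simp_rw [mFourier_zero_point, mul_one]
  fin_cases a <;> fin_cases b <;> simp only [jetCoeff, Fin.zero_eta, Fin.mk_one, Fin.reduceFinMk,
    Matrix.cons_val_zero, Matrix.cons_val_one, Matrix.cons_val, map_one, one_mul, mul_one,
    Finset.sum_const]
  · simp only [if_true, nsmul_eq_mul, mul_one]
    have : (numFreq n : ℂ) ≠ 0 := by exact_mod_cast hN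
    change 1 / (numFreq n : ℂ) * (numFreq n : ℂ) = 1
    field_simp
  · simpa using lin 0 (-Complex.I)
  · simpa using lin 1 (-Complex.I)
  · simpa using lin 0 Complex.I
  · simpa using sq 0
  · simpa using cross 0 1 (by simp)
  · simpa using lin 1 Complex.I
  · simpa using cross 1 0 (by simp)
  · simpa using sq 1

/-- `L L*` is the matrix of covariances at coinciding points, which is the identity; hence the jet
is a standard Gaussian vector at every point. -/
theorem isCoisometry_jet {n : ℕ} (hn : n ∈ sumTwoSq) (hn0 : n ≠ 0) (x : Torus) :
    IsCoisometry (jet n x) := by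
  intro t
  have h1 : (jet n x) (ContinuousLinearMap.adjoint (jet n x) t) = t := by
    ext a
    have := jet_adjoint_apply n x x t a
    rw [ContinuousLinearMap.comp_apply] at this
    rw [this]
    simp [crossCov_zero hn hn0]
  have h2 : ‖ContinuousLinearMap.adjoint (jet n x) t‖ ^ 2 = ‖t‖ ^ 2 := by
    rw [← real_inner_self_eq_norm_sq, ContinuousLinearMap.adjoint_inner_right, h1,
      real_inner_self_eq_norm_sq]
  exact (sq_eq_sq₀ (norm_nonneg _) (norm_nonneg _)).1 h2

/-- A 3 by 3 matrix with entries bounded by `m` has operator norm at most `3 m`, by Cauchy-Schwarz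
in each row. -/
theorem norm_jet_comp_adjoint_le {n : ℕ} {x y : Torus} {m : ℝ}
    (h : ∀ a b, ‖crossCov n a b (y - x)‖ ≤ m) :
    ‖(jet n y).comp (ContinuousLinearMap.adjoint (jet n x))‖ ≤ 3 * m := by
  have hm : 0 ≤ m := (norm_nonneg _).trans (h 0 0)
  refine ContinuousLinearMap.opNorm_le_bound _ (by positivity) fun t => ?_
  have h1 : ∀ a, ‖((jet n y).comp (ContinuousLinearMap.adjoint (jet n x))) t a‖ ^ 2 ≤
      3 * m ^ 2 * ‖t‖ ^ 2 := by
    intro a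
    have h2 : ‖((jet n y).comp (ContinuousLinearMap.adjoint (jet n x))) t a‖ ≤
        m * ∑ b, ‖t b‖ := by
      rw [jet_adjoint_apply, Finset.mul_sum]
      refine (norm_sum_le _ _).trans (Finset.sum_le_sum fun b _ => ?_)
      rw [norm_mul]
      exact mul_le_mul_of_nonneg_right (h a b) (norm_nonneg _)
    have h3 : (∑ b, ‖t b‖) ^ 2 ≤ 3 * ‖t‖ ^ 2 := by
      rw [EuclideanSpace.norm_sq_eq]
      have := sq_sum_le_card_mul_sum_sq (s := (Finset.univ : Finset (Fin 3))) (f := fun b => ‖t b‖)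
      simpa using this
    calc _ ≤ (m * ∑ b, ‖t b‖) ^ 2 := pow_le_pow_left₀ (norm_nonneg _) h2 2
      _ = m ^ 2 * (∑ b, ‖t b‖) ^ 2 := by ring
      _ ≤ m ^ 2 * (3 * ‖t‖ ^ 2) := by gcongr
      _ = _ := by ring
  refine abs_le_of_sq_le_sq' ?_ (by positivity) |>.2
  rw [EuclideanSpace.norm_sq_eq]
  calc _ ≤ ∑ a : Fin 3, 3 * m ^ 2 * ‖t‖ ^ 2 := Finset.sum_le_sum fun a _ => h1 a
    _ = _ := by simp; ring

theorem continuous_crossCov (n : ℕ) (a b : Fin 3) : Continuous (crossCov n a b) :=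
  continuous_const.mul (continuous_finsetSum _ fun _ _ =>
    continuous_const.mul (ContinuousMap.continuous _))

theorem norm_covFun (n : ℕ) (x : Torus) :
    |covFun n x| = (1 / (numFreq n : ℝ)) * ‖∑ l ∈ freq n, UnitAddTorus.mFourier l x‖ := by
  have h : ∑ l ∈ freq n, UnitAddTorus.mFourier l x =
      ((∑ l ∈ freq n, (UnitAddTorus.mFourier l x).re : ℝ) : ℂ) := by
    have h1 : conj (∑ l ∈ freq n, UnitAddTorus.mFourier l x) =
        ∑ l ∈ freq n, UnitAddTorus.mFourier l x := by
      rw [map_sum, ← sum_freq_neg n]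
      refine Finset.sum_congr rfl fun l _ => ?_
      rw [UnitAddTorus.mFourier_neg, Complex.conj_conj]
    rw [← Complex.re_sum]
    exact (Complex.conj_eq_iff_re.1 h1).symm
  rw [h, Complex.norm_real, covFun, abs_mul, abs_of_nonneg (by positivity), Real.norm_eq_abs]

/-- The symbols have modulus at most `√2`, so all these covariances have coefficients bounded by
twice those of `r_n`; the constant is `2 ^ 6`. -/
theorem integral_crossCov_pow_six_le (n : ℕ) (a b : Fin 3) :
    ∫ x : Torus, ‖crossCov n a b x‖ ^ 6 ≤ 64 * sixthMoment n := by
  have h2 : ∀ l ∈ freq n, ‖jetCoeff n a l * conj (jetCoeff n b l)‖ ≤ 2 := by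
    intro l hl
    rw [norm_mul, Complex.norm_conj]
    calc _ ≤ √2 * √2 := mul_le_mul (norm_jetCoeff_le a hl) (norm_jetCoeff_le b hl)
          (norm_nonneg _) (Real.sqrt_nonneg _)
      _ = 2 := Real.mul_self_sqrt (by norm_num)
  have h1 := integral_norm_pow_six_le (freq n) (fun l => jetCoeff n a l * conj (jetCoeff n b l))
    h2 (by norm_num)
  have h3 : ∫ x : Torus, ‖crossCov n a b x‖ ^ 6 = (1 / (numFreq n : ℝ)) ^ 6 *
      ∫ x : Torus, ‖∑ l ∈ freq n, jetCoeff n a l * conj (jetCoeff n b l) *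
        UnitAddTorus.mFourier l x‖ ^ 6 := by
    rw [← integral_const_mul]
    refine integral_congr_ae (Filter.Eventually.of_forall fun x => ?_)
    simp only [crossCov, norm_mul, mul_pow]
    simp
  have h4 : sixthMoment n = (1 / (numFreq n : ℝ)) ^ 6 *
      ∫ x : Torus, ‖∑ l ∈ freq n, UnitAddTorus.mFourier l x‖ ^ 6 := by
    rw [sixthMoment, ← integral_const_mul]
    refine integral_congr_ae (Filter.Eventually.of_forall fun x => ?_)
    simp only
    rw [← mul_pow, ← norm_covFun, Even.pow_abs (by decide)]
  rw [h3, h4]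
  calc _ ≤ (1 / (numFreq n : ℝ)) ^ 6 * (2 ^ 6 * _) := by gcongr
    _ = _ := by ring

theorem abs_phase_le {n : ℕ} {l : Fin 2 → ℤ} (hl : l ∈ freq n) {x : Fin 2 → ℝ} {h : ℝ}
    (hx : ∀ i, |x i| ≤ h) : |phase l x| ≤ 4 * Real.pi * √n * h := by
  have h1 : |(l 0 : ℝ) * x 0 + l 1 * x 1| ≤ √n * h + √n * h := by
    refine (abs_add_le _ _).trans (add_le_add ?_ ?_) <;> rw [abs_mul]
    · exact mul_le_mul (abs_coord_le hl 0) (hx 0) (abs_nonneg _) (Real.sqrt_nonneg _)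
    · exact mul_le_mul (abs_coord_le hl 1) (hx 1) (abs_nonneg _) (Real.sqrt_nonneg _)
  rw [phase, abs_mul, abs_of_pos (by positivity)]
  nlinarith [Real.pi_pos]

/-- The covariances vary on the scale `1 / √n`, since the frequencies have length `√n`. This keeps
the correlation nearly constant on pairs of small cells. -/
theorem norm_crossCov_sub_le {n : ℕ} (a b : Fin 3) {x y : Fin 2 → ℝ} {h : ℝ} (h0 : 0 ≤ h)
    (hx : ∀ i, |x i - y i| ≤ h) :
    ‖crossCov n a b (tmk x) - crossCov n a b (tmk y)‖ ≤ 8 * Real.pi * √n * h := by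
  rw [crossCov, crossCov, ← mul_sub, ← Finset.sum_sub_distrib]
  have h1 : ∀ l ∈ freq n, ‖jetCoeff n a l * conj (jetCoeff n b l) * UnitAddTorus.mFourier l (tmk x) -
      jetCoeff n a l * conj (jetCoeff n b l) * UnitAddTorus.mFourier l (tmk y)‖ ≤
      2 * (4 * Real.pi * √n * h) := by
    intro l hl
    rw [← mul_sub, norm_mul, norm_mul, Complex.norm_conj, mFourier_tmk, mFourier_tmk]
    have h2 : ‖jetCoeff n a l‖ * ‖jetCoeff n b l‖ ≤ 2 := by
      calc _ ≤ √2 * √2 := mul_le_mul (norm_jetCoeff_le a hl) (norm_jetCoeff_le b hl)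
            (norm_nonneg _) (Real.sqrt_nonneg _)
        _ = 2 := Real.mul_self_sqrt (by norm_num)
    refine mul_le_mul h2 ((norm_exp_mul_I_sub_le _ _).trans ?_) (norm_nonneg _) (by norm_num)
    have h3 : phase l x - phase l y = phase l (x - y) := by
      simp only [phase, Pi.sub_apply]; ring
    rw [h3]
    exact abs_phase_le hl hx
  rw [norm_mul]
  calc _ ≤ (1 / (numFreq n : ℝ)) * ∑ l ∈ freq n, 2 * (4 * Real.pi * √n * h) := by
        refine mul_le_mul (by simp) ((norm_sum_le _ _).trans (Finset.sum_le_sum h1))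
          (norm_nonneg _) (by positivity)
    _ = (numFreq n : ℝ) / numFreq n * (8 * Real.pi * √n * h) := by
        simp [numFreq]; ring
    _ ≤ 1 * (8 * Real.pi * √n * h) := by
        gcongr
        exact div_self_le_one _
    _ = _ := one_mul _

end Jets

/-! ### Gaussian integrals over slabs -/

section Slab

open scoped RealInnerProductSpace

variable {E : Type*} [NormedAddCommGroup E] [InnerProductSpace ℝ E] [FiniteDimensional ℝ E]
  [MeasurableSpace E] [BorelSpace E] {ι : Type*} [Fintype ι]

theorem measurePreserving_inner_orthonormal {e : ι → E} (he : Orthonormal ℝ e) :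
    MeasurePreserving (fun x i => ⟪e i, x⟫) (stdGaussian E)
      (Measure.pi fun _ : ι => gaussianReal 0 1) := by
  set L : E →L[ℝ] EuclideanSpace ℝ ι :=
    (EuclideanSpace.equiv ι ℝ).symm.toContinuousLinearMap.comp
      (ContinuousLinearMap.pi fun i => innerSL ℝ (e i)) with hL
  have hLa : ∀ x i, L x i = ⟪e i, x⟫ := fun x i => rfl
  have h1 : ∀ τ, ContinuousLinearMap.adjoint L τ = ∑ i, τ i • e i := by
    intro τ
    refine ext_inner_right ℝ fun x => ?_
    rw [ContinuousLinearMap.adjoint_inner_left, sum_inner, PiLp.inner_apply]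
    refine Finset.sum_congr rfl fun i _ => ?_
    rw [hLa, inner_smul_left]
    simp [mul_comm]
  have h2 : IsCoisometry L := by
    intro τ
    rw [h1]
    have : ‖∑ i, τ i • e i‖ ^ 2 = ‖τ‖ ^ 2 := by
      rw [← real_inner_self_eq_norm_sq, he.inner_sum, EuclideanSpace.real_norm_sq_eq]
      simp [sq]
    exact (sq_eq_sq₀ (norm_nonneg _) (norm_nonneg _)).1 this
  have h3 := h2.measurePreserving
  refine ⟨by fun_prop, ?_⟩
  have h4 : (fun x i => ⟪e i, x⟫) = WithLp.ofLp ∘ L := rfl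
  rw [h4, ← Measure.map_map (by fun_prop) (by fun_prop), h3.map_eq, ← map_pi_eq_stdGaussian,
    Measure.map_map (by fun_prop) (by fun_prop)]
  exact Measure.map_id

theorem lintegral_prod_inner_orthonormal {e : ι → E} (he : Orthonormal ℝ e) {f : ι → ℝ → ℝ≥0∞}
    (hf : ∀ i, Measurable (f i)) :
    ∫⁻ x, ∏ i, f i ⟪e i, x⟫ ∂(stdGaussian E) = ∏ i, ∫⁻ t, f i t ∂(gaussianReal 0 1) := by
  have h1 := (measurePreserving_inner_orthonormal he).lintegral_comp
    (f := fun t => ∏ i, f i (t i)) (by fun_prop)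
  rw [h1]
  have h2 : iIndepFun (fun i (t : ι → ℝ) => f i (t i))
      (Measure.pi fun _ : ι => gaussianReal 0 1) :=
    iIndepFun_pi fun i => (hf i).aemeasurable
  rw [lintegral_prod_eq_prod_lintegral_of_indepFun Finset.univ _ h2 (by fun_prop)]
  refine Finset.prod_congr rfl fun i _ => ?_
  exact (measurePreserving_eval (fun _ : ι => gaussianReal 0 1) i).lintegral_comp (hf i)

theorem gaussianReal_le_volume : gaussianReal 0 1 ≤ (volume : Measure ℝ) := by
  rw [gaussianReal_of_var_ne_zero _ one_ne_zero]
  refine (withDensity_mono (ae_of_all _ fun x => ?_)).trans withDensity_one.le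
  rw [gaussianPDF, Pi.one_apply, ENNReal.ofReal_le_one, gaussianPDFReal]
  refine mul_le_one₀ (inv_le_one_of_one_le₀ (Real.one_le_sqrt.2 ?_)) (Real.exp_pos _).le
    (Real.exp_le_one_iff.2 ?_)
  · have := Real.pi_gt_three
    simp only [NNReal.coe_one]
    linarith
  · simp only [NNReal.coe_one, sub_zero]
    have := sq_nonneg x
    linarith

/-- The fourth moment of the standard Gaussian. -/
def fourthMoment : ℝ≥0∞ := ∫⁻ t, ENNReal.ofReal (t ^ 4) ∂(gaussianReal 0 1)

theorem fourthMoment_ne_top : fourthMoment ≠ ∞ := by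
  have h : Integrable (fun t : ℝ => t ^ 4) (gaussianReal 0 1) := by
    have := (memLp_id_gaussianReal (μ := 0) (v := 1) 4).integrable_norm_pow (by norm_num)
    refine this.congr (ae_of_all _ fun t => ?_)
    simp only [id, Real.norm_eq_abs]
    exact Even.pow_abs (by decide) t
  rw [fourthMoment, ← ofReal_integral_eq_lintegral_ofReal h (ae_of_all _ fun t => by positivity)]
  exact ENNReal.ofReal_ne_top

/-- The indicator that the coordinates of a vector along `e` lie in prescribed sets. -/
def slab (e : ι → E) (A : ι → Set ℝ) (x : E) : ℝ≥0∞ := ∏ i, (A i).indicator 1 ⟪e i, x⟫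

theorem measurable_slab (e : ι → E) {A : ι → Set ℝ} (hA : ∀ i, MeasurableSet (A i)) :
    Measurable (slab e A) :=
  Finset.measurable_prod _ fun i _ => (measurable_one.indicator (hA i)).comp (by fun_prop)

theorem slab_eq_one {e : ι → E} {A : ι → Set ℝ} {x : E} (h : ∀ i, ⟪e i, x⟫ ∈ A i) :
    slab e A x = 1 :=
  Finset.prod_eq_one fun i _ => by simp [h i]

theorem slab_eq_zero {e : ι → E} {A : ι → Set ℝ} {x : E} (h : ¬ ∀ i, ⟪e i, x⟫ ∈ A i) :
    slab e A x = 0 := by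
  push Not at h
  obtain ⟨i, hi⟩ := h
  exact Finset.prod_eq_zero (Finset.mem_univ i) (by simp [hi])

theorem lintegral_slab_le {e : ι → E} (he : Orthonormal ℝ e) {A : ι → Set ℝ}
    (hA : ∀ i, MeasurableSet (A i)) :
    ∫⁻ x, slab e A x ∂(stdGaussian E) ≤ ∏ i, volume (A i) := by
  unfold slab
  rw [lintegral_prod_inner_orthonormal he fun i => measurable_one.indicator (hA i)]
  refine Finset.prod_le_prod' fun i _ => ?_
  rw [lintegral_indicator_one (hA i)]
  exact gaussianReal_le_volume _

/-- Normalised, `ξ` extends `e` to a larger orthonormal family, so its coordinate is independent of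
the slab and the integral factorises. -/
theorem lintegral_slab_mul_pow_le_of_orthogonal {e : ι → E} (he : Orthonormal ℝ e)
    {A : ι → Set ℝ} (hA : ∀ i, MeasurableSet (A i)) {ξ : E} (hξ : ∀ i, ⟪e i, ξ⟫ = 0) :
    ∫⁻ x, slab e A x * ENNReal.ofReal (⟪ξ, x⟫ ^ 4) ∂(stdGaussian E) ≤
      ENNReal.ofReal (‖ξ‖ ^ 4) * fourthMoment * ∏ i, volume (A i) := by
  classical
  by_cases h0 : ξ = 0
  · simp [h0]
  have h0' : ‖ξ‖ ≠ 0 := norm_ne_zero_iff.2 h0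
  set η : E := ‖ξ‖⁻¹ • ξ with hη
  have he' : Orthonormal ℝ (fun o : Option ι => o.elim η e) := by
    constructor
    · rintro (_ | i)
      · simp [hη, norm_smul, h0']
      · exact he.1 i
    · rintro (_ | i) (_ | j) hij
      · exact (hij rfl).elim
      · change ⟪η, e j⟫ = 0
        rw [hη, inner_smul_left, real_inner_comm, hξ, mul_zero]
      · simp [hη, inner_smul_right, hξ i]
      · exact he.2 (by simpa using hij)
  have h1 : ∀ x, slab e A x * ENNReal.ofReal (⟪ξ, x⟫ ^ 4) =
      ENNReal.ofReal (‖ξ‖ ^ 4) * ∏ o : Option ι,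
        (o.elim (fun t => ENNReal.ofReal (t ^ 4)) (fun i => (A i).indicator 1) : ℝ → ℝ≥0∞)
          ⟪o.elim η e, x⟫ := by
    intro x
    rw [Fintype.prod_option]
    simp only [Option.elim]
    rw [← mul_assoc, ← ENNReal.ofReal_mul (by positivity), ← mul_pow, hη, inner_smul_left,
      mul_comm (slab e A x)]
    simp [h0', slab]
  simp_rw [h1]
  rw [lintegral_const_mul' _ _ ENNReal.ofReal_ne_top,
    lintegral_prod_inner_orthonormal he', Fintype.prod_option, mul_assoc]
  · gcongr
    · rfl
    · simp only [Option.elim]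
      rw [lintegral_indicator_one (hA _)]
      exact gaussianReal_le_volume _
  · rintro (_ | i)
    · exact ENNReal.measurable_ofReal.comp (by fun_prop)
    · exact measurable_one.indicator (hA i)

theorem add_pow_four_le (a b : ℝ) : (a + b) ^ 4 ≤ 8 * (a ^ 4 + b ^ 4) := by
  nlinarith [sq_nonneg (a - b), sq_nonneg (a ^ 2 - b ^ 2), sq_nonneg (a + b),
    sq_nonneg (a ^ 2 + b ^ 2 - 2 * a * b), mul_nonneg (sq_nonneg (a - b)) (sq_nonneg (a + b))]

/-- Split `ξ` into its projection on the span of `e`, whose pairing with `x` is bounded on the slab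
because the windows lie in `[-1, 1]`, and an orthogonal remainder covered by the preceding estimate.
-/
theorem lintegral_slab_mul_pow_le {e : ι → E} (he : Orthonormal ℝ e)
    {A : ι → Set ℝ} (hA : ∀ i, MeasurableSet (A i)) (hA1 : ∀ i, A i ⊆ Set.Icc (-1) 1) (ξ : E) :
    ∫⁻ x, slab e A x * ENNReal.ofReal (⟪ξ, x⟫ ^ 4) ∂(stdGaussian E) ≤
      8 * ((Fintype.card ι : ℝ≥0∞) ^ 4 + fourthMoment) * ENNReal.ofReal (‖ξ‖ ^ 4) *
        ∏ i, volume (A i) := by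
  set π : E := ∑ i, ⟪e i, ξ⟫ • e i with hπ
  have hei : ∀ i, ⟪e i, π⟫ = ⟪e i, ξ⟫ := by
    intro i
    rw [hπ, he.inner_right_sum _ (Finset.mem_univ i)]
  have hξ : ∀ i, ⟪e i, ξ - π⟫ = 0 := fun i => by rw [inner_sub_right, hei, sub_self]
  have hn : ‖ξ - π‖ ≤ ‖ξ‖ := by
    have h1 : ⟪ξ - π, π⟫ = 0 := by
      rw [hπ, inner_sum]
      refine Finset.sum_eq_zero fun i _ => ?_
      rw [inner_smul_right, real_inner_comm (e i) (ξ - _), ← hπ, hξ, mul_zero]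
    have h2 : ‖ξ‖ ^ 2 = ‖ξ - π‖ ^ 2 + ‖π‖ ^ 2 := by
      have := norm_add_sq_real (ξ - π) π
      rw [h1, sub_add_cancel] at this
      linarith
    exact (sq_le_sq₀ (norm_nonneg _) (norm_nonneg _)).1 (by nlinarith [sq_nonneg ‖π‖])
  have hπx : ∀ x, (∀ i, ⟪e i, x⟫ ∈ A i) → |⟪π, x⟫| ≤ Fintype.card ι * ‖ξ‖ := by
    intro x hx
    rw [hπ, sum_inner]
    refine (Finset.abs_sum_le_sum_abs _ _).trans ?_
    refine (Finset.sum_le_card_nsmul _ _ ‖ξ‖ fun i _ => ?_).trans (by simp)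
    rw [inner_smul_left, abs_mul]
    have h1 : |⟪e i, ξ⟫| ≤ ‖ξ‖ := by
      have := abs_real_inner_le_norm (e i) ξ
      rwa [he.1, one_mul] at this
    have h2 : |⟪e i, x⟫| ≤ 1 := abs_le.2 (hA1 i (hx i))
    simpa using mul_le_mul h1 h2 (abs_nonneg _) (norm_nonneg _)
  have key : ∀ x, slab e A x * ENNReal.ofReal (⟪ξ, x⟫ ^ 4) ≤
      8 * (Fintype.card ι : ℝ≥0∞) ^ 4 * ENNReal.ofReal (‖ξ‖ ^ 4) * slab e A x +
      8 * (slab e A x * ENNReal.ofReal (⟪ξ - π, x⟫ ^ 4)) := by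
    intro x
    by_cases hx : ∀ i, ⟪e i, x⟫ ∈ A i
    · rw [slab_eq_one hx, one_mul, mul_one, one_mul]
      have h1 : ⟪ξ, x⟫ ^ 4 ≤ 8 * ((Fintype.card ι : ℝ) ^ 4 * ‖ξ‖ ^ 4) + 8 * ⟪ξ - π, x⟫ ^ 4 := by
        have h2 : ⟪ξ, x⟫ = ⟪π, x⟫ + ⟪ξ - π, x⟫ := by rw [← inner_add_left, add_sub_cancel]
        have h3 : ⟪π, x⟫ ^ 4 ≤ (Fintype.card ι * ‖ξ‖) ^ 4 := by
          rw [← Even.pow_abs (by decide : Even 4) ⟪π, x⟫]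
          exact pow_le_pow_left₀ (abs_nonneg _) (hπx x hx) 4
        rw [h2, ← mul_pow]
        linarith [add_pow_four_le ⟪π, x⟫ ⟪ξ - π, x⟫]
      refine (ENNReal.ofReal_le_ofReal h1).trans ?_
      rw [ENNReal.ofReal_add (by positivity) (by positivity), ENNReal.ofReal_mul (by norm_num),
        ENNReal.ofReal_mul (by positivity), ENNReal.ofReal_mul (by norm_num),
        ENNReal.ofReal_pow (by positivity), ENNReal.ofReal_natCast, mul_assoc]
      simp
    · simp [slab_eq_zero hx]
  refine (lintegral_mono key).trans ?_
  rw [lintegral_add_left (by have := measurable_slab e hA; fun_prop),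
    lintegral_const_mul _ (measurable_slab e hA), lintegral_const_mul' _ _ (by norm_num)]
  refine (add_le_add (mul_le_mul_right (lintegral_slab_le he hA) _)
    (mul_le_mul_right ((lintegral_slab_mul_pow_le_of_orthogonal he hA hξ).trans
    (mul_le_mul_left (mul_le_mul_left (ENNReal.ofReal_le_ofReal
      (pow_le_pow_left₀ (norm_nonneg _) hn 4)) _) _)) _)).trans (le_of_eq ?_)
  ring

end Slab

/-! ### Approximate Dirac masses and their chaos components, uniformly in `ε` -/

section ZeroKernel

open scoped RealInnerProductSpace

/-- The space of one-jets. -/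
abbrev JetSpace : Type := EuclideanSpace ℂ (Fin 3)

/-- The approximate Dirac mass at the zeros of the value, weighted by the Jacobian. -/
def zeroKernel (ε : ℝ) (z : JetSpace) : ℝ :=
  if |(z 0).re| ≤ ε ∧ |(z 0).im| ≤ ε then ((2 * ε) ^ 2)⁻¹ * |(conj (z 1) * z 2).im| else 0

theorem zeroKernel_nonneg (ε : ℝ) (z : JetSpace) : 0 ≤ zeroKernel ε z := by
  unfold zeroKernel
  split_ifs <;> positivity

theorem measurable_zeroKernel (ε : ℝ) : Measurable (zeroKernel ε) := by
  unfold zeroKernel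
  have h : ∀ a : Fin 3, Measurable fun z : JetSpace => z a := fun a => by fun_prop
  refine Measurable.ite ?_ ?_ measurable_const
  · exact (measurableSet_le (Complex.measurable_re.comp (h 0)).abs measurable_const).inter
      (measurableSet_le (Complex.measurable_im.comp (h 0)).abs measurable_const)
  · exact (Complex.measurable_im.comp (((by fun_prop : Measurable (conj : ℂ → ℂ)).comp
      (h 1)).mul (h 2))).abs.const_mul _

theorem abs_im_conj_mul_le (z w : ℂ) : |(conj z * w).im| ≤ ‖z‖ * ‖w‖ := by
  refine (Complex.abs_im_le_norm _).trans (le_of_eq ?_)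
  rw [norm_mul, Complex.norm_conj]

theorem zeroKernel_le (ε : ℝ) (z : JetSpace) :
    zeroKernel ε z ≤ ((2 * ε) ^ 2)⁻¹ * ‖z‖ ^ 2 := by
  unfold zeroKernel
  split_ifs
  · refine mul_le_mul_of_nonneg_left ((abs_im_conj_mul_le _ _).trans ?_) (by positivity)
    rw [sq]
    exact mul_le_mul (PiLp.norm_apply_le z 1) (PiLp.norm_apply_le z 2) (norm_nonneg _)
      (norm_nonneg _)
  · positivity

/-- The real coordinates of the jet space. -/
def jetCoord (a : Fin 3) (c : ℂ) : JetSpace := EuclideanSpace.single a c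

theorem inner_jetCoord (a : Fin 3) (c : ℂ) (z : JetSpace) :
    ⟪jetCoord a c, z⟫ = (conj c * z a).re := by
  rw [real_inner_eq_re]
  congr 1
  rw [Finset.sum_eq_single a]
  · simp [jetCoord]
  · intro b _ hb
    simp [jetCoord, hb]
  · simp

theorem inner_jetCoord_one (a : Fin 3) (z : JetSpace) : ⟪jetCoord a 1, z⟫ = (z a).re := by
  simp [inner_jetCoord]

theorem inner_jetCoord_I (a : Fin 3) (z : JetSpace) : ⟪jetCoord a Complex.I, z⟫ = (z a).im := by
  simp [inner_jetCoord]

theorem norm_jetCoord (a : Fin 3) (c : ℂ) : ‖jetCoord a c‖ = ‖c‖ := by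
  simp [jetCoord]

theorem inner_jetCoord_jetCoord (a b : Fin 3) (c d : ℂ) :
    ⟪jetCoord a c, jetCoord b d⟫ = if a = b then (conj c * d).re else 0 := by
  rw [inner_jetCoord]
  split_ifs with h
  · simp [jetCoord, h]
  · simp [jetCoord, h]

theorem orthonormal_jetCoord_zero : Orthonormal ℝ ![jetCoord 0 1, jetCoord 0 Complex.I] := by
  constructor
  · intro i; fin_cases i <;> simp [norm_jetCoord]
  · intro i j hij
    fin_cases i <;> fin_cases j <;> simp [inner_jetCoord_jetCoord] at hij ⊢

/-- The retraction of the Mehler semigroup at which the kernels are estimated. -/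
def halfInterval : unitInterval := ⟨1 / 2, by norm_num, by norm_num⟩

theorem volume_setOf_abs_add_mul_le {c t ε : ℝ} (ht : 1 / 2 ≤ t) (hε : 0 ≤ ε) :
    volume {r : ℝ | |c + t * r| ≤ ε} ≤ ENNReal.ofReal (4 * ε) := by
  have ht0 : 0 < t := by linarith
  have h : {r : ℝ | |c + t * r| ≤ ε} ⊆ Set.Icc ((-ε - c) / t) ((ε - c) / t) := by
    intro r hr
    rw [Set.mem_ofPred_eq, abs_le] at hr
    constructor
    · rw [div_le_iff₀ ht0]; linarith [hr.1]
    · rw [le_div_iff₀ ht0]; linarith [hr.2]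
  refine (measure_mono h).trans ?_
  rw [Real.volume_Icc, ← sub_div]
  refine ENNReal.ofReal_le_ofReal ?_
  rw [div_le_iff₀ ht0]
  nlinarith

theorem measurableSet_setOf_abs_add_mul_le (c t ε : ℝ) :
    MeasurableSet {r : ℝ | |c + t * r| ≤ ε} :=
  measurableSet_le (by fun_prop) measurable_const

/-- At `s = 1/2` the added noise has amplitude `√3/2 ≥ 1/2`. For fixed `x` the indicator then
confines two noise coordinates to windows of total measure `O(ε²)`, which cancels the normalisation
`(2ε)^(-2)`, while the Jacobian involves only coordinates independent of these. -/
theorem lintegral_zeroKernel_mix_le {ε : ℝ} (hε : 0 < ε) (x : JetSpace) :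
    ∫⁻ y, ENNReal.ofReal (zeroKernel ε (mix halfInterval (x, y))) ∂(stdGaussian JetSpace) ≤
      16 * (2 * ENNReal.ofReal (‖x‖ ^ 2) + 2 + 2 * fourthMoment) := by
  set s : ℝ := (halfInterval : ℝ) with hs
  set t : ℝ := √(1 - s ^ 2) with ht
  have hs2 : s = 1 / 2 := rfl
  have htt : t ^ 2 = 3 / 4 := by
    rw [ht, Real.sq_sqrt] <;> rw [hs2] <;> norm_num
  have ht0 : 0 ≤ t := Real.sqrt_nonneg _
  have ht1 : 1 / 2 ≤ t := by nlinarith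
  have ht2 : t ≤ 1 := by nlinarith
  have hmix : ∀ y a, mix halfInterval (x, y) a = s * x a + t * y a := by
    intro y a
    simp [mix, ← hs, ← ht]
  set e : Fin 2 → JetSpace := ![jetCoord 0 1, jetCoord 0 Complex.I] with he
  set A : Fin 2 → Set ℝ := fun i => {r | |s * ⟪e i, x⟫ + t * r| ≤ ε} with hA
  have hAm : ∀ i, MeasurableSet (A i) := fun i => measurableSet_setOf_abs_add_mul_le _ _ _
  have hAv : ∏ i, volume (A i) ≤ ENNReal.ofReal (4 * ε) ^ 2 := by
    refine (Finset.prod_le_prod' fun i _ => volume_setOf_abs_add_mul_le ht1 hε.le).trans ?_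
    simp
  set ξ : Fin 2 × Fin 2 → JetSpace := fun p => jetCoord (p.1.succ) (![1, Complex.I] p.2) with hξ
  have hξ1 : ∀ p, ‖ξ p‖ = 1 := by
    rintro ⟨p, q⟩
    rw [hξ, norm_jetCoord]
    fin_cases q <;> simp
  have hξe : ∀ p i, ⟪e i, ξ p⟫ = 0 := by
    rintro ⟨p, q⟩ i
    have hp : (0 : Fin 3) ≠ p.succ := (Fin.succ_ne_zero p).symm
    fin_cases i <;> simp [he, hξ, inner_jetCoord_jetCoord, hp]
  have key : ∀ y, ENNReal.ofReal (zeroKernel ε (mix halfInterval (x, y))) ≤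
      ENNReal.ofReal (((2 * ε) ^ 2)⁻¹) * ∑ p : Fin 2 × Fin 2,
        ((2 * ENNReal.ofReal (‖x‖ ^ 2) + 2) * slab e A y +
          2 * (slab e A y * ENNReal.ofReal (⟪ξ p, y⟫ ^ 4))) := by
    intro y
    set z := mix halfInterval (x, y) with hz
    by_cases hzε : |(z 0).re| ≤ ε ∧ |(z 0).im| ≤ ε
    · have hsl : slab e A y = 1 := by
        refine slab_eq_one fun i => ?_
        fin_cases i
        · simpa [hA, he, inner_jetCoord_one, hmix, hz] using hzε.1
        · simpa [hA, he, inner_jetCoord_I, hmix, hz] using hzε.2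
      rw [hsl, zeroKernel, if_pos hzε, ENNReal.ofReal_mul (by positivity)]
      refine mul_le_mul_right ?_ _
      have h1 : ∀ p, ⟪ξ p, z⟫ ^ 2 ≤ 2 * ‖x‖ ^ 2 + 2 + 2 * ⟪ξ p, y⟫ ^ 4 := by
        intro p
        have h2 : ⟪ξ p, z⟫ = s * ⟪ξ p, x⟫ + t * ⟪ξ p, y⟫ := by
          rw [hz, mix, inner_add_right, inner_smul_right, inner_smul_right]
        have h3 : ⟪ξ p, x⟫ ^ 2 ≤ ‖x‖ ^ 2 := by
          have := abs_real_inner_le_norm (ξ p) x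
          rw [hξ1, one_mul] at this
          exact sq_le_sq' (abs_le.1 this).1 (abs_le.1 this).2
        have h4 : ⟪ξ p, y⟫ ^ 2 ≤ 1 + ⟪ξ p, y⟫ ^ 4 := by nlinarith [sq_nonneg (⟪ξ p, y⟫ ^ 2 - 1)]
        have h5 : (s * ⟪ξ p, x⟫ + t * ⟪ξ p, y⟫) ^ 2 ≤
            2 * (s ^ 2 * ⟪ξ p, x⟫ ^ 2) + 2 * (t ^ 2 * ⟪ξ p, y⟫ ^ 2) := by
          nlinarith [sq_nonneg (s * ⟪ξ p, x⟫ - t * ⟪ξ p, y⟫)]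
        rw [h2]
        rw [htt, hs2] at h5
        rw [hs2]
        nlinarith [sq_nonneg ⟪ξ p, x⟫, sq_nonneg ⟪ξ p, y⟫]
      -- The Jacobian is replaced by the squares of the four real gradient coordinates, each
      -- orthogonal to the slab directions.
      have h6 : |(conj (z 1) * z 2).im| ≤ ∑ p, ⟪ξ p, z⟫ ^ 2 := by
        refine (abs_im_conj_mul_le _ _).trans ?_
        have h7 : ∑ p, ⟪ξ p, z⟫ ^ 2 = ‖z 1‖ ^ 2 + ‖z 2‖ ^ 2 := by
          rw [Fintype.sum_prod_type, Fin.sum_univ_two, Fin.sum_univ_two, Fin.sum_univ_two]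
          rw [Complex.sq_norm, Complex.sq_norm, Complex.normSq_apply, Complex.normSq_apply]
          simp [hξ, inner_jetCoord, sq]
        rw [h7]
        nlinarith [sq_nonneg (‖z 1‖ - ‖z 2‖), sq_nonneg ‖z 1‖, sq_nonneg ‖z 2‖]
      refine (ENNReal.ofReal_le_ofReal (h6.trans (Finset.sum_le_sum fun p _ => h1 p))).trans ?_
      rw [ENNReal.ofReal_sum_of_nonneg fun p _ => by positivity]
      refine Finset.sum_le_sum fun p _ => ?_
      rw [ENNReal.ofReal_add (by positivity) (by positivity),
        ENNReal.ofReal_add (by positivity) (by positivity), ENNReal.ofReal_mul (by norm_num),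
        ENNReal.ofReal_mul (by norm_num)]
      simp
    · simp [zeroKernel, hzε]
  have hsm := measurable_slab e hAm
  refine (lintegral_mono key).trans ?_
  rw [lintegral_const_mul' _ _ ENNReal.ofReal_ne_top, lintegral_finsetSum' _ (by fun_prop)]
  have h8 : ∀ p, ∫⁻ y, ((2 * ENNReal.ofReal (‖x‖ ^ 2) + 2) * slab e A y +
      2 * (slab e A y * ENNReal.ofReal (⟪ξ p, y⟫ ^ 4))) ∂(stdGaussian JetSpace) ≤
      (2 * ENNReal.ofReal (‖x‖ ^ 2) + 2 + 2 * fourthMoment) * ENNReal.ofReal (4 * ε) ^ 2 := by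
    intro p
    rw [lintegral_add_left (by fun_prop), lintegral_const_mul _ hsm,
      lintegral_const_mul' _ _ (by norm_num), add_mul _ (2 * fourthMoment), mul_assoc 2 fourthMoment]
    refine add_le_add (mul_le_mul_right ((lintegral_slab_le orthonormal_jetCoord_zero hAm).trans
      hAv) _) (mul_le_mul_right ((lintegral_slab_mul_pow_le_of_orthogonal
      orthonormal_jetCoord_zero hAm (hξe p)).trans ?_) _)
    rw [hξ1]
    simpa using mul_le_mul_right hAv fourthMoment
  refine (mul_le_mul_right (Finset.sum_le_sum fun p _ => h8 p) _).trans (le_of_eq ?_)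
  rw [Finset.sum_const, nsmul_eq_mul, mul_left_comm, mul_left_comm _ (2 * _ + _ + _),
    mul_left_comm _ (2 * _ + _ + _), mul_comm (16 : ℝ≥0∞)]
  congr 1
  have h9 : ((Finset.univ : Finset (Fin 2 × Fin 2)).card : ℝ≥0∞) = ENNReal.ofReal 4 := by
    simp
  rw [h9, ← ENNReal.ofReal_pow (by positivity), ← ENNReal.ofReal_mul (by positivity),
    ← ENNReal.ofReal_mul (by positivity)]
  -- Four gradient coordinates, times the ratio of the window area `(4ε)²` to the normalisation
  -- `(2ε)²`.
  have h10 : 4 * (((2 * ε) ^ 2)⁻¹ * (4 * ε) ^ 2) = 16 := by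
    field_simp
    norm_num
  rw [h10]
  simp

theorem memLp_norm_sq_stdGaussian {E : Type*} [NormedAddCommGroup E] [InnerProductSpace ℝ E]
    [FiniteDimensional ℝ E] [MeasurableSpace E] [BorelSpace E] :
    MemLp (fun z : E => ‖z‖ ^ 2) 2 (stdGaussian E) := by
  rw [memLp_two_iff_integrable_sq (by fun_prop)]
  have := (IsGaussian.memLp_id (stdGaussian E) 4 (by norm_num)).integrable_norm_pow (by norm_num)
  refine this.congr (ae_of_all _ fun z => ?_)
  change ‖z‖ ^ 4 = _
  ring

theorem memLp_zeroKernel (ε : ℝ) : MemLp (zeroKernel ε) 2 (stdGaussian JetSpace) := by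
  refine (memLp_norm_sq_stdGaussian.const_mul ((2 * ε) ^ 2)⁻¹).mono'
    (measurable_zeroKernel ε).aestronglyMeasurable (ae_of_all _ fun z => ?_)
  rw [Real.norm_of_nonneg (zeroKernel_nonneg ε z)]
  exact zeroKernel_le ε z

/-- The approximate Dirac mass as an element of `L²`. -/
def zeroKernelLp (ε : ℝ) : Lp ℝ 2 (stdGaussian JetSpace) := (memLp_zeroKernel ε).toLp (zeroKernel ε)

theorem coeFn_zeroKernelLp (ε : ℝ) : zeroKernelLp ε =ᵐ[stdGaussian JetSpace] zeroKernel ε :=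
  (memLp_zeroKernel ε).coeFn_toLp

theorem exists_norm_mehlerOp_zeroKernel_le : ∃ C : ℝ, ∀ ε : ℝ, 0 < ε →
    ‖mehlerOp halfInterval (zeroKernelLp ε)‖ ≤ C := by
  set Φ : JetSpace → ℝ := fun x => 32 * ‖x‖ ^ 2 + (32 + 32 * fourthMoment.toReal)
  have hΦ : MemLp Φ 2 (stdGaussian JetSpace) :=
    (memLp_norm_sq_stdGaussian.const_mul 32).add (memLp_const _)
  refine ⟨(eLpNorm Φ 2 (stdGaussian JetSpace)).toReal, fun ε hε => ?_⟩
  rw [Lp.norm_def]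
  refine ENNReal.toReal_mono hΦ.2.ne (eLpNorm_mono_ae_real ?_)
  have h1 : ∀ᵐ x ∂(stdGaussian JetSpace), ∀ᵐ y ∂(stdGaussian JetSpace),
      zeroKernelLp ε (mix halfInterval (x, y)) = zeroKernel ε (mix halfInterval (x, y)) :=
    Measure.ae_ae_of_ae_prod
      ((measurePreserving_mix halfInterval).quasiMeasurePreserving.ae_eq_comp
        (coeFn_zeroKernelLp ε))
  filter_upwards [h1, coeFn_mehlerOp halfInterval (zeroKernelLp ε)] with x hx hx'
  have h2 : Measurable fun y => zeroKernel ε (mix halfInterval (x, y)) :=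
    (measurable_zeroKernel ε).comp ((continuous_mix _).measurable.comp measurable_prodMk_left)
  rw [hx', integral_congr_ae hx, integral_eq_lintegral_of_nonneg_ae
    (ae_of_all _ fun y => zeroKernel_nonneg _ _) h2.aestronglyMeasurable,
    Real.norm_of_nonneg ENNReal.toReal_nonneg]
  refine ENNReal.toReal_le_of_le_ofReal (by positivity)
    ((lintegral_zeroKernel_mix_le hε x).trans (le_of_eq ?_))
  simp only [Φ]
  rw [ENNReal.ofReal_add (by positivity) (by positivity), ENNReal.ofReal_add (by positivity)
    (by positivity), ENNReal.ofReal_mul (by positivity), ENNReal.ofReal_mul (by positivity),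
    ENNReal.ofReal_toReal fourthMoment_ne_top]
  simp only [ENNReal.ofReal_ofNat]
  ring

/-- The kernels themselves blow up in `L²` as `ε` tends to 0. Bounding them after smoothing at `s =
1/2` costs only a factor `2 ^ q` on the q-th chaos, which a small enough correlation absorbs. -/
theorem exists_norm_gaussProj_zeroKernel_le : ∃ C : ℝ, 0 ≤ C ∧ ∀ ε : ℝ, 0 < ε → ∀ q : ℕ,
    ‖gaussProj q (zeroKernelLp ε)‖ ≤ C * 2 ^ q := by
  obtain ⟨C, hC⟩ := exists_norm_mehlerOp_zeroKernel_le
  refine ⟨C, (norm_nonneg _).trans (hC 1 one_pos), fun ε hε q => ?_⟩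
  have h := (norm_gaussProj_le halfInterval q (zeroKernelLp ε)).trans (hC ε hε)
  have h1 : ((halfInterval : ℝ)) = 1 / 2 := rfl
  rw [h1, one_div, inv_pow, inv_mul_le_iff₀ (by positivity)] at h
  linarith

end ZeroKernel

/-! ### Probability that one or two complex Gaussian forms are small -/

section LinForm

open scoped RealInnerProductSpace

variable {ι : Type*} [Fintype ι]

/-- The linear form with coefficients `k`. -/
def linForm (k : ι → ℂ) (w : EuclideanSpace ℂ ι) : ℂ := ∑ l, k l * w l

/-- The vector representing the real linear form `w ↦ Re (c̄ ∑ k_l w_l)`. -/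
def dualVec (k : ι → ℂ) (c : ℂ) : EuclideanSpace ℂ ι := WithLp.toLp 2 fun l => c * conj (k l)

theorem continuous_linForm (k : ι → ℂ) : Continuous (linForm k) := by
  unfold linForm
  fun_prop

theorem inner_dualVec (k : ι → ℂ) (c : ℂ) (w : EuclideanSpace ℂ ι) :
    ⟪dualVec k c, w⟫ = (conj c * linForm k w).re := by
  rw [real_inner_eq_re, linForm, Finset.mul_sum]
  congr 1
  refine Finset.sum_congr rfl fun l _ => ?_
  simp [dualVec]
  ring

theorem inner_dualVec_one (k : ι → ℂ) (w : EuclideanSpace ℂ ι) :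
    ⟪dualVec k 1, w⟫ = (linForm k w).re := by
  simp [inner_dualVec]

theorem inner_dualVec_I (k : ι → ℂ) (w : EuclideanSpace ℂ ι) :
    ⟪dualVec k Complex.I, w⟫ = (linForm k w).im := by
  simp [inner_dualVec]

theorem inner_dualVec_dualVec (k k' : ι → ℂ) (c c' : ℂ) :
    ⟪dualVec k c, dualVec k' c'⟫ = (conj c * c' * ∑ l, k l * conj (k' l)).re := by
  rw [inner_dualVec, linForm, mul_assoc, Finset.mul_sum _ _ c']
  congr 2
  refine Finset.sum_congr rfl fun l _ => ?_
  simp [dualVec]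
  ring

theorem norm_dualVec_sq (k : ι → ℂ) (c : ℂ) :
    ‖dualVec k c‖ ^ 2 = ‖c‖ ^ 2 * ∑ l, ‖k l‖ ^ 2 := by
  rw [EuclideanSpace.norm_sq_eq, Finset.mul_sum]
  refine Finset.sum_congr rfl fun l _ => ?_
  simp [dualVec, mul_pow]

theorem norm_linForm_pow_four_le (k : ι → ℂ) (w : EuclideanSpace ℂ ι) :
    ‖linForm k w‖ ^ 4 ≤ 2 * (⟪dualVec k 1, w⟫ ^ 4 + ⟪dualVec k Complex.I, w⟫ ^ 4) := by
  rw [inner_dualVec_one, inner_dualVec_I]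
  have h : ‖linForm k w‖ ^ 4 = ((linForm k w).re ^ 2 + (linForm k w).im ^ 2) ^ 2 := by
    rw [show ‖linForm k w‖ ^ 4 = (‖linForm k w‖ ^ 2) ^ 2 by ring, Complex.sq_norm,
      Complex.normSq_apply]
    ring
  rw [h]
  nlinarith [sq_nonneg ((linForm k w).re ^ 2 - (linForm k w).im ^ 2)]

theorem exists_lintegral_slab_mul_linForm_le : ∃ C : ℝ, 0 ≤ C ∧ ∀ {ι κ : Type} [Fintype ι]
    [Fintype κ] {e : κ → EuclideanSpace ℂ ι} (_ : Orthonormal ℝ e) {A : κ → Set ℝ}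
    (_ : ∀ i, MeasurableSet (A i)) (_ : ∀ i, A i ⊆ Set.Icc (-1) 1) (_ : Fintype.card κ ≤ 4)
    {ζ : ι → ℂ} (_ : ∑ l, ‖ζ l‖ ^ 2 ≤ 2),
    ∫⁻ w, slab e A w * ENNReal.ofReal (1 + ‖linForm ζ w‖ ^ 4) ∂(stdGaussian _) ≤
      ENNReal.ofReal C * ∏ i, volume (A i) := by
  set K : ℝ≥0∞ := 8 * ((4 : ℝ≥0∞) ^ 4 + fourthMoment) * 4
  have hK : K ≠ ∞ := by
    have := fourthMoment_ne_top
    finiteness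
  refine ⟨(1 + 2 * (K + K)).toReal, ENNReal.toReal_nonneg, ?_⟩
  intro ι κ _ _ e he A hA hA1 hc ζ hζ
  rw [ENNReal.ofReal_toReal (by finiteness)]
  have hsm := measurable_slab e hA
  have key : ∀ w, slab e A w * ENNReal.ofReal (1 + ‖linForm ζ w‖ ^ 4) ≤
      slab e A w + 2 * (slab e A w * ENNReal.ofReal (⟪dualVec ζ 1, w⟫ ^ 4) +
        slab e A w * ENNReal.ofReal (⟪dualVec ζ Complex.I, w⟫ ^ 4)) := by
    intro w
    rw [← mul_add, mul_left_comm, ← ENNReal.ofReal_add (by positivity) (by positivity)]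
    nth_rw 2 [← mul_one (slab e A w)]
    rw [← mul_add]
    refine mul_le_mul_right ?_ _
    rw [ENNReal.ofReal_add (by positivity) (by positivity), ENNReal.ofReal_one]
    refine add_le_add le_rfl ((ENNReal.ofReal_le_ofReal (norm_linForm_pow_four_le ζ w)).trans ?_)
    rw [ENNReal.ofReal_mul (by norm_num)]
    simp
  have h4 : ∀ c : ℂ, ‖c‖ = 1 → ∫⁻ w, slab e A w * ENNReal.ofReal (⟪dualVec ζ c, w⟫ ^ 4)
      ∂(stdGaussian _) ≤ K * ∏ i, volume (A i) := by
    intro c hc1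
    refine (lintegral_slab_mul_pow_le he hA hA1 (dualVec ζ c)).trans ?_
    refine mul_le_mul_left ?_ _
    refine mul_le_mul' (mul_le_mul_right (add_le_add (pow_le_pow_left' ?_ 4) le_rfl) _) ?_
    · exact_mod_cast hc
    · have h5 : ‖dualVec ζ c‖ ^ 4 ≤ 4 := by
        have h6 := norm_dualVec_sq ζ c
        rw [hc1, one_pow, one_mul] at h6
        have : ‖dualVec ζ c‖ ^ 4 = (‖dualVec ζ c‖ ^ 2) ^ 2 := by ring
        rw [this, h6]
        have h7 : 0 ≤ ∑ l, ‖ζ l‖ ^ 2 := Finset.sum_nonneg fun _ _ => by positivity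
        nlinarith
      exact (ENNReal.ofReal_le_ofReal h5).trans (by simp)
  refine (lintegral_mono key).trans ?_
  rw [lintegral_add_left hsm, lintegral_const_mul' _ _ (by norm_num),
    lintegral_add_left (by fun_prop)]
  refine (add_le_add (lintegral_slab_le he hA) (mul_le_mul_right
    (add_le_add (h4 1 (by simp)) (h4 Complex.I (by simp))) 2)).trans (le_of_eq ?_)
  ring

/-- The event that the value of a complex linear form is within `ε` of zero. -/
def smallSet (k : ι → ℂ) (ε : ℝ) : Set (EuclideanSpace ℂ ι) :=
  {w | |(linForm k w).re| ≤ ε ∧ |(linForm k w).im| ≤ ε}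

theorem measurableSet_smallSet (k : ι → ℂ) (ε : ℝ) : MeasurableSet (smallSet k ε) :=
  ((isClosed_le (Complex.continuous_re.comp (continuous_linForm k)).abs continuous_const).inter
    (isClosed_le (Complex.continuous_im.comp (continuous_linForm k)).abs
      continuous_const)).measurableSet

theorem setLIntegral_le_slab {κ : Type*} [Fintype κ] {e : κ → EuclideanSpace ℂ ι}
    {A : κ → Set ℝ} {S : Set (EuclideanSpace ℂ ι)} (hS : MeasurableSet S)
    (h : ∀ w ∈ S, ∀ i, ⟪e i, w⟫ ∈ A i) (f : EuclideanSpace ℂ ι → ℝ≥0∞)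
    (μ : Measure (EuclideanSpace ℂ ι)) :
    ∫⁻ w in S, f w ∂μ ≤ ∫⁻ w, slab e A w * f w ∂μ := by
  rw [← lintegral_indicator hS]
  refine lintegral_mono fun w => ?_
  by_cases hw : w ∈ S
  · rw [Set.indicator_of_mem hw, slab_eq_one (h w hw), one_mul]
  · simp [hw]

theorem orthonormal_dualVec {κ : Type*} {k : κ → ι → ℂ} [DecidableEq κ]
    (hk : ∀ i j, ∑ l, k i l * conj (k j l) = if i = j then 1 else 0) :
    Orthonormal ℝ fun p : κ × Fin 2 => dualVec (k p.1) (![1, Complex.I] p.2) := by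
  classical
  rw [orthonormal_iff_ite]
  rintro ⟨i, a⟩ ⟨j, b⟩
  rw [inner_dualVec_dualVec, hk]
  by_cases hij : i = j
  · fin_cases a <;> fin_cases b <;> simp [hij]
  · simp [hij]

/-- The real and imaginary parts of a unit complex form are orthonormal real coordinates, each
confined to a window of length `2ε`. -/
theorem exists_setLIntegral_smallSet_le : ∃ C : ℝ, 0 ≤ C ∧ ∀ {ι : Type} [Fintype ι]
    {k ζ : ι → ℂ} (_ : ∑ l, ‖k l‖ ^ 2 = 1) (_ : ∑ l, ‖ζ l‖ ^ 2 ≤ 2) {ε : ℝ} (_ : 0 ≤ ε)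
    (_ : ε ≤ 1), ∫⁻ w in smallSet k ε, ENNReal.ofReal (1 + ‖linForm ζ w‖ ^ 4) ∂(stdGaussian _) ≤
      ENNReal.ofReal (C * ε ^ 2) := by
  obtain ⟨C, hC0, hC⟩ := exists_lintegral_slab_mul_linForm_le
  refine ⟨C * 4, by positivity, ?_⟩
  intro ι _ k ζ hk hζ ε hε hε1
  have ho := orthonormal_dualVec (k := fun _ : Fin 1 => k) (by
    intro i j
    rw [if_pos (Subsingleton.elim i j)]
    simp_rw [Complex.mul_conj, Complex.normSq_eq_norm_sq]
    exact_mod_cast hk)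
  refine (setLIntegral_le_slab (A := fun _ : Fin 1 × Fin 2 => Set.Icc (-ε) ε)
    (measurableSet_smallSet k ε) ?_ _ _).trans
    ((hC ho (fun _ => measurableSet_Icc) (fun _ => Set.Icc_subset_Icc (by linarith) hε1)
      (by simp) hζ).trans ?_)
  · rintro w hw ⟨i, a⟩
    fin_cases a
    · simpa [inner_dualVec_one, ← abs_le] using hw.1
    · simpa [inner_dualVec_I, ← abs_le] using hw.2
  · rw [Finset.prod_const, Real.volume_Icc, ← ENNReal.ofReal_pow (by linarith),
      ← ENNReal.ofReal_mul hC0]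
    refine ENNReal.ofReal_le_ofReal (le_of_eq ?_)
    simp
    ring

/-- After Gram-Schmidt, the second form constrains an independent unit form to a window wider by a
factor of order `1/δ`. Each form has two real components, whence `ε² (ε/δ)²`. -/
theorem exists_setLIntegral_smallSet_inter_le : ∃ C : ℝ, 0 ≤ C ∧ ∀ {ι : Type} [Fintype ι]
    {k k' ζ : ι → ℂ} (_ : ∑ l, ‖k l‖ ^ 2 = 1) (_ : ∑ l, ‖k' l‖ ^ 2 = 1)
    {r δ : ℝ} (_ : ∑ l, k' l * conj (k l) = r) (_ : 0 < δ) (_ : |r| ≤ 1) (_ : δ ^ 2 / 5 ≤ 1 - r ^ 2)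
    (_ : ∑ l, ‖ζ l‖ ^ 2 ≤ 2) {ε : ℝ} (_ : 0 ≤ ε) (_ : ε ≤ 1) (_ : 5 * ε ≤ δ),
    ∫⁻ w in smallSet k ε ∩ smallSet k' ε, ENNReal.ofReal (1 + ‖linForm ζ w‖ ^ 4)
      ∂(stdGaussian _) ≤ ENNReal.ofReal (C * (ε ^ 4 / δ ^ 2)) := by
  obtain ⟨C, hC0, hC⟩ := exists_lintegral_slab_mul_linForm_le
  refine ⟨C * 400, by positivity, ?_⟩
  intro ι _ k k' ζ hk hk' r δ hr hδ hr1 hrδ hζ ε hε hε1 hεδ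
  set s : ℝ := √(1 - r ^ 2) with hs
  have hs2 : s ^ 2 = 1 - r ^ 2 := Real.sq_sqrt (le_trans (by positivity) hrδ)
  have hs0 : 0 < s := Real.sqrt_pos.2 (lt_of_lt_of_le (by positivity) hrδ)
  have hsδ : 2 * δ ≤ 5 * s := by
    refine le_of_sq_le_sq ?_ (by positivity)
    rw [mul_pow, mul_pow, hs2]
    nlinarith
  -- The normalised component of `k'` orthogonal to `k`.
  set kV : ι → ℂ := fun l => (k' l - r * k l) / s with hkV
  have hsC : (s : ℂ) ≠ 0 := by exact_mod_cast hs0.ne'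
  have hs2C : (s : ℂ) ^ 2 = 1 - (r : ℂ) ^ 2 := by exact_mod_cast hs2
  have g00 : ∑ l, k l * conj (k l) = 1 := by
    simp_rw [Complex.mul_conj, Complex.normSq_eq_norm_sq]
    exact_mod_cast hk
  have g11 : ∑ l, k' l * conj (k' l) = 1 := by
    simp_rw [Complex.mul_conj, Complex.normSq_eq_norm_sq]
    exact_mod_cast hk'
  have g01 : ∑ l, k l * conj (k' l) = r := by
    have := congrArg conj hr
    rw [map_sum, Complex.conj_ofReal] at this
    rw [← this]
    refine Finset.sum_congr rfl fun l _ => ?_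
    simp [mul_comm]
  have gV0 : ∑ l, kV l * conj (k l) = 0 := by
    have : ∀ l, kV l * conj (k l) = (k' l * conj (k l) - r * (k l * conj (k l))) / s := by
      intro l
      rw [hkV]
      ring
    simp_rw [this]
    rw [← Finset.sum_div, Finset.sum_sub_distrib, ← Finset.mul_sum, hr, g00]
    simp
  have g0V : ∑ l, k l * conj (kV l) = 0 := by
    have := congrArg conj gV0
    rw [map_sum, map_zero] at this
    rw [← this]
    refine Finset.sum_congr rfl fun l _ => ?_
    simp [mul_comm]
  have gVV : ∑ l, kV l * conj (kV l) = 1 := by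
    have : ∀ l, kV l * conj (kV l) = (k' l * conj (k' l) - r * (k' l * conj (k l)) -
        r * (k l * conj (k' l)) + r ^ 2 * (k l * conj (k l))) / s ^ 2 := by
      intro l
      rw [hkV]
      simp only [map_div₀, map_sub, map_mul, Complex.conj_ofReal]
      field_simp
      ring
    simp_rw [this]
    rw [← Finset.sum_div, Finset.sum_add_distrib, Finset.sum_sub_distrib,
      Finset.sum_sub_distrib, ← Finset.mul_sum, ← Finset.mul_sum, ← Finset.mul_sum, hr, g00, g01,
      g11, div_eq_one_iff_eq (pow_ne_zero 2 hsC), hs2C]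
    ring
  have ho := orthonormal_dualVec (k := ![k, kV]) (by
    intro i j
    fin_cases i <;> fin_cases j <;> simp [g00, g0V, gV0, gVV])
  -- On the event the second form is at most `2ε/s` in each component, and `2δ ≤ 5s` follows from
  -- `s² ≥ δ²/5`. The hypothesis `5ε ≤ δ` keeps this window inside `[-1, 1]`.
  set R : Fin 2 → ℝ := ![ε, 5 * ε / δ] with hR
  have hR1 : ∀ i, R i ≤ 1 := by
    intro i
    fin_cases i
    · simpa [hR] using hε1
    · simpa [hR] using div_le_one_of_le₀ hεδ hδ.le
  have hlin : ∀ w, linForm kV w = (linForm k' w - r * linForm k w) / s := by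
    intro w
    simp only [linForm, hkV, Finset.mul_sum]
    rw [← Finset.sum_sub_distrib, Finset.sum_div]
    refine Finset.sum_congr rfl fun l _ => ?_
    ring
  have hbd : ∀ a b : ℝ, |a| ≤ ε → |b| ≤ ε → |(b - r * a) / s| ≤ 5 * ε / δ := by
    intro a b ha hb
    rw [abs_div, abs_of_pos hs0, div_le_div_iff₀ hs0 hδ]
    have h1 : |b - r * a| ≤ 2 * ε := by
      refine (abs_sub _ _).trans ?_
      rw [abs_mul]
      nlinarith [abs_nonneg a, abs_nonneg r]
    nlinarith [abs_nonneg (b - r * a)]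
  refine (setLIntegral_le_slab (A := fun p : Fin 2 × Fin 2 => Set.Icc (-R p.1) (R p.1))
    ((measurableSet_smallSet k ε).inter (measurableSet_smallSet k' ε)) ?_ _ _).trans
    ((hC ho (fun _ => measurableSet_Icc) (fun p => Set.Icc_subset_Icc
      (by linarith [hR1 p.1]) (hR1 p.1)) (by simp) hζ).trans ?_)
  · rintro w ⟨hw, hw'⟩ ⟨i, a⟩
    rw [Set.mem_Icc, ← abs_le]
    fin_cases i <;> fin_cases a
    · simpa [inner_dualVec_one, hR] using hw.1
    · simpa [inner_dualVec_I, hR] using hw.2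
    · have := hbd _ _ hw.1 hw'.1
      simpa [inner_dualVec_one, hR, hlin] using this
    · have := hbd _ _ hw.2 hw'.2
      simpa [inner_dualVec_I, hR, hlin] using this
  · simp only [Fintype.prod_prod_type, Real.volume_Icc, Fin.prod_univ_two]
    have hRn : ∀ i, 0 ≤ R i - -R i := by
      intro i
      fin_cases i
      · simpa [hR] using hε
      · simp only [hR]
        have : 0 ≤ 5 * ε / δ := by positivity
        simpa using this
    rw [← ENNReal.ofReal_mul (hRn 0), ← ENNReal.ofReal_mul (hRn 1),
      ← ENNReal.ofReal_mul (mul_nonneg (hRn 0) (hRn 0)), ← ENNReal.ofReal_mul hC0]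
    refine ENNReal.ofReal_le_ofReal (le_of_eq ?_)
    simp only [hR, Matrix.cons_val_zero, Matrix.cons_val_one]
    field_simp
    ring

end LinForm

/-! ### Taylor expansion and decorrelation at two nearby points -/

section TwoPoint

open scoped RealInnerProductSpace

/-- The coefficients of a component of the jet, as a function on the frequencies. -/
def jetRow (n : ℕ) (x : Torus) (a : Fin 3) (l : freq n) : ℂ := jetAt n x a l

theorem jet_eq_linForm (n : ℕ) (x : Torus) (w : CoeffSpace n) (a : Fin 3) :
    jet n x w a = linForm (jetRow n x a) w := rfl

theorem sum_norm_sq_le_of_norm_le {n : ℕ} (hn : n ∈ sumTwoSq) {k : freq n → ℂ} {B : ℝ}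
    (h : ∀ l, ‖k l‖ ≤ √B / √(numFreq n)) (hB : 0 ≤ B) : ∑ l, ‖k l‖ ^ 2 ≤ B := by
  have hN : (0 : ℝ) < numFreq n := by exact_mod_cast numFreq_pos hn
  have h1 : ∀ l, ‖k l‖ ^ 2 ≤ B / numFreq n := by
    intro l
    refine (pow_le_pow_left₀ (norm_nonneg _) (h l) 2).trans (le_of_eq ?_)
    rw [div_pow, Real.sq_sqrt hB, Real.sq_sqrt hN.le]
  refine (Finset.sum_le_sum fun l _ => h1 l).trans (le_of_eq ?_)
  rw [Finset.sum_const, Finset.card_univ, Fintype.card_coe, ← numFreq, nsmul_eq_mul]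
  field_simp

theorem norm_jetRow_le {n : ℕ} (x : Torus) (a : Fin 3) (l : freq n) :
    ‖jetRow n x a l‖ ≤ √2 / √(numFreq n) := by
  rw [jetRow, jetAt, norm_div, norm_mul, norm_mFourier_apply, mul_one, Complex.norm_real,
    Real.norm_of_nonneg (Real.sqrt_nonneg _)]
  gcongr
  exact norm_jetCoeff_le a l.2

theorem sum_norm_jetRow_zero_sq {n : ℕ} (hn : n ∈ sumTwoSq) (x : Torus) :
    ∑ l : freq n, ‖jetRow n x 0 l‖ ^ 2 = 1 := by
  have hN : (numFreq n : ℝ) ≠ 0 := by exact_mod_cast (numFreq_pos hn).ne'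
  have h1 : ∀ l : freq n, ‖jetRow n x 0 l‖ ^ 2 = 1 / numFreq n := by
    intro l
    rw [jetRow, jetAt, norm_div, norm_mul, norm_mFourier_apply, mul_one, Complex.norm_real,
      Real.norm_of_nonneg (Real.sqrt_nonneg _), div_pow, Real.sq_sqrt (Nat.cast_nonneg _)]
    simp [jetCoeff]
  simp_rw [h1]
  rw [Finset.sum_const, Finset.card_univ, Fintype.card_coe, ← numFreq, nsmul_eq_mul]
  field_simp

/-- The squared distance at the natural scale of the wave. -/
def scaledSq (n : ℕ) (d : Fin 2 → ℝ) : ℝ := 2 * Real.pi ^ 2 * n * (d 0 ^ 2 + d 1 ^ 2)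

theorem phase_sq_le {n : ℕ} {l : Fin 2 → ℤ} (hl : l ∈ freq n) (d : Fin 2 → ℝ) :
    phase l d ^ 2 ≤ 2 * scaledSq n d := by
  rw [mem_freq] at hl
  have h : (l 0 : ℝ) ^ 2 + (l 1 : ℝ) ^ 2 = n := by exact_mod_cast hl
  rw [phase, scaledSq, ← h]
  nlinarith [mul_nonneg (sq_nonneg Real.pi) (sq_nonneg ((l 0 : ℝ) * d 1 - l 1 * d 0))]

theorem sum_phase_sq (n : ℕ) (d : Fin 2 → ℝ) :
    ∑ l ∈ freq n, phase l d ^ 2 = numFreq n * scaledSq n d := by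
  have h : ∀ l : Fin 2 → ℤ, phase l d ^ 2 = 4 * Real.pi ^ 2 * d 0 ^ 2 * (l 0 : ℝ) ^ 2 +
      4 * Real.pi ^ 2 * d 1 ^ 2 * (l 1 : ℝ) ^ 2 +
      8 * Real.pi ^ 2 * d 0 * d 1 * ((l 0 : ℝ) * l 1) := by
    intro l
    rw [phase]
    ring
  simp_rw [h]
  rw [Finset.sum_add_distrib, Finset.sum_add_distrib, ← Finset.mul_sum, ← Finset.mul_sum,
    ← Finset.mul_sum, sum_freq_sq, sum_freq_sq, sum_freq_mul, scaledSq]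
  ring

theorem crossCov_zero_zero_eq (n : ℕ) (x : Torus) : crossCov n 0 0 x = (covFun n x : ℂ) := by
  have h1 : conj (∑ l ∈ freq n, UnitAddTorus.mFourier l x) =
      ∑ l ∈ freq n, UnitAddTorus.mFourier l x := by
    rw [map_sum, ← sum_freq_neg n]
    refine Finset.sum_congr rfl fun l _ => ?_
    rw [UnitAddTorus.mFourier_neg, Complex.conj_conj]
  rw [crossCov, covFun, ← Complex.re_sum]
  push_cast
  congr 1
  rw [Complex.conj_eq_iff_re.1 h1]
  refine Finset.sum_congr rfl fun l _ => ?_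
  simp [jetCoeff]

theorem covFun_tmk (n : ℕ) (d : Fin 2 → ℝ) :
    covFun n (tmk d) = (1 / (numFreq n : ℝ)) * ∑ l ∈ freq n, Real.cos (phase l d) := by
  rw [covFun]
  congr 1
  refine Finset.sum_congr rfl fun l _ => ?_
  rw [mFourier_tmk, Complex.exp_ofReal_mul_I_re]

/-- For phases at most 1, `cos θ ≤ 1 - (2/π²) θ² ≤ 1 - θ²/5`, and the average of `θ²` over `Λ_n` is
exactly `scaledSq`. Nonnegativity of the covariance then transfers the gap to its square. -/
theorem one_sub_covFun_sq_ge {n : ℕ} (hn : n ∈ sumTwoSq) {d : Fin 2 → ℝ}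
    (hd : scaledSq n d ≤ 1 / 4) :
    |covFun n (tmk d)| ≤ 1 ∧ scaledSq n d / 5 ≤ 1 - covFun n (tmk d) ^ 2 := by
  have hN : (0 : ℝ) < numFreq n := by exact_mod_cast numFreq_pos hn
  have hθ : ∀ l ∈ freq n, |phase l d| ≤ 1 := fun l hl =>
    abs_le_one_iff_mul_self_le_one.2 (by nlinarith [phase_sq_le hl d])
  have hpi := Real.pi_gt_three
  have hpi2 : Real.pi ^ 2 ≤ 10 := by nlinarith [Real.pi_lt_d2]
  have h0 : 0 ≤ covFun n (tmk d) := by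
    rw [covFun_tmk]
    refine mul_nonneg (by positivity) (Finset.sum_nonneg fun l hl => ?_)
    have := abs_le.1 (hθ l hl)
    exact Real.cos_nonneg_of_mem_Icc ⟨by linarith, by linarith⟩
  have h1 : covFun n (tmk d) ≤ 1 - scaledSq n d / 5 := by
    rw [covFun_tmk, one_div, inv_mul_le_iff₀ hN]
    have h2 : ∀ l ∈ freq n, Real.cos (phase l d) ≤ 1 - 1 / 5 * phase l d ^ 2 := by
      intro l hl
      refine (Real.cos_le_one_sub_mul_cos_sq ((hθ l hl).trans (by linarith))).trans ?_
      have : 1 / 5 ≤ 2 / Real.pi ^ 2 := by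
        rw [div_le_div_iff₀ (by norm_num) (by positivity)]
        linarith
      nlinarith [sq_nonneg (phase l d)]
    refine (Finset.sum_le_sum h2).trans (le_of_eq ?_)
    rw [Finset.sum_sub_distrib, ← Finset.mul_sum, sum_phase_sq]
    rw [Finset.sum_const, ← numFreq, nsmul_eq_mul]
    ring
  have h3 : 0 ≤ scaledSq n d := by unfold scaledSq; positivity
  exact ⟨abs_le.2 ⟨by linarith, by linarith⟩, by nlinarith⟩

/-- A first order Taylor expansion bounds the Jacobian at a point where the wave is small, if the
wave is also small at a nearby point. -/
theorem exists_abs_im_jet_le {n : ℕ} (hn : n ∈ sumTwoSq) {x y : Fin 2 → ℝ}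
    {δ : ℝ} (hδ0 : 0 < δ) (hδ : δ ^ 2 = scaledSq n (y - x)) (hδ1 : δ ^ 2 ≤ 1 / 4) :
    ∃ ζ ζ' : freq n → ℂ, ∑ l, ‖ζ l‖ ^ 2 ≤ 2 ∧ ∑ l, ‖ζ' l‖ ^ 2 ≤ 2 ∧
      ∀ ε : ℝ, 0 ≤ ε → ∀ w ∈ smallSet (jetRow n (tmk x) 0) ε ∩ smallSet (jetRow n (tmk y) 0) ε,
        |(conj (jet n (tmk x) w 1) * jet n (tmk x) w 2).im| ≤
          (3 * ε / δ + 2 * δ) * ((1 + ‖linForm ζ w‖) * ‖linForm ζ' w‖) := by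
  have hN : (0 : ℝ) < numFreq n := by exact_mod_cast numFreq_pos hn
  have hsN : (0 : ℝ) < √(numFreq n) := Real.sqrt_pos.2 hN
  set d : Fin 2 → ℝ := y - x with hd
  set D : ℝ := √(d 0 ^ 2 + d 1 ^ 2) with hD
  have hD2 : D ^ 2 = d 0 ^ 2 + d 1 ^ 2 := Real.sq_sqrt (by positivity)
  have hn0 : 0 < (n : ℝ) := by
    rcases (Nat.cast_nonneg n : (0 : ℝ) ≤ n).eq_or_lt with h | h
    · rw [scaledSq, ← h] at hδ
      nlinarith
    · exact h
  have hD0 : 0 < D := by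
    rcases (Real.sqrt_nonneg (d 0 ^ 2 + d 1 ^ 2)).eq_or_lt with h | h
    · rw [scaledSq, ← hD2, hD, ← h] at hδ
      nlinarith
    · exact h
  have hδD : δ = Real.pi * √2 * √n * D := by
    refine (sq_eq_sq₀ hδ0.le (by positivity)).1 ?_
    rw [hδ, scaledSq, mul_pow, mul_pow, mul_pow, Real.sq_sqrt (by norm_num),
      Real.sq_sqrt hn0.le, hD2]
    ring
  set c : ℝ := d 0 / D with hc
  set s : ℝ := d 1 / D with hs
  have hcs : c ^ 2 + s ^ 2 = 1 := by
    rw [hc, hs, div_pow, div_pow, ← add_div, ← hD2]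
    field_simp
  -- The second-order Taylor remainder of the wave between `x` and `y`, divided by `2δ²`; it is
  -- bounded since each squared phase is at most `2δ²`.
  set ζ : freq n → ℂ := fun l => UnitAddTorus.mFourier l (tmk x) *
    (Complex.exp (phase l d * Complex.I) - 1 - phase l d * Complex.I) / (√(numFreq n) * (2 * δ ^ 2))
    with hζ
  -- The normalised derivative at `x` transverse to `y - x`.
  set ζ' : freq n → ℂ := fun l => -s * jetRow n (tmk x) 1 l + c * jetRow n (tmk x) 2 l with hζ'
  refine ⟨ζ, ζ', ?_, ?_, ?_⟩
  · refine sum_norm_sq_le_of_norm_le hn (fun l => ?_) (by norm_num)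
    have h1 := phase_sq_le l.2 d
    rw [← hδ] at h1
    have h2 : ‖(phase l d : ℂ) * Complex.I‖ = |phase l d| := by simp
    have h3 : ‖Complex.exp (phase l d * Complex.I) - 1 - phase l d * Complex.I‖ ≤
        phase l d ^ 2 := by
      have h4 : ‖(phase l d : ℂ) * Complex.I‖ ≤ 1 := by
        rw [h2]
        exact abs_le_one_iff_mul_self_le_one.2 (by nlinarith)
      refine (Complex.norm_exp_sub_one_sub_id_le h4).trans (le_of_eq ?_)
      rw [h2, sq_abs]
    rw [hζ]
    simp only
    rw [norm_div, norm_mul, norm_mFourier_apply, one_mul, norm_mul, Complex.norm_real,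
      Real.norm_of_nonneg hsN.le, norm_mul, norm_pow, Complex.norm_real, Real.norm_of_nonneg hδ0.le,
      Complex.norm_ofNat, mul_comm (√_), ← div_div]
    gcongr
    refine div_le_of_le_mul₀ (by positivity) (Real.sqrt_nonneg _) (h3.trans ?_)
    have h5 : (1 : ℝ) ≤ √2 := Real.one_le_sqrt.2 (by norm_num)
    nlinarith [sq_nonneg δ]
  · refine sum_norm_sq_le_of_norm_le hn (fun l => ?_) (by norm_num)
    have hl := l.2
    rw [mem_freq] at hl
    have h : ((l : Fin 2 → ℤ) 0 : ℝ) ^ 2 + ((l : Fin 2 → ℤ) 1 : ℝ) ^ 2 = n := by exact_mod_cast hl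
    have h1 : ζ' l = Complex.I * ((√2 * (-s * (l : Fin 2 → ℤ) 0 + c * (l : Fin 2 → ℤ) 1) / √n : ℝ) : ℂ)
        * UnitAddTorus.mFourier l (tmk x) / √(numFreq n) := by
      simp only [hζ', jetRow, jetAt, jetCoeff, Matrix.cons_val_one, Matrix.cons_val]
      push_cast
      ring
    rw [h1, norm_div, norm_mul, norm_mFourier_apply, mul_one, norm_mul, Complex.norm_I, one_mul,
      Complex.norm_real, Complex.norm_real, Real.norm_of_nonneg hsN.le]
    gcongr
    have h2 : |-s * (l : Fin 2 → ℤ) 0 + c * (l : Fin 2 → ℤ) 1| ≤ √n := by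
      refine Real.abs_le_sqrt ?_
      rw [← h]
      nlinarith [sq_nonneg (c * ((l : Fin 2 → ℤ) 0 : ℝ) + s * (l : Fin 2 → ℤ) 1)]
    rw [Real.norm_eq_abs, abs_div, abs_mul, abs_of_nonneg (Real.sqrt_nonneg _),
      abs_of_nonneg (Real.sqrt_nonneg _)]
    exact div_le_of_le_mul₀ (Real.sqrt_nonneg _) (Real.sqrt_nonneg _)
      (mul_le_mul_of_nonneg_left h2 (Real.sqrt_nonneg _))
  · intro ε hε w hw
    set z := jet n (tmk x) w with hz
    -- The Jacobian is unchanged by rotating the gradient to the directions along and across `y -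
    -- x`.
    have h1 : (conj (z 1) * z 2).im =
        (conj (c * z 1 + s * z 2) * (-s * z 1 + c * z 2)).im := by
      simp only [map_add, map_mul, Complex.conj_ofReal, Complex.mul_im, Complex.mul_re,
        Complex.add_im, Complex.add_re, Complex.neg_re, Complex.neg_im, Complex.ofReal_re,
        Complex.ofReal_im, Complex.conj_re, Complex.conj_im]
      linear_combination -((z 1).re * (z 2).im - (z 1).im * (z 2).re) * hcs
    have h2 : linForm ζ' w = -s * z 1 + c * z 2 := by
      simp only [hz, jet_eq_linForm, linForm, hζ', Finset.mul_sum]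
      rw [← Finset.sum_add_distrib]
      refine Finset.sum_congr rfl fun l _ => ?_
      ring
    -- Taylor's formula: the longitudinal derivative is the difference of two small values minus the
    -- remainder, so it is `O(ε/δ + δ)`.
    have h3 : (δ : ℂ) * (c * z 1 + s * z 2) =
        linForm (jetRow n (tmk y) 0) w - linForm (jetRow n (tmk x) 0) w -
          2 * δ ^ 2 * linForm ζ w := by
      simp only [hz, jet_eq_linForm, linForm, hζ, Finset.mul_sum]
      rw [← Finset.sum_add_distrib, ← Finset.sum_sub_distrib, ← Finset.sum_sub_distrib,
        Finset.mul_sum]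
      refine Finset.sum_congr rfl fun l _ => ?_
      have h4 : UnitAddTorus.mFourier (l : Fin 2 → ℤ) (tmk y) =
          UnitAddTorus.mFourier l (tmk x) * Complex.exp (phase l d * Complex.I) := by
        rw [← mFourier_tmk, ← mFourier_add_point, ← tmk_add, hd, add_sub_cancel]
      have h5 : (phase l d : ℂ) = δ * √2 * (c * (l : Fin 2 → ℤ) 0 + s * (l : Fin 2 → ℤ) 1) / √n := by
        have : phase l d = δ * √2 * (c * (l : Fin 2 → ℤ) 0 + s * (l : Fin 2 → ℤ) 1) / √n := by
          have h6 : √(2 : ℝ) ^ 2 = 2 := Real.sq_sqrt (by norm_num)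
          rw [hδD, hc, hs, phase]
          field_simp
          rw [h6]
          ring
        rw [this]
        push_cast
        rfl
      have hδC : (δ : ℂ) ≠ 0 := by exact_mod_cast hδ0.ne'
      have hNC : (√(numFreq n) : ℂ) ≠ 0 := by exact_mod_cast hsN.ne'
      simp only [jetRow, jetAt, jetCoeff, Matrix.cons_val_zero, Matrix.cons_val_one, Matrix.cons_val, h4]
      generalize Complex.exp (phase l d * Complex.I) = X
      rw [h5]
      push_cast
      field_simp
      ring
    have hsm : ∀ (k : freq n → ℂ), w ∈ smallSet k ε → ‖linForm k w‖ ≤ 3 / 2 * ε := by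
      intro k hk
      refine le_of_sq_le_sq ?_ (by positivity)
      rw [Complex.sq_norm, Complex.normSq_apply]
      have h6 := sq_le_sq' (abs_le.1 hk.1).1 (abs_le.1 hk.1).2
      have h7 := sq_le_sq' (abs_le.1 hk.2).1 (abs_le.1 hk.2).2
      nlinarith [sq_nonneg ε]
    have h8 : ‖(c * z 1 + s * z 2 : ℂ)‖ ≤ (3 * ε / δ + 2 * δ) * (1 + ‖linForm ζ w‖) := by
      have h9 : δ * ‖(c * z 1 + s * z 2 : ℂ)‖ ≤ 3 * ε + 2 * δ ^ 2 * ‖linForm ζ w‖ := by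
        have h10 := congrArg norm h3
        rw [norm_mul, Complex.norm_real, Real.norm_of_nonneg hδ0.le] at h10
        rw [h10]
        refine (norm_sub_le _ _).trans (add_le_add ((norm_sub_le _ _).trans ?_) (le_of_eq ?_))
        · linarith [hsm _ hw.1, hsm _ hw.2]
        · simp
      have h11 : δ * ((3 * ε / δ + 2 * δ) * (1 + ‖linForm ζ w‖)) =
          (3 * ε + 2 * δ ^ 2) * (1 + ‖linForm ζ w‖) := by
        field_simp
      refine le_of_mul_le_mul_left ?_ hδ0
      rw [h11]
      nlinarith [norm_nonneg (linForm ζ w), sq_nonneg δ, mul_nonneg hε (norm_nonneg (linForm ζ w))]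
    rw [h1, ← mul_assoc]
    refine (abs_im_conj_mul_le _ _).trans ?_
    rw [← h2]
    exact mul_le_mul_of_nonneg_right h8 (norm_nonneg _)

end TwoPoint

/-! ### The two-point estimate for the approximate zero density -/

section TwoPointIntegral

theorem mul_mul_mul_le_pow_four (a b c d : ℝ) :
    a * b * (c * d) ≤ (a ^ 4 + b ^ 4 + c ^ 4 + d ^ 4) / 4 := by
  nlinarith [sq_nonneg (a * b - c * d), sq_nonneg (a ^ 2 - b ^ 2), sq_nonneg (c ^ 2 - d ^ 2)]

theorem zeroKernel_jet (n : ℕ) (ε : ℝ) (x : Torus) (w : CoeffSpace n) :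
    zeroKernel ε (jet n x w) = (smallSet (jetRow n x 0) ε).indicator
      (fun w => ((2 * ε) ^ 2)⁻¹ * |(conj (jet n x w 1) * jet n x w 2).im|) w := by
  classical
  rw [zeroKernel, Set.indicator_apply]
  exact if_congr Iff.rfl rfl rfl

theorem scaledSq_neg (n : ℕ) (d : Fin 2 → ℝ) : scaledSq n (-d) = scaledSq n d := by
  simp [scaledSq]

theorem sum_norm_jetRow_sq_le {n : ℕ} (hn : n ∈ sumTwoSq) (x : Torus) (a : Fin 3) :
    ∑ l, ‖jetRow n x a l‖ ^ 2 ≤ 2 :=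
  sum_norm_sq_le_of_norm_le hn (norm_jetRow_le x a) (by norm_num)

theorem mul_le_sum_pow_four_of_near {T g X Y a b c d : ℝ} (hT : 0 ≤ T) (hY0 : 0 ≤ Y)
    (ha : 0 ≤ a) (hb : 0 ≤ b) (hX : X ≤ T * ((1 + a) * b)) (hY : Y ≤ T * ((1 + c) * d)) :
    g * X * (g * Y) ≤
      (g * T) ^ 2 * 2 * (1 + a ^ 4 + (1 + b ^ 4) + (1 + c ^ 4) + (1 + d ^ 4)) := by
  have e3 := mul_mul_mul_le_pow_four (1 + a) b (1 + c) d
  have e4 := add_pow_four_le 1 a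
  have e5 := add_pow_four_le 1 c
  have e6 : (1 + a) * b * ((1 + c) * d) ≤
      2 * (1 + a ^ 4 + (1 + b ^ 4) + (1 + c ^ 4) + (1 + d ^ 4)) := by
    have p1 : 0 ≤ b ^ 4 := by positivity
    have p2 : 0 ≤ d ^ 4 := by positivity
    linarith
  have e7 : X * Y ≤ T * ((1 + a) * b) * (T * ((1 + c) * d)) :=
    mul_le_mul hX hY hY0 (by positivity)
  calc g * X * (g * Y) = g ^ 2 * (X * Y) := by ring
    _ ≤ g ^ 2 * (T * ((1 + a) * b) * (T * ((1 + c) * d))) := by gcongr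
    _ = (g * T) ^ 2 * ((1 + a) * b * ((1 + c) * d)) := by ring
    _ ≤ (g * T) ^ 2 * (2 * (1 + a ^ 4 + (1 + b ^ 4) + (1 + c ^ 4) + (1 + d ^ 4))) := by gcongr
    _ = _ := by ring

theorem mul_le_sum_pow_four_of_far {g X Y a b c d : ℝ} (hY0 : 0 ≤ Y) (hg : 0 ≤ g)
    (ha : 0 ≤ a) (hb : 0 ≤ b) (hX : X ≤ g * (a * b)) (hY : Y ≤ g * (c * d)) :
    X * Y ≤ g ^ 2 / 4 * (1 + a ^ 4 + (1 + b ^ 4) + (1 + c ^ 4) + (1 + d ^ 4)) := by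
  have e3 := mul_mul_mul_le_pow_four a b c d
  calc X * Y ≤ g * (a * b) * (g * (c * d)) := mul_le_mul hX hY hY0 (by positivity)
    _ = g ^ 2 * (a * b * (c * d)) := by ring
    _ ≤ g ^ 2 * ((1 + a ^ 4 + (1 + b ^ 4) + (1 + c ^ 4) + (1 + d ^ 4)) / 4) := by
      gcongr
      linarith
    _ = _ := by ring

theorem lintegral_le_of_le_sum_pow_four {ι : Type} [Fintype ι] {S : Set (EuclideanSpace ℂ ι)}
    (hS : MeasurableSet S) {f : EuclideanSpace ℂ ι → ℝ} {B K : ℝ} (hB : 0 ≤ B)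
    {k₁ k₂ k₃ k₄ : ι → ℂ} (hf0 : ∀ w ∉ S, f w = 0)
    (hf : ∀ w ∈ S, f w ≤ B * (1 + ‖linForm k₁ w‖ ^ 4 + (1 + ‖linForm k₂ w‖ ^ 4) +
      (1 + ‖linForm k₃ w‖ ^ 4) + (1 + ‖linForm k₄ w‖ ^ 4)))
    (hk : ∀ k : ι → ℂ, ∑ l, ‖k l‖ ^ 2 ≤ 2 →
      ∫⁻ w in S, ENNReal.ofReal (1 + ‖linForm k w‖ ^ 4) ∂(stdGaussian _) ≤ ENNReal.ofReal K)
    (h₁ : ∑ l, ‖k₁ l‖ ^ 2 ≤ 2) (h₂ : ∑ l, ‖k₂ l‖ ^ 2 ≤ 2) (h₃ : ∑ l, ‖k₃ l‖ ^ 2 ≤ 2)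
    (h₄ : ∑ l, ‖k₄ l‖ ^ 2 ≤ 2) :
    ∫⁻ w, ENNReal.ofReal (f w) ∂(stdGaussian _) ≤ ENNReal.ofReal (B * (4 * K)) := by
  have hm : ∀ k : ι → ℂ, Measurable fun w => ENNReal.ofReal (1 + ‖linForm k w‖ ^ 4) := fun k => by
    have := (continuous_linForm k).measurable
    fun_prop
  have h1 : ∫⁻ w, ENNReal.ofReal (f w) ∂(stdGaussian _) ≤
      ∫⁻ w in S, ENNReal.ofReal B * (ENNReal.ofReal (1 + ‖linForm k₁ w‖ ^ 4) +
        ENNReal.ofReal (1 + ‖linForm k₂ w‖ ^ 4) + ENNReal.ofReal (1 + ‖linForm k₃ w‖ ^ 4) +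
        ENNReal.ofReal (1 + ‖linForm k₄ w‖ ^ 4)) ∂(stdGaussian _) := by
    rw [← lintegral_indicator hS]
    refine lintegral_mono fun w => ?_
    by_cases hw : w ∈ S
    · rw [Set.indicator_of_mem hw, ← ENNReal.ofReal_add (by positivity) (by positivity),
        ← ENNReal.ofReal_add (by positivity) (by positivity),
        ← ENNReal.ofReal_add (by positivity) (by positivity), ← ENNReal.ofReal_mul hB]
      exact ENNReal.ofReal_le_ofReal (hf w hw)
    · simp [hf0 w hw]
  refine h1.trans ?_
  rw [lintegral_const_mul' _ _ ENNReal.ofReal_ne_top, lintegral_add_right _ (hm _),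
    lintegral_add_right _ (hm _), lintegral_add_right _ (hm _), ENNReal.ofReal_mul hB]
  refine mul_le_mul_right ((add_le_add (add_le_add (add_le_add (hk _ h₁) (hk _ h₂)) (hk _ h₃))
    (hk _ h₄)).trans (le_of_eq ?_)) _
  rw [ENNReal.ofReal_mul (by norm_num)]
  simp only [ENNReal.ofReal_ofNat]
  ring

/-- Two normalisations `ε^(-2)`, two Jacobians of size `ε/δ + δ` and a probability `ε^4/δ²` multiply
to `(ε/δ² + 1)²` up to constants; for `5ε ≤ δ` this is comparable to `1 + ε²/(ε² + δ²)²`. -/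
theorem near_bound {ε δ C₁ C₂ : ℝ} (hε : 0 < ε) (hδ0 : 0 < δ) (hC₁0 : 0 ≤ C₁) (hC₂0 : 0 ≤ C₂)
    (hreg : 5 * ε ≤ δ) :
    (((2 * ε) ^ 2)⁻¹ * (3 * ε / δ + 2 * δ)) ^ 2 * 2 * (4 * (C₂ * (ε ^ 4 / δ ^ 2))) ≤
      (50 * C₁ + 40 * C₂) * (1 + ε ^ 2 / (ε ^ 2 + δ ^ 2) ^ 2) := by
  have e1 : (((2 * ε) ^ 2)⁻¹ * (3 * ε / δ + 2 * δ)) ^ 2 * 2 * (4 * (C₂ * (ε ^ 4 / δ ^ 2))) =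
      C₂ / 2 * (3 * ε / δ ^ 2 + 2) ^ 2 := by
    field_simp
    norm_num
  have e2 : ε ^ 2 / δ ^ 4 ≤ 2 * (ε ^ 2 / (ε ^ 2 + δ ^ 2) ^ 2) := by
    rw [← mul_div_assoc, div_le_div_iff₀ (by positivity) (by positivity)]
    have : 25 * ε ^ 2 ≤ δ ^ 2 := by nlinarith
    have h5 : (ε ^ 2 + δ ^ 2) ^ 2 ≤ 2 * δ ^ 4 := by nlinarith [sq_nonneg ε, sq_nonneg δ]
    nlinarith [sq_nonneg ε]
  have e3 : (3 * ε / δ ^ 2 + 2) ^ 2 ≤ 18 * (ε ^ 2 / δ ^ 4) + 8 := by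
    have : ε ^ 2 / δ ^ 4 = (ε / δ ^ 2) ^ 2 := by rw [div_pow]; ring
    rw [this, mul_div_assoc]
    nlinarith [sq_nonneg (3 * (ε / δ ^ 2) - 2)]
  rw [e1]
  have e4 : 0 ≤ ε ^ 2 / (ε ^ 2 + δ ^ 2) ^ 2 := by positivity
  have e5 : 0 ≤ C₁ * (ε ^ 2 / (ε ^ 2 + δ ^ 2) ^ 2) := by positivity
  have e6 : 0 ≤ C₂ * (ε ^ 2 / (ε ^ 2 + δ ^ 2) ^ 2) := by positivity
  have e7 : C₂ / 2 * (3 * ε / δ ^ 2 + 2) ^ 2 ≤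
      C₂ / 2 * (36 * (ε ^ 2 / (ε ^ 2 + δ ^ 2) ^ 2) + 8) := by gcongr; linarith
  nlinarith

/-- For `δ < 5ε` the trivial bound `ε^(-4) ε²` is enough, since `ε² + δ² ≤ 26 ε²`; the constant 676
is `26²`. -/
theorem far_bound {ε δ C₁ C₂ : ℝ} (hε : 0 < ε) (hδ0 : 0 < δ) (hC₁0 : 0 ≤ C₁) (hC₂0 : 0 ≤ C₂)
    (hreg : δ < 5 * ε) :
    (((2 * ε) ^ 2)⁻¹) ^ 2 / 4 * (4 * (C₁ * ε ^ 2)) ≤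
      (50 * C₁ + 40 * C₂) * (1 + ε ^ 2 / (ε ^ 2 + δ ^ 2) ^ 2) := by
  have e1 : (((2 * ε) ^ 2)⁻¹) ^ 2 / 4 * (4 * (C₁ * ε ^ 2)) = C₁ / 16 * (1 / ε ^ 2) := by
    field_simp
    ring
  have e2 : 1 / ε ^ 2 ≤ 676 * (ε ^ 2 / (ε ^ 2 + δ ^ 2) ^ 2) := by
    rw [← mul_div_assoc, div_le_div_iff₀ (by positivity) (by positivity)]
    have : δ ^ 2 ≤ 25 * ε ^ 2 := by nlinarith
    nlinarith [sq_nonneg ε, sq_nonneg δ]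
  rw [e1]
  have e4 : 0 ≤ ε ^ 2 / (ε ^ 2 + δ ^ 2) ^ 2 := by positivity
  have e5 : 0 ≤ C₁ * (ε ^ 2 / (ε ^ 2 + δ ^ 2) ^ 2) := by positivity
  have e6 : 0 ≤ C₂ * (ε ^ 2 / (ε ^ 2 + δ ^ 2) ^ 2) := by positivity
  have e7 : C₁ / 16 * (1 / ε ^ 2) ≤
      C₁ / 16 * (676 * (ε ^ 2 / (ε ^ 2 + δ ^ 2) ^ 2)) := by gcongr
  nlinarith

/-- If `5ε ≤ δ`, the values at both points constrain the wave and Taylor's formula is applied from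
each end. Otherwise the points are too close for the second constraint to help, and it is dropped.
The resulting majorant has an integral over `y` that stays bounded as `ε` tends to 0. -/
theorem exists_lintegral_zeroKernel_mul_le : ∃ C : ℝ, 0 ≤ C ∧ ∀ n ∈ sumTwoSq,
    ∀ x y : Fin 2 → ℝ, 0 < scaledSq n (y - x) → scaledSq n (y - x) ≤ 1 / 4 →
    ∀ ε : ℝ, 0 < ε → ε ≤ 1 →
    ∫⁻ w, ENNReal.ofReal (zeroKernel ε (jet n (tmk x) w) * zeroKernel ε (jet n (tmk y) w))
      ∂(stdGaussian (CoeffSpace n)) ≤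
        ENNReal.ofReal (C * (1 + ε ^ 2 / (ε ^ 2 + scaledSq n (y - x)) ^ 2)) := by
  obtain ⟨C₁, hC₁0, hC₁⟩ := exists_setLIntegral_smallSet_le
  obtain ⟨C₂, hC₂0, hC₂⟩ := exists_setLIntegral_smallSet_inter_le
  refine ⟨50 * C₁ + 40 * C₂, by positivity, ?_⟩
  intro n hn x y hp hq ε hε hε1
  set δ : ℝ := √(scaledSq n (y - x)) with hδ
  have hδ2 : δ ^ 2 = scaledSq n (y - x) := Real.sq_sqrt hp.le
  have hδ0 : 0 < δ := Real.sqrt_pos.2 hp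
  rw [← hδ2] at hq ⊢
  have hx1 := sum_norm_jetRow_zero_sq hn (tmk x)
  have hy1 := sum_norm_jetRow_zero_sq hn (tmk y)
  rcases le_or_gt (5 * ε) δ with hreg | hreg
  · obtain ⟨ζ₁, ζ₂, h₁, h₂, hb⟩ := exists_abs_im_jet_le hn hδ0 hδ2 hq
    obtain ⟨ζ₃, ζ₄, h₃, h₄, hb'⟩ := exists_abs_im_jet_le (x := y) (y := x) hn hδ0
      (by rw [← neg_sub, scaledSq_neg, hδ2]) hq
    obtain ⟨hr1, hrδ⟩ := one_sub_covFun_sq_ge hn (d := y - x) (by rw [← hδ2]; exact hq)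
    rw [← hδ2] at hrδ
    have hr : ∑ l, jetRow n (tmk y) 0 l * conj (jetRow n (tmk x) 0 l) =
        (covFun n (tmk (y - x)) : ℂ) := by
      rw [← crossCov_zero_zero_eq, tmk_sub, ← sum_jetAt_mul_conj]
      rfl
    refine (lintegral_le_of_le_sum_pow_four (S := smallSet (jetRow n (tmk x) 0) ε ∩
      smallSet (jetRow n (tmk y) 0) ε) (K := C₂ * (ε ^ 4 / δ ^ 2))
      (B := (((2 * ε) ^ 2)⁻¹ * (3 * ε / δ + 2 * δ)) ^ 2 * 2)
      ((measurableSet_smallSet _ _).inter (measurableSet_smallSet _ _)) (by positivity) ?_ ?_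
      (fun k hk => hC₂ hx1 hy1 hr hδ0 hr1 hrδ hk hε.le hε1 hreg) h₁ h₂ h₃ h₄).trans ?_
    · intro w hw
      rw [Set.mem_inter_iff, not_and_or] at hw
      rcases hw with hw | hw
      · rw [zeroKernel_jet, Set.indicator_of_notMem hw, zero_mul]
      · rw [zeroKernel_jet n ε (tmk y), Set.indicator_of_notMem hw, mul_zero]
    · intro w hw
      rw [zeroKernel_jet, zeroKernel_jet, Set.indicator_of_mem hw.1, Set.indicator_of_mem hw.2]
      exact mul_le_sum_pow_four_of_near (by positivity) (abs_nonneg _) (norm_nonneg _) (norm_nonneg _) (hb ε hε.le w hw) (hb' ε hε.le w hw.symm)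
    · exact ENNReal.ofReal_le_ofReal (near_bound hε hδ0 hC₁0 hC₂0 hreg)
  · refine (lintegral_le_of_le_sum_pow_four (S := smallSet (jetRow n (tmk x) 0) ε)
      (K := C₁ * ε ^ 2) (B := (((2 * ε) ^ 2)⁻¹) ^ 2 / 4)
      (measurableSet_smallSet _ _) (by positivity) ?_ ?_ (fun k hk => hC₁ hx1 hk hε.le hε1)
      (sum_norm_jetRow_sq_le hn (tmk x) 1) (sum_norm_jetRow_sq_le hn (tmk x) 2)
      (sum_norm_jetRow_sq_le hn (tmk y) 1) (sum_norm_jetRow_sq_le hn (tmk y) 2)).trans ?_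
    · intro w hw
      rw [zeroKernel_jet, Set.indicator_of_notMem hw, zero_mul]
    · intro w hw
      have hk : ∀ x : Torus, zeroKernel ε (jet n x w) ≤ ((2 * ε) ^ 2)⁻¹ *
          (‖linForm (jetRow n x 1) w‖ * ‖linForm (jetRow n x 2) w‖) := by
        intro x
        rw [zeroKernel]
        split_ifs
        · exact mul_le_mul_of_nonneg_left (abs_im_conj_mul_le _ _) (by positivity)
        · positivity
      exact mul_le_sum_pow_four_of_far (zeroKernel_nonneg _ _) (by positivity) (norm_nonneg _)
        (norm_nonneg _) (hk (tmk x)) (hk (tmk y))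
    · exact ENNReal.ofReal_le_ofReal (far_bound hε hδ0 hC₁0 hC₂0 hreg)

end TwoPointIntegral

/-! ### Second moment of the approximate count in one cell -/

section LocalSecondMoment

/-- A square cell of side `h`. -/
def cell (a : Fin 2 → ℝ) (h : ℝ) : Set (Fin 2 → ℝ) := Set.univ.pi fun i => Set.Ioc (a i) (a i + h)

theorem measurableSet_cell (a : Fin 2 → ℝ) (h : ℝ) : MeasurableSet (cell a h) :=
  MeasurableSet.univ_pi fun _ => measurableSet_Ioc

theorem volume_cell (a : Fin 2 → ℝ) {h : ℝ} (hh : 0 ≤ h) :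
    volume (cell a h) = ENNReal.ofReal (h ^ 2) := by
  rw [cell, volume_pi_pi]
  simp [ENNReal.ofReal_pow hh]

/-- The approximate density of the zeros of the wave. -/
def zeroDensity (n : ℕ) (ε : ℝ) (w : CoeffSpace n) (x : Fin 2 → ℝ) : ℝ :=
  energy n / 2 * zeroKernel ε (jet n (tmk x) w)

theorem energy_nonneg (n : ℕ) : 0 ≤ energy n := by unfold energy; positivity

theorem zeroDensity_nonneg (n : ℕ) (ε : ℝ) (w : CoeffSpace n) (x : Fin 2 → ℝ) :
    0 ≤ zeroDensity n ε w x :=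
  mul_nonneg (div_nonneg (energy_nonneg n) zero_le_two) (zeroKernel_nonneg _ _)

theorem continuous_jetAt (n : ℕ) (a : Fin 3) (l : Fin 2 → ℤ) :
    Continuous fun x : Torus => jetAt n x a l := by
  unfold jetAt
  fun_prop

theorem continuous_jet (n : ℕ) :
    Continuous fun p : CoeffSpace n × (Fin 2 → ℝ) => jet n (tmk p.2) p.1 := by
  refine (PiLp.continuous_toLp 2 _).comp (continuous_pi fun a => ?_)
  refine continuous_finsetSum _ fun l _ => ?_
  exact ((continuous_jetAt n a l).comp (continuous_tmk.comp continuous_snd)).mul (by fun_prop)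

theorem measurable_zeroDensity (n : ℕ) (ε : ℝ) :
    Measurable fun p : CoeffSpace n × (Fin 2 → ℝ) => zeroDensity n ε p.1 p.2 :=
  ((measurable_zeroKernel ε).comp (continuous_jet n).measurable).const_mul _

/-- The rescaled Cauchy kernel. -/
def cauchyKernel (ε κ t : ℝ) : ℝ := ε / (ε ^ 2 + κ ^ 2 * t ^ 2)

theorem cauchyKernel_eq {ε κ : ℝ} (hε : 0 < ε) (t : ℝ) :
    cauchyKernel ε κ t = ε⁻¹ * (1 + (κ / ε * t) ^ 2)⁻¹ := by
  rw [cauchyKernel]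
  field_simp

theorem integrable_cauchyKernel {ε κ : ℝ} (hε : 0 < ε) (hκ : 0 < κ) :
    Integrable (cauchyKernel ε κ) := by
  have h : cauchyKernel ε κ = fun t => ε⁻¹ * (1 + (κ / ε * t) ^ 2)⁻¹ :=
    funext fun t => cauchyKernel_eq hε t
  rw [h]
  exact (integrable_inv_one_add_sq.comp_mul_left' (by positivity : κ / ε ≠ 0)).const_mul _

theorem integral_cauchyKernel {ε κ : ℝ} (hε : 0 < ε) (hκ : 0 < κ) :
    ∫ t, cauchyKernel ε κ t = Real.pi / κ := by
  simp_rw [cauchyKernel_eq hε]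
  rw [integral_const_mul, Measure.integral_comp_mul_left (fun t => (1 + t ^ 2)⁻¹),
    integral_univ_inv_one_add_sq, abs_of_pos (by positivity), smul_eq_mul]
  field_simp

theorem lintegral_cauchyKernel_prod {ε κ : ℝ} (hε : 0 < ε) (hκ : 0 < κ) (x : Fin 2 → ℝ) :
    ∫⁻ y : Fin 2 → ℝ, ENNReal.ofReal (∏ i, cauchyKernel ε κ ((y - x) i)) =
      ENNReal.ofReal ((Real.pi / κ) ^ 2) := by
  rw [lintegral_sub_right_eq_self
    (fun y : Fin 2 → ℝ => ENNReal.ofReal (∏ i, cauchyKernel ε κ (y i))) x]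
  rw [← ofReal_integral_eq_lintegral_ofReal]
  · rw [integral_fintype_prod_volume_eq_prod (fun _ : Fin 2 => cauchyKernel ε κ)]
    simp [integral_cauchyKernel hε hκ, div_pow]
  · exact Integrable.fintype_prod (f := fun _ : Fin 2 => cauchyKernel ε κ)
      fun _ => integrable_cauchyKernel hε hκ
  · refine ae_of_all _ fun y => Finset.prod_nonneg fun i _ => ?_
    unfold cauchyKernel
    positivity

/-- `(ε² + a)(ε² + b) ≤ (ε² + a + b)²` for nonnegative `a, b`. The product form reduces the planar
integral to the one-dimensional Cauchy integral, whose value does not depend on `ε`. -/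
theorem div_sq_le_prod_cauchyKernel {n : ℕ} {ε κ : ℝ} (hε : 0 < ε)
    (hκ : κ ^ 2 = 2 * Real.pi ^ 2 * n) (d : Fin 2 → ℝ) :
    ε ^ 2 / (ε ^ 2 + scaledSq n d) ^ 2 ≤ ∏ i, cauchyKernel ε κ (d i) := by
  rw [Fin.prod_univ_two, cauchyKernel, cauchyKernel, div_mul_div_comm, ← sq ε, scaledSq, ← hκ]
  refine div_le_div_of_nonneg_left (by positivity) (by positivity) ?_
  nlinarith [mul_nonneg (sq_nonneg κ) (sq_nonneg (d 0)), mul_nonneg (sq_nonneg κ) (sq_nonneg (d 1)),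
    mul_nonneg (mul_nonneg (sq_nonneg κ) (sq_nonneg (d 0)))
      (mul_nonneg (sq_nonneg κ) (sq_nonneg (d 1))), sq_nonneg ε,
    mul_nonneg (sq_nonneg ε) (mul_nonneg (sq_nonneg κ) (sq_nonneg (d 1))),
    mul_nonneg (sq_nonneg ε) (mul_nonneg (sq_nonneg κ) (sq_nonneg (d 0)))]

theorem lintegral_sq_eq {α : Type*} [MeasurableSpace α] (μ : Measure α) {f : α → ℝ≥0∞}
    (hf : Measurable f) : (∫⁻ x, f x ∂μ) ^ 2 = ∫⁻ x, ∫⁻ y, f x * f y ∂μ ∂μ := by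
  simp_rw [lintegral_const_mul _ hf]
  rw [lintegral_mul_const _ hf, sq]

theorem lintegral_sq_lintegral_eq {α β : Type*} [MeasurableSpace α] [MeasurableSpace β]
    (μ : Measure α) [SFinite μ] (ν : Measure β) [SFinite ν] {f : α → β → ℝ≥0∞}
    (hf : Measurable (Function.uncurry f)) :
    ∫⁻ w, (∫⁻ x, f w x ∂ν) ^ 2 ∂μ = ∫⁻ x, ∫⁻ y, ∫⁻ w, f w x * f w y ∂μ ∂ν ∂ν := by
  have hmx : ∀ w, Measurable (f w) := fun w => hf.comp measurable_prodMk_left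
  simp_rw [lintegral_sq_eq ν (hmx _)]
  have hm2 : Measurable fun p : (α × β) × β => f p.1.1 p.1.2 * f p.1.1 p.2 :=
    (hf.comp measurable_fst).mul
      (hf.comp ((measurable_fst.comp measurable_fst).prodMk measurable_snd))
  have h1 : Measurable fun p : α × β => ∫⁻ y, f p.1 p.2 * f p.1 y ∂ν := hm2.lintegral_prod_right'
  rw [lintegral_lintegral_swap h1.aemeasurable]
  refine lintegral_congr fun x => ?_
  have h2 : Measurable fun p : α × β => f p.1 x * f p.1 p.2 :=
    hm2.comp ((measurable_fst.prodMk measurable_const).prodMk measurable_snd)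
  exact lintegral_lintegral_swap h2.aemeasurable

theorem exists_lintegral_zeroDensity_mul_le : ∃ C : ℝ, 0 ≤ C ∧ ∀ n ∈ sumTwoSq, n ≠ 0 →
    ∀ κ : ℝ, κ ^ 2 = 2 * Real.pi ^ 2 * n →
    ∀ (a : Fin 2 → ℝ) (h : ℝ), κ ^ 2 * h ^ 2 ≤ 1 / 8 → ∀ ε : ℝ, 0 < ε → ε ≤ 1 →
    ∀ x ∈ cell a h, ∀ y ∈ cell a h, y ≠ x → ∫⁻ w, ENNReal.ofReal (zeroDensity n ε w x) *
      ENNReal.ofReal (zeroDensity n ε w y) ∂(stdGaussian (CoeffSpace n)) ≤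
      ENNReal.ofReal (κ ^ 4 * C) * (1 + ENNReal.ofReal (∏ i, cauchyKernel ε κ ((y - x) i))) := by
  obtain ⟨C, hC0, hC⟩ := exists_lintegral_zeroKernel_mul_le
  refine ⟨C, hC0, ?_⟩
  intro n hn hn0 κ hκ2 a h hκh ε hε hε1 x hx y hy hxy
  have hn' : (0 : ℝ) < n := by exact_mod_cast Nat.pos_of_ne_zero hn0
  have hEκ : energy n / 2 = κ ^ 2 := by rw [hκ2, energy]; ring
  have hd : ∀ i, (y i - x i) ^ 2 ≤ h ^ 2 := by
    intro i
    have h1 := hx i (Set.mem_univ i)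
    have h2 := hy i (Set.mem_univ i)
    exact sq_le_sq' (by linarith [h1.2, h2.1]) (by linarith [h1.1, h2.2])
  have hs0 : 0 < scaledSq n (y - x) := by
    obtain ⟨i, hi⟩ := Function.ne_iff.1 hxy
    have hi' : 0 < (y i - x i) ^ 2 := by
      have := sub_ne_zero.2 hi
      positivity
    have : 0 < (y 0 - x 0) ^ 2 + (y 1 - x 1) ^ 2 := by
      fin_cases i
      · simp only [Fin.zero_eta] at hi'; positivity
      · simp only [Fin.mk_one] at hi'; positivity
    simp only [scaledSq, Pi.sub_apply]
    positivity
  have hs1 : scaledSq n (y - x) ≤ 1 / 4 := by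
    rw [scaledSq, ← hκ2]
    simp only [Pi.sub_apply]
    nlinarith [hd 0, hd 1, sq_nonneg κ]
  have h3 := hC n hn x y hs0 hs1 ε hε hε1
  have h4 : ∀ w, ENNReal.ofReal (zeroDensity n ε w x) * ENNReal.ofReal (zeroDensity n ε w y) =
      ENNReal.ofReal (κ ^ 4) * ENNReal.ofReal
        (zeroKernel ε (jet n (tmk x) w) * zeroKernel ε (jet n (tmk y) w)) := by
    intro w
    rw [← ENNReal.ofReal_mul (zeroDensity_nonneg _ _ _ _), ← ENNReal.ofReal_mul (by positivity),
      zeroDensity, zeroDensity, hEκ]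
    congr 1
    ring
  simp_rw [h4]
  rw [lintegral_const_mul' _ _ ENNReal.ofReal_ne_top, ENNReal.ofReal_mul (by positivity),
    mul_assoc]
  refine mul_le_mul_right (h3.trans ?_) _
  rw [ENNReal.ofReal_mul hC0]
  refine mul_le_mul_right ((ENNReal.ofReal_add_le).trans ?_) _
  rw [ENNReal.ofReal_one]
  exact add_le_add le_rfl (ENNReal.ofReal_le_ofReal (div_sq_le_prod_cauchyKernel hε hκ2 _))

/-- By Tonelli the second moment is the double integral of the two-point estimate. The prefactor
`κ⁴`, with `κ² = E_n/2`, is compensated by the scale of the cell: the result depends only on `κ² h²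
≤ 1/8`, uniformly in `n` and `ε`. -/
theorem exists_lintegral_sq_cell_le : ∃ C : ℝ, 0 ≤ C ∧ ∀ n ∈ sumTwoSq, n ≠ 0 →
    ∀ (a : Fin 2 → ℝ) (h : ℝ), 0 ≤ h → 4 * Real.pi * √n * h ≤ 1 → ∀ ε : ℝ, 0 < ε → ε ≤ 1 →
    ∫⁻ w, (∫⁻ x in cell a h, ENNReal.ofReal (zeroDensity n ε w x)) ^ 2
      ∂(stdGaussian (CoeffSpace n)) ≤ ENNReal.ofReal C := by
  obtain ⟨C, hC0, hC⟩ := exists_lintegral_zeroDensity_mul_le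
  refine ⟨2 * C, by positivity, ?_⟩
  intro n hn hn0 a h hh hnh ε hε hε1
  have hn' : (0 : ℝ) < n := by exact_mod_cast Nat.pos_of_ne_zero hn0
  set κ : ℝ := √(2 * Real.pi ^ 2 * n) with hκ
  have hκ2 : κ ^ 2 = 2 * Real.pi ^ 2 * n := Real.sq_sqrt (by positivity)
  have hκ0 : 0 < κ := Real.sqrt_pos.2 (by positivity)
  have hκh : κ ^ 2 * h ^ 2 ≤ 1 / 8 := by
    have : (4 * Real.pi * √n * h) ^ 2 ≤ 1 := pow_le_one₀ (by positivity) hnh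
    rw [mul_pow, mul_pow, Real.sq_sqrt hn'.le] at this
    rw [hκ2]
    nlinarith
  rw [lintegral_sq_lintegral_eq _ _
    (f := fun (w : CoeffSpace n) x => ENNReal.ofReal (zeroDensity n ε w x))
    (ENNReal.measurable_ofReal.comp (measurable_zeroDensity n ε))]
  have hinner : ∀ x ∈ cell a h, ∫⁻ y in cell a h, ∫⁻ w, ENNReal.ofReal (zeroDensity n ε w x) *
      ENNReal.ofReal (zeroDensity n ε w y) ∂(stdGaussian (CoeffSpace n)) ≤
      ENNReal.ofReal (κ ^ 4 * C) * (ENNReal.ofReal (h ^ 2) + ENNReal.ofReal ((Real.pi / κ) ^ 2)) := by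
    intro x hx
    have hne : ∀ᵐ y ∂(volume.restrict (cell a h)), y ≠ x := by
      refine ae_restrict_of_ae ?_
      simp [ae_iff]
    refine (lintegral_mono_ae (g := fun y => ENNReal.ofReal (κ ^ 4 * C) *
      (1 + ENNReal.ofReal (∏ i, cauchyKernel ε κ ((y - x) i)))) ?_).trans ?_
    · filter_upwards [hne, ae_restrict_mem (measurableSet_cell a h)] with y hy1 hy2
      exact hC n hn hn0 κ hκ2 a h hκh ε hε hε1 x hx y hy2 hy1
    · rw [lintegral_const_mul' _ _ ENNReal.ofReal_ne_top, lintegral_add_left measurable_const]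
      refine mul_le_mul_right (add_le_add ?_ ?_) _
      · simp [volume_cell a hh]
      · exact (setLIntegral_le_lintegral _ _).trans (lintegral_cauchyKernel_prod hε hκ0 x).le
  refine (setLIntegral_mono' (measurableSet_cell a h) hinner).trans ?_
  rw [lintegral_const, Measure.restrict_apply_univ, volume_cell a hh,
    ← ENNReal.ofReal_add (by positivity) (by positivity), ← ENNReal.ofReal_mul (by positivity),
    ← ENNReal.ofReal_mul (by positivity)]
  refine ENNReal.ofReal_le_ofReal ?_
  have h5 : κ ^ 4 * C * (h ^ 2 + (Real.pi / κ) ^ 2) * h ^ 2 =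
      C * ((κ ^ 2 * h ^ 2) ^ 2 + Real.pi ^ 2 * (κ ^ 2 * h ^ 2)) := by
    field_simp
  rw [h5, mul_comm 2 C]
  have hpi : Real.pi ^ 2 ≤ 10 := by nlinarith [Real.pi_lt_d2, Real.pi_pos]
  have h6 : 0 ≤ κ ^ 2 * h ^ 2 := by positivity
  refine mul_le_mul_of_nonneg_left ?_ hC0
  nlinarith

end LocalSecondMoment

/-! ### Approximate counts in `L²` and correlation decay of their densities -/

section ZeroMass

open scoped RealInnerProductSpace

theorem IsCoisometry.norm_apply_le {E F : Type*} [NormedAddCommGroup E] [InnerProductSpace ℝ E]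
    [FiniteDimensional ℝ E] [NormedAddCommGroup F] [InnerProductSpace ℝ F]
    [FiniteDimensional ℝ F] {L : E →L[ℝ] F} (hL : IsCoisometry L) (w : E) : ‖L w‖ ≤ ‖w‖ := by
  have h1 : ‖L w‖ ^ 2 ≤ ‖w‖ * ‖L w‖ := by
    rw [← real_inner_self_eq_norm_sq, ← ContinuousLinearMap.adjoint_inner_right, ← hL (L w)]
    exact real_inner_le_norm _ _
  rcases (norm_nonneg (L w)).eq_or_lt with h | h
  · rw [← h]; exact norm_nonneg _
  · nlinarith

/-- The approximate number of zeros, weighted by a measure. -/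
def zeroMass (n : ℕ) (ε : ℝ) (ν : Measure (Fin 2 → ℝ)) (w : CoeffSpace n) : ℝ :=
  ∫ x, zeroDensity n ε w x ∂ν

variable {n : ℕ}

/-- A crude bound depending on `ε`; it serves only for integrability and the use of Fubini. -/
theorem zeroDensity_le (hn : n ∈ sumTwoSq) (hn0 : n ≠ 0) (ε : ℝ) (w : CoeffSpace n)
    (x : Fin 2 → ℝ) : zeroDensity n ε w x ≤ energy n / 2 * ((2 * ε) ^ 2)⁻¹ * ‖w‖ ^ 2 := by
  rw [zeroDensity, mul_assoc]
  refine mul_le_mul_of_nonneg_left ((zeroKernel_le ε _).trans ?_)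
    (div_nonneg (energy_nonneg n) zero_le_two)
  gcongr
  exact (isCoisometry_jet hn hn0 _).norm_apply_le w

theorem integrable_zeroDensity (hn : n ∈ sumTwoSq) (hn0 : n ≠ 0) (ε : ℝ) (w : CoeffSpace n)
    (ν : Measure (Fin 2 → ℝ)) [IsFiniteMeasure ν] : Integrable (zeroDensity n ε w) ν :=
  Integrable.of_bound ((measurable_zeroDensity n ε).comp
    measurable_prodMk_left).aestronglyMeasurable _ (ae_of_all _ fun x => by
      rw [Real.norm_of_nonneg (zeroDensity_nonneg _ _ _ _)]
      exact zeroDensity_le hn hn0 ε w x)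

theorem measurable_zeroMass (n : ℕ) (ε : ℝ) (ν : Measure (Fin 2 → ℝ)) [SFinite ν] :
    Measurable (zeroMass n ε ν) :=
  ((measurable_zeroDensity n ε).stronglyMeasurable.integral_prod_right (ν := ν)).measurable

theorem memLp_zeroMass (hn : n ∈ sumTwoSq) (hn0 : n ≠ 0) (ε : ℝ) (ν : Measure (Fin 2 → ℝ))
    [IsFiniteMeasure ν] : MemLp (zeroMass n ε ν) 2 (stdGaussian (CoeffSpace n)) := by
  refine (memLp_norm_sq_stdGaussian.const_mul
    (energy n / 2 * ((2 * ε) ^ 2)⁻¹ * ν.real Set.univ)).mono'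
    (measurable_zeroMass n ε ν).aestronglyMeasurable (ae_of_all _ fun w => ?_)
  refine (norm_integral_le_of_norm_le_const (ae_of_all _ fun x => ?_)).trans (le_of_eq
    (mul_right_comm (energy n / 2 * ((2 * ε) ^ 2)⁻¹) (‖w‖ ^ 2) _))
  rw [Real.norm_of_nonneg (zeroDensity_nonneg _ _ _ _)]
  exact zeroDensity_le hn hn0 ε w x

/-- The approximate number of zeros, as an element of `L²`. -/
def zeroMassLp (hn : n ∈ sumTwoSq) (hn0 : n ≠ 0) (ε : ℝ) (ν : Measure (Fin 2 → ℝ))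
    [IsFiniteMeasure ν] : Lp ℝ 2 (stdGaussian (CoeffSpace n)) :=
  (memLp_zeroMass hn hn0 ε ν).toLp (zeroMass n ε ν)

theorem coeFn_zeroMassLp (hn : n ∈ sumTwoSq) (hn0 : n ≠ 0) (ε : ℝ) (ν : Measure (Fin 2 → ℝ))
    [IsFiniteMeasure ν] : zeroMassLp hn hn0 ε ν =ᵐ[stdGaussian (CoeffSpace n)] zeroMass n ε ν :=
  (memLp_zeroMass hn hn0 ε ν).coeFn_toLp

/-- The approximate density of the zeros at a point, as an element of `L²`. -/
def zeroDensityLp (hn : n ∈ sumTwoSq) (hn0 : n ≠ 0) (ε : ℝ) (x : Fin 2 → ℝ) :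
    Lp ℝ 2 (stdGaussian (CoeffSpace n)) :=
  (energy n / 2) • pull (isCoisometry_jet hn hn0 (tmk x)).measurePreserving (zeroKernelLp ε)

theorem coeFn_zeroDensityLp (hn : n ∈ sumTwoSq) (hn0 : n ≠ 0) (ε : ℝ) (x : Fin 2 → ℝ) :
    zeroDensityLp hn hn0 ε x =ᵐ[stdGaussian (CoeffSpace n)] fun w => zeroDensity n ε w x := by
  have hL := (isCoisometry_jet hn hn0 (tmk x)).measurePreserving
  filter_upwards [Lp.coeFn_smul (energy n / 2) (pull hL (zeroKernelLp ε)),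
    coeFn_pull hL (zeroKernelLp ε),
    hL.quasiMeasurePreserving.ae_eq_comp (coeFn_zeroKernelLp ε)] with w h1 h2 h3
  rw [zeroDensityLp, h1, Pi.smul_apply, h2, h3, zeroDensity, smul_eq_mul]
  rfl

theorem inner_eq_integral {α : Type*} [MeasurableSpace α] {μ : Measure α} {f g : Lp ℝ 2 μ}
    {f' : α → ℝ} (hf : f =ᵐ[μ] f') : ⟪f, g⟫ = ∫ a, f' a * g a ∂μ := by
  rw [L2.inner_def]
  refine integral_congr_ae ?_
  filter_upwards [hf] with a ha
  rw [ha]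
  simp [mul_comm]

/-- Fubini: testing the mass weakly reduces covariances of counts to integrals of covariances of
densities at points, without integrating `L²`-valued functions. -/
theorem inner_zeroMassLp (hn : n ∈ sumTwoSq) (hn0 : n ≠ 0) (ε : ℝ) (ν : Measure (Fin 2 → ℝ))
    [IsFiniteMeasure ν] (g : Lp ℝ 2 (stdGaussian (CoeffSpace n))) :
    ⟪zeroMassLp hn hn0 ε ν, g⟫ = ∫ x, ⟪zeroDensityLp hn hn0 ε x, g⟫ ∂ν := by
  rw [inner_eq_integral (coeFn_zeroMassLp hn hn0 ε ν)]
  simp_rw [inner_eq_integral (coeFn_zeroDensityLp hn hn0 ε _)]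
  have hg := (Lp.memLp g)
  have hint : Integrable (Function.uncurry fun (w : CoeffSpace n) x => zeroDensity n ε w x * g w)
      ((stdGaussian (CoeffSpace n)).prod ν) := by
    have h1 : Integrable (fun w : CoeffSpace n => energy n / 2 * ((2 * ε) ^ 2)⁻¹ * ‖w‖ ^ 2 * |g w|)
        (stdGaussian (CoeffSpace n)) :=
      (memLp_norm_sq_stdGaussian.const_mul _).integrable_mul hg.norm
    refine (h1.comp_fst ν).mono' ?_ (ae_of_all _ fun p => ?_)
    · exact (measurable_zeroDensity n ε).aestronglyMeasurable.mul hg.1.comp_fst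
    · rw [Function.uncurry, norm_mul, Real.norm_of_nonneg (zeroDensity_nonneg _ _ _ _),
        Real.norm_eq_abs]
      exact mul_le_mul_of_nonneg_right (zeroDensity_le hn hn0 ε p.1 p.2) (abs_nonneg _)
  rw [← integral_integral_swap hint]
  refine integral_congr_ae (ae_of_all _ fun w => ?_)
  change zeroMass n ε ν w * g w = ∫ x, zeroDensity n ε w x * g w ∂ν
  rw [integral_mul_const]
  rfl

theorem norm_zeroMassLp_sq_le (hn : n ∈ sumTwoSq) (hn0 : n ≠ 0) {ε C : ℝ} (hC : 0 ≤ C)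
    (ν : Measure (Fin 2 → ℝ)) [IsFiniteMeasure ν]
    (h : ∫⁻ w, (∫⁻ x, ENNReal.ofReal (zeroDensity n ε w x) ∂ν) ^ 2
      ∂(stdGaussian (CoeffSpace n)) ≤ ENNReal.ofReal C) :
    ‖zeroMassLp hn hn0 ε ν‖ ^ 2 ≤ C := by
  have h0 : ∀ w, 0 ≤ zeroMass n ε ν w := fun w => integral_nonneg fun x => zeroDensity_nonneg _ _ _ _
  have h1 : ∀ w, ENNReal.ofReal (zeroMass n ε ν w * zeroMass n ε ν w) =
      (∫⁻ x, ENNReal.ofReal (zeroDensity n ε w x) ∂ν) ^ 2 := by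
    intro w
    rw [← sq, ENNReal.ofReal_pow (h0 w), zeroMass,
      ofReal_integral_eq_lintegral_ofReal (integrable_zeroDensity hn hn0 ε w ν)
      (ae_of_all _ fun x => zeroDensity_nonneg _ _ _ _)]
  rw [← real_inner_self_eq_norm_sq, inner_eq_integral (coeFn_zeroMassLp hn hn0 ε ν)]
  have h2 : ∫ w, zeroMass n ε ν w * zeroMassLp hn hn0 ε ν w ∂(stdGaussian (CoeffSpace n)) =
      ∫ w, zeroMass n ε ν w * zeroMass n ε ν w ∂(stdGaussian (CoeffSpace n)) := by
    refine integral_congr_ae ?_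
    filter_upwards [coeFn_zeroMassLp hn hn0 ε ν] with w hw
    rw [hw]
  have hm := measurable_zeroMass n ε ν
  rw [h2, integral_eq_lintegral_of_nonneg_ae (ae_of_all _ fun w => mul_self_nonneg _)
    (hm.mul hm).aestronglyMeasurable]
  simp_rw [h1]
  exact ENNReal.toReal_le_of_le_ofReal hC h

/-- The projection onto finitely many chaoses. -/
def chaosSum {E : Type*} [NormedAddCommGroup E] [InnerProductSpace ℝ E] [FiniteDimensional ℝ E]
    [MeasurableSpace E] [BorelSpace E] (S : Finset ℕ) :
    Lp ℝ 2 (stdGaussian E) →L[ℝ] Lp ℝ 2 (stdGaussian E) := ∑ q ∈ S, gaussProj q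

section ChaosSum

variable {E : Type*} [NormedAddCommGroup E] [InnerProductSpace ℝ E] [FiniteDimensional ℝ E]
  [MeasurableSpace E] [BorelSpace E]

theorem chaosSum_apply (S : Finset ℕ) (f : Lp ℝ 2 (stdGaussian E)) :
    chaosSum S f = ∑ q ∈ S, gaussProj q f := by
  rw [chaosSum, sum_apply]

theorem norm_chaosSum_le (S : Finset ℕ) (f : Lp ℝ 2 (stdGaussian E)) : ‖chaosSum S f‖ ≤ ‖f‖ := by
  rw [chaosSum_apply]
  exact norm_sum_gaussProj_le S f

theorem norm_chaosSum_sq (S : Finset ℕ) (f : Lp ℝ 2 (stdGaussian E)) :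
    ‖chaosSum S f‖ ^ 2 = ⟪chaosSum S f, f⟫ := by
  rw [chaosSum_apply, norm_sum_gaussProj_sq, sum_inner]
  exact Finset.sum_congr rfl fun q _ => (inner_gaussProj_self q f).symm

theorem inner_gaussProj_comm (q : ℕ) (f g : Lp ℝ 2 (stdGaussian E)) :
    ⟪gaussProj q f, g⟫ = ⟪f, gaussProj q g⟫ := by
  rw [← inner_gaussProj f (gaussProj_mem q g), real_inner_comm,
    ← inner_gaussProj g (gaussProj_mem q f), real_inner_comm]

theorem inner_chaosSum_comm (S : Finset ℕ) (f g : Lp ℝ 2 (stdGaussian E)) :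
    ⟪chaosSum S f, g⟫ = ⟪f, chaosSum S g⟫ := by
  rw [chaosSum_apply, chaosSum_apply, sum_inner, inner_sum]
  exact Finset.sum_congr rfl fun q _ => inner_gaussProj_comm q f g

end ChaosSum

/-- The total size of the cross covariances of the jets. -/
def covSize (n : ℕ) (x : Torus) : ℝ := ∑ p : Fin 3 × Fin 3, ‖crossCov n p.1 p.2 x‖

theorem covSize_nonneg (n : ℕ) (x : Torus) : 0 ≤ covSize n x :=
  Finset.sum_nonneg fun _ _ => norm_nonneg _

theorem norm_crossCov_le_covSize (n : ℕ) (a b : Fin 3) (x : Torus) :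
    ‖crossCov n a b x‖ ≤ covSize n x := by
  unfold covSize
  generalize hf : (fun p : Fin 3 × Fin 3 => ‖crossCov n p.1 p.2 x‖) = f
  have h0 : ∀ p, 0 ≤ f p := fun p => by rw [← hf]; exact norm_nonneg _
  have h1 : f (a, b) = ‖crossCov n a b x‖ := by rw [← hf]
  rw [← h1]
  exact Finset.single_le_sum (fun p _ => h0 p) (Finset.mem_univ (a, b))

theorem continuous_covSize (n : ℕ) : Continuous (covSize n) :=
  continuous_finsetSum _ fun _ _ => (continuous_crossCov n _ _).norm

theorem integral_covSize_pow_six_le (n : ℕ) :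
    ∫ x, covSize n x ^ 6 ≤ 9 ^ 6 * 64 * sixthMoment n := by
  have h1 : ∀ x, covSize n x ^ 6 ≤ 9 ^ 5 * ∑ p : Fin 3 × Fin 3, ‖crossCov n p.1 p.2 x‖ ^ 6 := by
    intro x
    have h := pow_sum_div_card_le_sum_pow (s := (Finset.univ : Finset (Fin 3 × Fin 3)))
      (f := fun p => ‖crossCov n p.1 p.2 x‖) (fun _ _ => norm_nonneg _) 5
    have hc : ((Finset.univ : Finset (Fin 3 × Fin 3)).card : ℝ) = 9 := by simp
    rw [hc, div_le_iff₀ (by positivity)] at h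
    rw [covSize, mul_comm]
    exact h
  have h2 : ∀ p : Fin 3 × Fin 3, Integrable fun x => ‖crossCov n p.1 p.2 x‖ ^ 6 := fun p =>
    integrable_of_continuous_torus ((continuous_crossCov n p.1 p.2).norm.pow 6)
  refine (integral_mono (integrable_of_continuous_torus ((continuous_covSize n).pow 6))
    ((integrable_finsetSum _ fun p _ => h2 p).const_mul _) h1).trans ?_
  rw [integral_const_mul, integral_finsetSum _ fun p _ => h2 p]
  have h3 : ∑ p : Fin 3 × Fin 3, ∫ x, ‖crossCov n p.1 p.2 x‖ ^ 6 ≤ 9 * (64 * sixthMoment n) := by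
    refine (Finset.sum_le_card_nsmul _ _ _ fun p _ =>
      integral_crossCov_pow_six_le n p.1 p.2).trans (le_of_eq ?_)
    simp
  linarith

theorem covSize_sub_le {n : ℕ} {x y : Fin 2 → ℝ} {h : ℝ} (h0 : 0 ≤ h)
    (hx : ∀ i, |x i - y i| ≤ h) :
    covSize n (tmk x) ≤ covSize n (tmk y) + 72 * Real.pi * √n * h := by
  have h1 : ∀ p : Fin 3 × Fin 3, ‖crossCov n p.1 p.2 (tmk x)‖ ≤
      ‖crossCov n p.1 p.2 (tmk y)‖ + 8 * Real.pi * √n * h := by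
    intro p
    have := norm_crossCov_sub_le (n := n) p.1 p.2 h0 hx
    linarith [norm_sub_norm_le (crossCov n p.1 p.2 (tmk x)) (crossCov n p.1 p.2 (tmk y))]
  refine (Finset.sum_le_sum fun p _ => h1 p).trans (le_of_eq ?_)
  rw [Finset.sum_add_distrib, ← covSize]
  simp
  ring

/-- Correlation decay for the chaos components of the zero density. -/
theorem exists_abs_inner_chaosSum_zeroDensityLp_le : ∃ C : ℝ, 0 ≤ C ∧ ∀ n (hn : n ∈ sumTwoSq)
    (hn0 : n ≠ 0) (ε : ℝ), 0 < ε → ∀ S : Finset ℕ, (∀ q ∈ S, 6 ≤ q) → ∀ x y : Fin 2 → ℝ,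
    covSize n (tmk y - tmk x) ≤ 1 / 24 →
    |⟪chaosSum S (zeroDensityLp hn hn0 ε x), zeroDensityLp hn hn0 ε y⟫| ≤
      C * (energy n ^ 2 * covSize n (tmk y - tmk x) ^ 6) := by
  obtain ⟨C, hC0, hC⟩ := exists_norm_gaussProj_zeroKernel_le
  refine ⟨C ^ 2 * 12 ^ 6 / 2, by positivity, ?_⟩
  intro n hn hn0 ε hε S hS x y hxy
  set m := covSize n (tmk y - tmk x) with hm
  have hm0 : 0 ≤ m := covSize_nonneg _ _
  -- The norm of the 3 by 3 correlation matrix is at most `3m`. Together with the two factors `2 ^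
  -- q` from the kernels, this makes `12m` the ratio of the geometric series, and `m ≤ 1/24` makes
  -- it at most 1/2.
  set ρ : unitInterval := ⟨3 * m, by positivity, by linarith⟩ with hρ
  have hρm : (ρ : ℝ) = 3 * m := rfl
  have hL := isCoisometry_jet hn hn0 (tmk x)
  have hM := isCoisometry_jet hn hn0 (tmk y)
  have hLM : ‖(jet n (tmk y)).comp (ContinuousLinearMap.adjoint (jet n (tmk x)))‖ ≤ ρ :=
    norm_jet_comp_adjoint_le fun a b => norm_crossCov_le_covSize n a b _
  have h1 : ∀ q, |⟪gaussProj q (pull hL.measurePreserving (zeroKernelLp ε)),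
      pull hM.measurePreserving (zeroKernelLp ε)⟫| ≤ C ^ 2 * (12 * m) ^ q := by
    intro q
    refine (abs_inner_gaussProj_pull_le hL hM hLM q _ _).trans ?_
    have h2 := hC ε hε q
    calc _ ≤ (3 * m) ^ q * ((C * 2 ^ q) * (C * 2 ^ q)) := by
          rw [hρm]
          gcongr
      _ = C ^ 2 * (12 * m) ^ q := by
          rw [show (12 : ℝ) * m = 3 * m * (2 * 2) by ring, mul_pow (3 * m), mul_pow (2 : ℝ)]
          ring
  -- Since every `q` in `S` is at least 6, a factor `(12m)^6` comes out and the remaining geometric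
  -- series sums to at most 2.
  have h3 : ∑ q ∈ S, (12 * m) ^ q ≤ 2 * (12 * m) ^ 6 := by
    have h12 : 12 * m < 1 := by linarith
    have hs := summable_geometric_of_lt_one (by positivity) h12
    have h4 : ∀ q ∈ S, (12 * m) ^ q = (12 * m) ^ 6 * (12 * m) ^ (q - 6) := by
      intro q hq
      rw [← pow_add, Nat.add_sub_cancel' (hS q hq)]
    rw [Finset.sum_congr rfl h4, ← Finset.mul_sum, mul_comm]
    refine mul_le_mul_of_nonneg_right ?_ (by positivity)
    have h5 : ∑ q ∈ S, (12 * m) ^ (q - 6) = ∑ q ∈ S.image (fun q => q - 6), (12 * m) ^ q := by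
      rw [Finset.sum_image]
      intro a ha b hb hab
      have := hS a ha
      have := hS b hb
      simp only at hab
      omega
    rw [h5]
    refine (hs.sum_le_tsum _ fun q _ => by positivity).trans ?_
    rw [tsum_geometric_of_lt_one (by positivity) h12, inv_le_comm₀ (by linarith) (by norm_num)]
    linarith
  rw [zeroDensityLp, zeroDensityLp, map_smul, inner_smul_left, inner_smul_right, chaosSum_apply,
    sum_inner, abs_mul, abs_mul]
  have h6 : |∑ q ∈ S, ⟪gaussProj q (pull hL.measurePreserving (zeroKernelLp ε)),
      pull hM.measurePreserving (zeroKernelLp ε)⟫| ≤ C ^ 2 * (2 * (12 * m) ^ 6) := by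
    refine (Finset.abs_sum_le_sum_abs _ _).trans ((Finset.sum_le_sum fun q _ => h1 q).trans ?_)
    rw [← Finset.mul_sum]
    gcongr
  have hE := energy_nonneg n
  have h7 : |energy n / 2| = energy n / 2 := abs_of_nonneg (by positivity)
  simp only [RCLike.conj_to_real]
  rw [h7]
  calc _ ≤ energy n / 2 * (energy n / 2 * (C ^ 2 * (2 * (12 * m) ^ 6))) := by gcongr
    _ = _ := by ring

end ZeroMass

/-! ### Singular and nonsingular pairs of cells -/

section Grid

open scoped RealInnerProductSpace

/-- The lower left corners of the cells of the `M × M` grid. -/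
def gridCorner (M : ℕ) (k : Fin 2 → Fin M) (i : Fin 2) : ℝ := (k i : ℝ) / M

theorem box_zero_eq_iUnion_cell {M : ℕ} (hM : 0 < M) :
    box 0 = ⋃ k : Fin 2 → Fin M, cell (gridCorner M k) (1 / M) := by
  have hM' : (0 : ℝ) < M := by exact_mod_cast hM
  ext x
  simp only [box, cell, Set.mem_iUnion, Set.mem_univ_pi, Set.mem_Ioc, gridCorner, Pi.zero_apply,
    zero_add]
  constructor
  · intro hx
    have h1 : ∀ i, 0 < ⌈x i * M⌉₊ := fun i => Nat.ceil_pos.2 (mul_pos (hx i).1 hM')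
    have h2 : ∀ i, ⌈x i * M⌉₊ ≤ M := fun i => Nat.ceil_le.2 (by nlinarith [(hx i).2])
    refine ⟨fun i => ⟨⌈x i * M⌉₊ - 1, by have := h1 i; have := h2 i; omega⟩, fun i => ?_⟩
    have h3 : ((⌈x i * M⌉₊ - 1 : ℕ) : ℝ) = ⌈x i * M⌉₊ - 1 := by
      rw [Nat.cast_sub (h1 i)]; simp
    simp only [h3]
    constructor
    · rw [div_lt_iff₀ hM']
      linarith [Nat.ceil_lt_add_one (mul_pos (hx i).1 hM').le]
    · rw [← add_div, le_div_iff₀ hM']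
      linarith [Nat.le_ceil (x i * M)]
  · rintro ⟨k, hk⟩ i
    have h1 : ((k i : ℕ) : ℝ) + 1 ≤ M := by exact_mod_cast (k i).2
    refine ⟨lt_of_le_of_lt (by positivity) (hk i).1, (hk i).2.trans ?_⟩
    rw [← add_div, div_le_one hM']
    exact h1

theorem pairwise_disjoint_cell {M : ℕ} (hM : 0 < M) :
    Pairwise (Function.onFun Disjoint fun k : Fin 2 → Fin M => cell (gridCorner M k) (1 / M)) := by
  have hM' : (0 : ℝ) < M := by exact_mod_cast hM
  intro k k' hkk
  refine Set.disjoint_left.2 fun x hx hx' => hkk ?_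
  funext i
  have h1 := hx i (Set.mem_univ i)
  have h2 := hx' i (Set.mem_univ i)
  simp only [gridCorner, Set.mem_Ioc, ← add_div] at h1 h2
  have h3 : ((k i : ℕ) : ℝ) < (k' i : ℕ) + 1 := by
    have := h1.1.trans_le h2.2
    rwa [div_lt_div_iff_of_pos_right hM'] at this
  have h4 : ((k' i : ℕ) : ℝ) < (k i : ℕ) + 1 := by
    have := h2.1.trans_le h1.2
    rwa [div_lt_div_iff_of_pos_right hM'] at this
  have h5 : (k i : ℕ) < (k' i : ℕ) + 1 := by exact_mod_cast h3
  have h6 : (k' i : ℕ) < (k i : ℕ) + 1 := by exact_mod_cast h4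
  exact Fin.ext (by omega)

theorem setIntegral_box_eq_sum {M : ℕ} (hM : 0 < M) {f : (Fin 2 → ℝ) → ℝ}
    (hf : IntegrableOn f (box 0)) :
    ∫ x in box 0, f x = ∑ k : Fin 2 → Fin M, ∫ x in cell (gridCorner M k) (1 / M), f x := by
  rw [box_zero_eq_iUnion_cell hM] at hf ⊢
  exact integral_iUnion_fintype (fun k => measurableSet_cell _ _) (pairwise_disjoint_cell hM)
    fun k => hf.mono_set (Set.subset_iUnion (fun k => cell (gridCorner M k) (1 / M)) k)

instance (t : Fin 2 → ℝ) : IsFiniteMeasure ((volume : Measure (Fin 2 → ℝ)).restrict (box t)) :=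
  ⟨by simp [volume_box]⟩

instance (a : Fin 2 → ℝ) (h : ℝ) :
    IsFiniteMeasure ((volume : Measure (Fin 2 → ℝ)).restrict (cell a h)) :=
  ⟨by
    rw [Measure.restrict_apply_univ, cell, volume_pi_pi]
    exact ENNReal.prod_lt_top fun i _ => by simp⟩

variable {n : ℕ}

theorem zeroMassLp_box_eq_sum (hn : n ∈ sumTwoSq) (hn0 : n ≠ 0) (ε : ℝ) {M : ℕ} (hM : 0 < M) :
    zeroMassLp hn hn0 ε (volume.restrict (box 0)) =
      ∑ k : Fin 2 → Fin M, zeroMassLp hn hn0 ε (volume.restrict (cell (gridCorner M k) (1 / M))) := by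
  refine Lp.ext ?_
  have h1 : ∀ᵐ w ∂(stdGaussian (CoeffSpace n)), ∀ k : Fin 2 → Fin M,
      zeroMassLp hn hn0 ε (volume.restrict (cell (gridCorner M k) (1 / M))) w =
        zeroMass n ε (volume.restrict (cell (gridCorner M k) (1 / M))) w :=
    ae_all_iff.2 fun k => coeFn_zeroMassLp hn hn0 ε _
  filter_upwards [h1, coeFn_zeroMassLp hn hn0 ε (volume.restrict (box 0)),
    Lp.coeFn_finsetSum Finset.univ fun k : Fin 2 → Fin M =>
      zeroMassLp hn hn0 ε (volume.restrict (cell (gridCorner M k) (1 / M)))] with w h2 h3 h4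
  rw [h3, h4, zeroMass, setIntegral_box_eq_sum hM (integrable_zeroDensity hn hn0 ε w _)]
  simp only [Finset.sum_apply]
  exact Finset.sum_congr rfl fun k _ => (h2 k).symm

theorem integrable_covSize_pow_six (n : ℕ) (ν : Measure ((Fin 2 → ℝ) × (Fin 2 → ℝ)))
    [IsFiniteMeasure ν] : Integrable (fun p => covSize n (tmk p.2 - tmk p.1) ^ 6) ν := by
  obtain ⟨B, hB⟩ := isCompact_univ.exists_bound_of_continuousOn (continuous_covSize n).continuousOn
  have hc : Continuous fun p : (Fin 2 → ℝ) × (Fin 2 → ℝ) => covSize n (tmk p.2 - tmk p.1) ^ 6 :=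
    ((continuous_covSize n).comp ((continuous_tmk.comp continuous_snd).sub
      (continuous_tmk.comp continuous_fst))).pow 6
  refine Integrable.of_bound hc.aestronglyMeasurable (B ^ 6) (ae_of_all _ fun p => ?_)
  rw [norm_pow]
  exact pow_le_pow_left₀ (norm_nonneg _) (hB _ (Set.mem_univ _)) 6

/-- The second moment of the covariance over a pair of sets. -/
def covMass (n : ℕ) (A B : Set (Fin 2 → ℝ)) : ℝ :=
  ∫ y in B, ∫ x in A, covSize n (tmk y - tmk x) ^ 6

theorem integrable_integral_covSize (n : ℕ) (μ ν : Measure (Fin 2 → ℝ)) [IsFiniteMeasure μ]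
    [IsFiniteMeasure ν] : Integrable (fun y => ∫ x, covSize n (tmk y - tmk x) ^ 6 ∂μ) ν :=
  (integrable_covSize_pow_six n (μ.prod ν)).integral_prod_right

theorem integrable_covSize_left (n : ℕ) (μ : Measure (Fin 2 → ℝ)) [IsFiniteMeasure μ]
    (y : Fin 2 → ℝ) : Integrable (fun x => covSize n (tmk y - tmk x) ^ 6) μ := by
  have h := integrable_covSize_pow_six n (μ.map fun x => (x, y))
  exact (integrable_map_measure h.1 (by fun_prop)).1 h

theorem covMass_box_eq_sum (n : ℕ) {M : ℕ} (hM : 0 < M) :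
    covMass n (box 0) (box 0) = ∑ k' : Fin 2 → Fin M, ∑ k : Fin 2 → Fin M,
      covMass n (cell (gridCorner M k) (1 / M)) (cell (gridCorner M k') (1 / M)) := by
  rw [covMass, setIntegral_box_eq_sum hM (integrable_integral_covSize n _ _)]
  refine Finset.sum_congr rfl fun k' _ => ?_
  simp_rw [setIntegral_box_eq_sum hM (integrable_covSize_left n (volume.restrict (box 0)) _)]
  rw [integral_finsetSum _ fun k _ => integrable_integral_covSize n _ _]
  rfl

instance : (volume : Measure Torus).IsNegInvariant :=
  Measure.pi.isNegInvariant fun _ : Fin 2 => (volume : Measure UnitAddCircle)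

/-- By invariance under translation and negation, the inner integral over `x` does not depend on
`y`. -/
theorem covMass_box (n : ℕ) : covMass n (box 0) (box 0) = ∫ x : Torus, covSize n x ^ 6 := by
  have h1 : ∀ y : Fin 2 → ℝ, ∫ x in box 0, covSize n (tmk y - tmk x) ^ 6 =
      ∫ x : Torus, covSize n x ^ 6 := by
    intro y
    have hm : AEStronglyMeasurable (fun t : Torus => covSize n (tmk y - t) ^ 6) volume :=
      (((continuous_covSize n).comp (continuous_const.sub continuous_id)).pow 6).aestronglyMeasurable
    rw [← integral_sub_left_eq_self (fun x : Torus => covSize n x ^ 6) volume (tmk y),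
      ← (measurePreserving_tmk 0).map_eq, integral_map (continuous_tmk.measurable.aemeasurable)]
    rw [(measurePreserving_tmk 0).map_eq]
    exact hm
  simp_rw [covMass, h1]
  rw [setIntegral_const, measureReal_def, volume_box]
  simp

/-- The two hypotheses on `h` fix the scale `E_n^(-1/2)`: small enough for correlations to be almost
constant on a pair of cells, large enough that `E_n² h⁴` is bounded below. -/
theorem exists_abs_inner_chaosSum_zeroMassLp_le : ∃ C : ℝ, 0 ≤ C ∧ ∀ n (hn : n ∈ sumTwoSq)
    (hn0 : n ≠ 0) (ε : ℝ), 0 < ε → ε ≤ 1 → ∀ S : Finset ℕ, (∀ q ∈ S, 6 ≤ q) →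
    ∀ h : ℝ, 0 < h → 10000 * Real.pi * √n * h ≤ 1 → 1 ≤ 10 ^ 8 * energy n * h ^ 2 →
    ∀ a b : Fin 2 → ℝ,
    |⟪chaosSum S (zeroMassLp hn hn0 ε (volume.restrict (cell a h))),
      zeroMassLp hn hn0 ε (volume.restrict (cell b h))⟫| ≤
        C * (energy n ^ 2 * covMass n (cell a h) (cell b h)) := by
  obtain ⟨C₁, hC₁0, hC₁⟩ := exists_lintegral_sq_cell_le
  obtain ⟨C₂, hC₂0, hC₂⟩ := exists_abs_inner_chaosSum_zeroDensityLp_le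
  refine ⟨C₁ * 48 ^ 6 * 10 ^ 16 + C₂, by positivity, ?_⟩
  intro n hn hn0 ε hε hε1 S hS h hh hh1 hh2 a b
  have hE := energy_nonneg n
  have hcov : 0 ≤ covMass n (cell a h) (cell b h) :=
    integral_nonneg fun y => integral_nonneg fun x => pow_nonneg (covSize_nonneg _ _) 6
  -- Nonsingular pairs, with correlations at most 1/24 throughout, are handled by integrating the
  -- pointwise decay over both cells.
  by_cases hsing : ∀ x ∈ cell a h, ∀ y ∈ cell b h, covSize n (tmk y - tmk x) ≤ 1 / 24
  · have hmain : |⟪chaosSum S (zeroMassLp hn hn0 ε (volume.restrict (cell a h))),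
        zeroMassLp hn hn0 ε (volume.restrict (cell b h))⟫| ≤
        C₂ * (energy n ^ 2 * covMass n (cell a h) (cell b h)) := by
      rw [real_inner_comm, inner_zeroMassLp, covMass, ← integral_const_mul, ← integral_const_mul,
        ← Real.norm_eq_abs]
      refine norm_integral_le_of_norm_le
        (((integrable_integral_covSize n _ _).const_mul _).const_mul _) ?_
      filter_upwards [ae_restrict_mem (measurableSet_cell b h)] with y hy
      rw [real_inner_comm, inner_chaosSum_comm, inner_zeroMassLp, ← integral_const_mul,
        ← integral_const_mul]
      refine norm_integral_le_of_norm_le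
        (((integrable_covSize_left n _ _).const_mul _).const_mul _) ?_
      filter_upwards [ae_restrict_mem (measurableSet_cell a h)] with x hx
      rw [← inner_chaosSum_comm, Real.norm_eq_abs]
      exact hC₂ n hn hn0 ε hε S hS x y (hsing x hx y hy)
    refine hmain.trans (mul_le_mul_of_nonneg_right ?_ (by positivity))
    have : 0 ≤ C₁ * 48 ^ 6 * 10 ^ 16 := by positivity
    linarith
  · push Not at hsing
    obtain ⟨x₀, hx₀, y₀, hy₀, hxy⟩ := hsing
    have hb : ∀ c : Fin 2 → ℝ, ‖zeroMassLp hn hn0 ε (volume.restrict (cell c h))‖ ^ 2 ≤ C₁ :=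
      fun c => norm_zeroMassLp_sq_le hn hn0 hC₁0 _ (hC₁ n hn hn0 c h hh.le (by
        have : 0 ≤ Real.pi * √n * h := by positivity
        nlinarith) ε hε hε1)
    -- For a singular pair the chaos expansion is abandoned: Bessel and Cauchy-Schwarz leave the
    -- second moments of the two cells.
    have hmain : |⟪chaosSum S (zeroMassLp hn hn0 ε (volume.restrict (cell a h))),
        zeroMassLp hn hn0 ε (volume.restrict (cell b h))⟫| ≤ C₁ := by
      refine (abs_real_inner_le_norm _ _).trans ?_
      have h1 := norm_chaosSum_le S (zeroMassLp hn hn0 ε (volume.restrict (cell a h)))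
      have h2 := mul_le_mul_of_nonneg_right h1
        (norm_nonneg (zeroMassLp hn hn0 ε (volume.restrict (cell b h))))
      nlinarith [hb a, hb b, sq_nonneg (‖zeroMassLp hn hn0 ε (volume.restrict (cell a h))‖ -
        ‖zeroMassLp hn hn0 ε (volume.restrict (cell b h))‖)]
    -- Over the pair of cells the difference of points moves by at most `2h` per coordinate,
    -- changing the correlation by at most `144 π √n h ≤ 0.0144`, which is less than `1/24 - 1/48`.
    have hlow : ∀ x ∈ cell a h, ∀ y ∈ cell b h, 1 / 48 ≤ covSize n (tmk y - tmk x) := by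
      intro x hx y hy
      rw [← tmk_sub] at hxy ⊢
      have h3 : ∀ i, |(y₀ - x₀) i - (y - x) i| ≤ 2 * h := by
        intro i
        have e1 := hx₀ i (Set.mem_univ i)
        have e2 := hy₀ i (Set.mem_univ i)
        have e3 := hx i (Set.mem_univ i)
        have e4 := hy i (Set.mem_univ i)
        simp only [Set.mem_Ioc] at e1 e2 e3 e4
        simp only [Pi.sub_apply]
        rw [abs_le]
        constructor <;> linarith [e1.1, e1.2, e2.1, e2.2, e3.1, e3.2, e4.1, e4.2]
      have h4 := covSize_sub_le (n := n) (by positivity) h3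
      nlinarith
    have hcl : h ^ 4 * (1 / 48) ^ 6 ≤ covMass n (cell a h) (cell b h) := by
      have h5 : ∀ y ∈ cell b h, h ^ 2 * (1 / 48) ^ 6 ≤
          ∫ x in cell a h, covSize n (tmk y - tmk x) ^ 6 := by
        intro y hy
        have := setIntegral_mono_on (f := fun _ => ((1 : ℝ) / 48) ^ 6) (integrable_const _)
          (integrable_covSize_left n (volume.restrict (cell a h)) y) (measurableSet_cell a h)
          fun x hx => pow_le_pow_left₀ (by norm_num) (hlow x hx y hy) 6
        rwa [setIntegral_const, measureReal_def, volume_cell a hh.le,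
          ENNReal.toReal_ofReal (by positivity), smul_eq_mul] at this
      have := setIntegral_mono_on (f := fun _ => h ^ 2 * ((1 : ℝ) / 48) ^ 6) (integrable_const _)
          (integrable_integral_covSize n (volume.restrict (cell a h)) (volume.restrict (cell b h)))
          (measurableSet_cell b h) h5
      rw [setIntegral_const, measureReal_def, volume_cell b hh.le,
          ENNReal.toReal_ofReal (by positivity), smul_eq_mul] at this
      refine le_trans (le_of_eq ?_) this
      ring
    have hEh : 1 ≤ (10 ^ 8 * energy n * h ^ 2) ^ 2 := one_le_pow₀ hh2
    refine hmain.trans ?_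
    -- A singular pair contributes at least an absolute constant to `E_n² ∫∫ ρ^6`, so the bounded
    -- covariance can be charged to it.
    have h6 : 1 ≤ 48 ^ 6 * 10 ^ 16 * (energy n ^ 2 * covMass n (cell a h) (cell b h)) := by
      have h7 : energy n ^ 2 * (h ^ 4 * (1 / 48) ^ 6) ≤
        energy n ^ 2 * covMass n (cell a h) (cell b h) := by gcongr
      have h8 : (10 ^ 8 * energy n * h ^ 2) ^ 2 =
        48 ^ 6 * 10 ^ 16 * (energy n ^ 2 * (h ^ 4 * (1 / 48) ^ 6)) := by ring
      rw [h8] at hEh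
      linarith
    have h9 : 0 ≤ C₂ * (energy n ^ 2 * covMass n (cell a h) (cell b h)) := by positivity
    nlinarith [mul_le_mul_of_nonneg_left h6 hC₁0]

theorem exists_norm_chaosSum_zeroMassLp_box_le : ∃ C : ℝ, 0 ≤ C ∧ ∀ n (hn : n ∈ sumTwoSq)
    (hn0 : n ≠ 0) (ε : ℝ), 0 < ε → ε ≤ 1 → ∀ S : Finset ℕ, (∀ q ∈ S, 6 ≤ q) →
    ‖chaosSum S (zeroMassLp hn hn0 ε (volume.restrict (box 0)))‖ ^ 2 ≤
      C * (energy n ^ 2 * sixthMoment n) := by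
  obtain ⟨C, hC0, hC⟩ := exists_abs_inner_chaosSum_zeroMassLp_le
  refine ⟨C * (9 ^ 6 * 64), by positivity, ?_⟩
  intro n hn hn0 ε hε hε1 S hS
  have hn' : (1 : ℝ) ≤ n := by exact_mod_cast Nat.one_le_iff_ne_zero.2 hn0
  have hsn : 1 ≤ √(n : ℝ) := Real.one_le_sqrt.2 hn'
  have hpi := Real.pi_gt_three
  set t : ℝ := 10000 * Real.pi * √n with ht
  have ht1 : 1 ≤ t := by
    have : 1 ≤ Real.pi * √n := by nlinarith
    rw [ht]; linarith
  -- The side `1/M` satisfies both scale conditions: `M ≥ t` makes the cells small, and `M ≤ 2t`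
  -- together with `10^8 E_n = (2t)²` keeps them from being too small.
  set M : ℕ := ⌈t⌉₊ with hMdef
  have hM0 : 0 < M := Nat.ceil_pos.2 (by linarith)
  have hM' : (0 : ℝ) < M := by exact_mod_cast hM0
  have hM1 : t ≤ M := Nat.le_ceil t
  have hM2 : (M : ℝ) ≤ 2 * t := by linarith [Nat.ceil_lt_add_one (by linarith : 0 ≤ t)]
  have hE : 10 ^ 8 * energy n = (2 * t) ^ 2 := by
    rw [ht, mul_pow, mul_pow, mul_pow, Real.sq_sqrt (by linarith), energy]
    ring
  have hpair := hC n hn hn0 ε hε hε1 S hS (1 / M) (by positivity)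
    (by rw [mul_one_div, div_le_one hM']; exact hM1)
    (by
      rw [hE, div_pow, one_pow, mul_one_div, one_le_div (by positivity)]
      exact pow_le_pow_left₀ hM'.le hM2 2)
  rw [norm_chaosSum_sq, zeroMassLp_box_eq_sum hn hn0 ε hM0, map_sum, sum_inner]
  simp_rw [inner_sum]
  calc _ ≤ ∑ k : Fin 2 → Fin M, ∑ k' : Fin 2 → Fin M, C * (energy n ^ 2 *
        covMass n (cell (gridCorner M k) (1 / M)) (cell (gridCorner M k') (1 / M))) :=
        Finset.sum_le_sum fun k _ => Finset.sum_le_sum fun k' _ =>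
          (le_abs_self _).trans (hpair _ _)
    _ = C * (energy n ^ 2 * covMass n (box 0) (box 0)) := by
        rw [covMass_box_eq_sum n hM0, Finset.sum_comm]
        simp_rw [Finset.mul_sum]
    _ ≤ C * (energy n ^ 2 * (9 ^ 6 * 64 * sixthMoment n)) := by
        rw [covMass_box]
        have := integral_covSize_pow_six_le n
        gcongr
    _ = _ := by ring

end Grid

/-! ### Planar trigonometric polynomials and resampling of one coefficient -/

section Regularity

open scoped RealInnerProductSpace

/-- The real linear map of the plane with columns `a` and `b`. -/
def realLin (a b : ℂ) : ℂ →L[ℝ] ℂ := Complex.reCLM.smulRight a + Complex.imCLM.smulRight b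

theorem realLin_apply (a b z : ℂ) : realLin a b z = z.re * a + z.im * b := by
  simp [realLin]

theorem det_realLin (a b : ℂ) : (realLin a b).det = (conj a * b).im := by
  rw [ContinuousLinearMap.det, ← LinearMap.det_toMatrix Complex.basisOneI, Matrix.det_fin_two]
  simp [LinearMap.toMatrix_apply, realLin_apply]
  ring

/-- The point of the plane with complex coordinate `z`. -/
def planePt (z : ℂ) : Fin 2 → ℝ := ![z.re, z.im]

theorem phase_planePt (l : Fin 2 → ℤ) (z : ℂ) :
    phase l (planePt z) = 2 * Real.pi * (l 0 * z.re + l 1 * z.im) := rfl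

theorem hasStrictFDerivAt_exp_phase (l : Fin 2 → ℤ) (z : ℂ) :
    HasStrictFDerivAt (fun z => Complex.exp (phase l (planePt z) * Complex.I))
      (realLin (2 * Real.pi * l 0 * Complex.I * Complex.exp (phase l (planePt z) * Complex.I))
        (2 * Real.pi * l 1 * Complex.I * Complex.exp (phase l (planePt z) * Complex.I))) z := by
  have h1 : HasStrictFDerivAt (fun z : ℂ => (phase l (planePt z) : ℂ) * Complex.I)
      (realLin (2 * Real.pi * l 0 * Complex.I) (2 * Real.pi * l 1 * Complex.I)) z := by
    have h2 : (fun z : ℂ => (phase l (planePt z) : ℂ) * Complex.I) =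
        realLin (2 * Real.pi * l 0 * Complex.I) (2 * Real.pi * l 1 * Complex.I) := by
      funext z
      rw [realLin_apply, phase_planePt]
      push_cast
      ring
    rw [h2]
    exact (realLin _ _).hasStrictFDerivAt
  refine ((Complex.hasStrictDerivAt_exp _).complexToReal_fderiv.comp z h1).congr_fderiv ?_
  ext v
  simp [realLin_apply]
  ring

/-- A trigonometric polynomial on the plane, with coefficients `c` and frequencies `σ`. -/
def trigPoly {ι : Type*} [Fintype ι] (c : ι → ℂ) (σ : ι → Fin 2 → ℤ) (z : ℂ) : ℂ :=
  ∑ l, c l * Complex.exp (phase (σ l) (planePt z) * Complex.I)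

/-- The partial derivatives of a trigonometric polynomial. -/
def trigPolyDeriv {ι : Type*} [Fintype ι] (c : ι → ℂ) (σ : ι → Fin 2 → ℤ) (i : Fin 2) (z : ℂ) : ℂ :=
  ∑ l, c l * (2 * Real.pi * σ l i * Complex.I * Complex.exp (phase (σ l) (planePt z) * Complex.I))

theorem hasStrictFDerivAt_trigPoly {ι : Type*} [Fintype ι] (c : ι → ℂ) (σ : ι → Fin 2 → ℤ)
    (z : ℂ) : HasStrictFDerivAt (trigPoly c σ)
      (realLin (trigPolyDeriv c σ 0 z) (trigPolyDeriv c σ 1 z)) z := by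
  refine (HasStrictFDerivAt.fun_sum fun l _ =>
    (hasStrictFDerivAt_exp_phase (σ l) z).const_mul (c l)).congr_fderiv ?_
  ext v
  simp [realLin_apply, trigPolyDeriv, Finset.mul_sum, ← Finset.sum_add_distrib]
  refine Finset.sum_congr rfl fun l _ => ?_
  ring

variable {n : ℕ}

theorem stdGaussian_complex_absolutelyContinuous : stdGaussian ℂ ≪ volume := by
  have he : Orthonormal ℝ ![(1 : ℂ), Complex.I] := by
    have := Complex.orthonormalBasisOneI.orthonormal
    rwa [Complex.coe_orthonormalBasisOneI] at this
  have h1 := measurePreserving_inner_orthonormal he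
  have h2 : (fun (x : ℂ) i => ⟪![(1 : ℂ), Complex.I] i, x⟫) = planePt := by
    funext x i
    fin_cases i <;> simp [planePt, Complex.inner]
  rw [h2] at h1
  have hγ : gaussianReal 0 1 ≪ (volume : Measure ℝ) := gaussianReal_le_volume.absolutelyContinuous
  refine Measure.AbsolutelyContinuous.mk fun N hN hN0 => ?_
  have h3 : MeasurePreserving (fun z : ℂ => (z.re, z.im)) (stdGaussian ℂ)
      ((gaussianReal 0 1).prod (gaussianReal 0 1)) :=
    (measurePreserving_finTwoArrow (gaussianReal 0 1)).comp h1
  have h4 : N = Complex.measurableEquivRealProd ⁻¹' (Complex.measurableEquivRealProd.symm ⁻¹' N) := by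
    rw [← Set.preimage_comp]; simp
  have h5 : MeasurableSet (Complex.measurableEquivRealProd.symm ⁻¹' N) :=
    Complex.measurableEquivRealProd.symm.measurable hN
  have h6 : (stdGaussian ℂ) (Complex.measurableEquivRealProd ⁻¹'
      (Complex.measurableEquivRealProd.symm ⁻¹' N)) = _ := h3.measure_preimage h5.nullMeasurableSet
  rw [h4, h6]
  refine (hγ.prod hγ) ?_
  rw [h4] at hN0
  have h7 := Complex.volume_preserving_equiv_real_prod.measure_preimage h5.nullMeasurableSet
  exact h7.symm.trans hN0

/-- Replacement of one coefficient. -/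
def resample (l₀ : freq n) (p : CoeffSpace n × ℂ) : CoeffSpace n :=
  WithLp.toLp 2 (Function.update p.1 l₀ p.2)

theorem continuous_resample (l₀ : freq n) : Continuous (resample l₀) :=
  (PiLp.continuous_toLp 2 _).comp
    (((PiLp.continuous_ofLp 2 _).comp continuous_fst).update l₀ continuous_snd)

theorem measurePreserving_resample (l₀ : freq n) : MeasurePreserving (resample l₀)
    ((stdGaussian (CoeffSpace n)).prod (stdGaussian ℂ)) (stdGaussian (CoeffSpace n)) := by
  refine measurePreserving_stdGaussian_of_charFun (continuous_resample l₀).measurable fun t => ?_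
  set t' : CoeffSpace n := WithLp.toLp 2 (Function.update t l₀ 0) with ht'
  have hsplit : ∀ (f g : freq n → ℂ) (z : ℂ), (∑ l, conj (Function.update f l₀ z l) * g l).re =
      (∑ l, conj (f l) * Function.update g l₀ 0 l).re + (conj z * g l₀).re := by
    intro f g z
    rw [← Complex.add_re]
    congr 1
    rw [← Finset.add_sum_erase _ _ (Finset.mem_univ l₀),
      ← Finset.add_sum_erase _ _ (Finset.mem_univ l₀)]
    simp only [Function.update_self, mul_zero, zero_add]
    rw [add_comm]
    congr 1
    refine Finset.sum_congr rfl fun l hl => ?_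
    rw [Function.update_of_ne (Finset.ne_of_mem_erase hl),
      Function.update_of_ne (Finset.ne_of_mem_erase hl)]
  have h1 : ∀ p : CoeffSpace n × ℂ, ⟪resample l₀ p, t⟫ = ⟪p.1, t'⟫ + ⟪p.2, t l₀⟫ := by
    intro p
    rw [real_inner_eq_re, real_inner_eq_re, Complex.inner, mul_comm (t l₀)]
    exact hsplit p.1 t p.2
  have h2 : ∀ p : CoeffSpace n × ℂ, Complex.exp ((⟪resample l₀ p, t⟫ : ℂ) * Complex.I) =
      Complex.exp ((⟪p.1, t'⟫ : ℂ) * Complex.I) * Complex.exp ((⟪p.2, t l₀⟫ : ℂ) * Complex.I) := by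
    intro p
    rw [← Complex.exp_add, ← add_mul, ← Complex.ofReal_add, ← h1]
  have h3 : ‖t‖ ^ 2 = ‖t'‖ ^ 2 + ‖t l₀‖ ^ 2 := by
    have e1 : ⟪resample l₀ (t, t l₀), t⟫ = ‖t‖ ^ 2 := by
      rw [← real_inner_self_eq_norm_sq]
      congr 1
      simp [resample]
    have e2 : ⟪t, t'⟫ = ‖t'‖ ^ 2 := by
      rw [EuclideanSpace.norm_sq_eq, real_inner_eq_re, Complex.re_sum]
      refine Finset.sum_congr rfl fun l _ => ?_
      by_cases hl : l = l₀
      · subst hl; simp [ht']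
      · simp only [ht', Function.update_of_ne hl]
        rw [← Complex.normSq_eq_norm_sq, ← Complex.normSq_eq_conj_mul_self]
        simp
    rw [← e1, h1, e2, real_inner_self_eq_norm_sq]
  simp_rw [h2]
  rw [integral_prod_mul (fun x : CoeffSpace n => Complex.exp ((⟪x, t'⟫ : ℂ) * Complex.I))
    (fun c : ℂ => Complex.exp ((⟪c, t l₀⟫ : ℂ) * Complex.I)), integral_exp_stdGaussian,
    integral_exp_stdGaussian, ← Complex.exp_add, h3]
  congr 1
  push_cast
  ring

theorem continuous_jet_torus (n : ℕ) :
    Continuous fun p : CoeffSpace n × Torus => jet n p.2 p.1 := by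
  refine (PiLp.continuous_toLp 2 _).comp (continuous_pi fun a => ?_)
  refine continuous_finsetSum _ fun l _ => ?_
  exact ((continuous_jetAt n a l).comp continuous_snd).mul (by fun_prop)

/-- The coefficients for which the wave has a degenerate zero. -/
def degenerateSet (n : ℕ) : Set (CoeffSpace n) :=
  {w | ∃ t : Torus, jet n t w 0 = 0 ∧ (conj (jet n t w 1) * jet n t w 2).im = 0}

/-- The set is the projection of a closed set along the compact torus. Closedness supplies the
measurability needed for Fubini. -/
theorem isClosed_degenerateSet (n : ℕ) : IsClosed (degenerateSet n) := by
  have hc : ∀ a, Continuous fun p : CoeffSpace n × Torus => jet n p.2 p.1 a := fun a =>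
    (by fun_prop : Continuous fun z : JetSpace => z a).comp (continuous_jet_torus n)
  have h1 : IsClosed {p : CoeffSpace n × Torus | jet n p.2 p.1 0 = 0 ∧
      (conj (jet n p.2 p.1 1) * jet n p.2 p.1 2).im = 0} :=
    (isClosed_eq (hc 0) continuous_const).inter (isClosed_eq (Complex.continuous_im.comp
      ((Complex.continuous_conj.comp (hc 1)).mul (hc 2))) continuous_const)
  have h2 := isClosedMap_fst_of_compactSpace (X := CoeffSpace n) (Y := Torus) _ h1
  convert h2 using 1
  ext w
  simp [degenerateSet]

theorem tmk_planePt_surjective (t : Torus) : ∃ z : ℂ, tmk (planePt z) = t := by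
  have h : ∀ i, ∃ r : ℝ, (r : UnitAddCircle) = t i := fun i => QuotientAddGroup.mk_surjective (t i)
  choose r hr using h
  refine ⟨⟨r 0, r 1⟩, ?_⟩
  funext i
  fin_cases i
  · exact hr 0
  · exact hr 1

end Regularity

/-! ### Almost surely no zero is degenerate -/

section Degenerate

variable {n : ℕ}

theorem trigPoly_eq_jet (hn : n ∈ sumTwoSq) (w : CoeffSpace n) (z : ℂ) :
    trigPoly w (fun l : freq n => (l : Fin 2 → ℤ)) z = √(numFreq n) * jet n (tmk (planePt z)) w 0 := by
  have hN : (√(numFreq n) : ℂ) ≠ 0 := by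
    exact_mod_cast (Real.sqrt_pos.2 (by exact_mod_cast numFreq_pos hn)).ne'
  rw [jet_apply, trigPoly, Finset.mul_sum]
  refine Finset.sum_congr rfl fun l _ => ?_
  rw [jetAt, mFourier_tmk]
  simp only [jetCoeff, Matrix.cons_val_zero]
  field_simp

theorem trigPolyDeriv_eq_jet (hn : n ∈ sumTwoSq) (hn0 : n ≠ 0) (w : CoeffSpace n) (i : Fin 2) (z : ℂ) :
    trigPolyDeriv w (fun l : freq n => (l : Fin 2 → ℤ)) i z =
      (√(numFreq n) * (Real.pi * √2 * √n) : ℝ) * jet n (tmk (planePt z)) w i.succ := by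
  have hN : (√(numFreq n) : ℂ) ≠ 0 := by
    exact_mod_cast (Real.sqrt_pos.2 (by exact_mod_cast numFreq_pos hn)).ne'
  have hn' : (√n : ℂ) ≠ 0 := by
    exact_mod_cast (Real.sqrt_pos.2 (by exact_mod_cast Nat.pos_of_ne_zero hn0)).ne'
  have h2 : (√2 : ℂ) * √2 = 2 := by
    rw [← Complex.ofReal_mul, Real.mul_self_sqrt (by norm_num)]; norm_num
  rw [jet_apply, trigPolyDeriv, Finset.mul_sum]
  refine Finset.sum_congr rfl fun l _ => ?_
  have hj : jetCoeff n i.succ (l : Fin 2 → ℤ) =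
      Complex.I * (√2 * (l : Fin 2 → ℤ) i / √n : ℝ) := by
    fin_cases i <;> rfl
  rw [jetAt, mFourier_tmk, hj]
  push_cast
  field_simp
  linear_combination (-(w l * ((l : Fin 2 → ℤ) i : ℂ))) * h2

/-- Multiplying by a unimodular character adds to the derivative a multiple of the value, which
vanishes at a zero; there the derivatives are merely rotated. -/
theorem trigPolyDeriv_sub {ι : Type*} [Fintype ι] (c : ι → ℂ) (σ : ι → Fin 2 → ℤ) (m : Fin 2 → ℤ)
    (i : Fin 2) {z : ℂ} (hz : trigPoly c σ z = 0) :
    trigPolyDeriv c (fun l => σ l - m) i z =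
      Complex.exp (-phase m (planePt z) * Complex.I) * trigPolyDeriv c σ i z := by
  have h : trigPolyDeriv c (fun l => σ l - m) i z =
      Complex.exp (-phase m (planePt z) * Complex.I) *
        (trigPolyDeriv c σ i z - 2 * Real.pi * m i * Complex.I * trigPoly c σ z) := by
    simp only [trigPolyDeriv, trigPoly]
    rw [Finset.mul_sum, ← Finset.sum_sub_distrib, Finset.mul_sum]
    refine Finset.sum_congr rfl fun l _ => ?_
    have he : Complex.exp (phase (σ l - m) (planePt z) * Complex.I) =
        Complex.exp (-phase m (planePt z) * Complex.I) *
          Complex.exp (phase (σ l) (planePt z) * Complex.I) := by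
      rw [← Complex.exp_add]
      congr 1
      simp only [phase, Pi.sub_apply]
      push_cast
      ring
    rw [he]
    simp only [Pi.sub_apply]
    push_cast
    ring
  rw [h, hz]; ring

theorem trigPoly_sub {ι : Type*} [Fintype ι] (c : ι → ℂ) (σ : ι → Fin 2 → ℤ) (m : Fin 2 → ℤ) (z : ℂ) :
    trigPoly c (fun l => σ l - m) z =
      Complex.exp (-phase m (planePt z) * Complex.I) * trigPoly c σ z := by
  simp only [trigPoly]
  rw [Finset.mul_sum]
  refine Finset.sum_congr rfl fun l _ => ?_
  have he : Complex.exp (phase (σ l - m) (planePt z) * Complex.I) =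
      Complex.exp (-phase m (planePt z) * Complex.I) *
        Complex.exp (phase (σ l) (planePt z) * Complex.I) := by
    rw [← Complex.exp_add]
    congr 1
    simp only [phase, Pi.sub_apply]
    push_cast
    ring
  rw [he]
  ring

/-- One coefficient is resampled with the others frozen. Dividing the wave by the corresponding
character turns that coefficient into an additive constant `c`, so a degenerate zero makes `c` a
critical value of a fixed smooth map `g` of the plane. By Sard these values are Lebesgue null, hence
null for the absolutely continuous law of `c`. -/
theorem ae_notMem_degenerateSet (hn : n ∈ sumTwoSq) (hn0 : n ≠ 0) :
    ∀ᵐ w ∂(stdGaussian (CoeffSpace n)), w ∉ degenerateSet n := by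
  classical
  obtain ⟨l₀, hl₀⟩ : (freq n).Nonempty := Finset.card_pos.1 (numFreq_pos hn)
  set m : freq n := ⟨l₀, hl₀⟩
  rw [ae_iff]
  simp only [not_not]
  change stdGaussian (CoeffSpace n) (degenerateSet n) = 0
  have hms := (isClosed_degenerateSet n).measurableSet
  rw [← (measurePreserving_resample m).measure_preimage hms.nullMeasurableSet,
    Measure.measure_prod_null ((continuous_resample m).measurable hms)]
  refine Filter.Eventually.of_forall fun w => ?_
  set σ : freq n → Fin 2 → ℤ := fun l => (l : Fin 2 → ℤ) with hσ
  set c₀ : freq n → ℂ := Function.update w m 0 with hc₀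
  -- After division by the character of `l₀`, the resampled wave is `c - g z`.
  set g : ℂ → ℂ := fun z => -trigPoly c₀ (fun l => σ l - l₀) z with hg
  set g' : ℂ → ℂ →L[ℝ] ℂ := fun z => -realLin (trigPolyDeriv c₀ (fun l => σ l - l₀) 0 z)
    (trigPolyDeriv c₀ (fun l => σ l - l₀) 1 z) with hg'
  have hgd : ∀ z, HasFDerivAt g (g' z) z := fun z =>
    (hasStrictFDerivAt_trigPoly _ _ z).hasFDerivAt.neg
  refine stdGaussian_complex_absolutelyContinuous (measure_mono_null (t := g '' {z | (g' z).det = 0}) ?_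
    (MeasureTheory.addHaar_image_eq_zero_of_det_fderivWithin_eq_zero volume
      (fun z _ => (hgd z).hasFDerivWithinAt) fun z hz => hz))
  rintro c ⟨t, ht0, htd⟩
  obtain ⟨z, rfl⟩ := tmk_planePt_surjective t
  set u : CoeffSpace n := resample m (w, c) with hu
  have hum : u m = c := by simp [hu, resample]
  have hul : ∀ l, l ≠ m → u l = c₀ l := fun l hl => by
    simp [hu, hc₀, resample, Function.update_of_ne hl]
  have hz0 : trigPoly u σ z = 0 := by rw [trigPoly_eq_jet hn, ht0, mul_zero]
  have hz1 : trigPoly u (fun l => σ l - l₀) z = 0 := by rw [trigPoly_sub, hz0, mul_zero]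
  have hmm : σ m - l₀ = 0 := sub_self _
  refine ⟨z, ?_, ?_⟩
  -- The frequency of the resampled coefficient becomes 0 after division, so it does not contribute
  -- to the derivatives.
  · have : trigPolyDeriv c₀ (fun l => σ l - l₀) = trigPolyDeriv u (fun l => σ l - l₀) := by
      funext i z
      refine Finset.sum_congr rfl fun l _ => ?_
      by_cases hl : l = m
      · subst hl; simp [hσ, m]
      · rw [hul l hl]
    change (-realLin _ _).det = 0
    have hneg : ∀ a b : ℂ, -realLin a b = realLin (-a) (-b) := fun a b => by
      ext v; simp [realLin_apply, add_comm]
    rw [hneg, det_realLin, this, trigPolyDeriv_sub u σ l₀ 0 hz0, trigPolyDeriv_sub u σ l₀ 1 hz0,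
      trigPolyDeriv_eq_jet hn hn0, trigPolyDeriv_eq_jet hn hn0]
    set e := Complex.exp (-phase l₀ (planePt z) * Complex.I)
    set k := √(numFreq n) * (Real.pi * √2 * √n)
    have : conj (-(e * (k * jet n (tmk (planePt z)) u (Fin.succ 0)))) *
        -(e * (k * jet n (tmk (planePt z)) u (Fin.succ 1))) =
        ((Complex.normSq e * k * k : ℝ) : ℂ) * (conj (jet n (tmk (planePt z)) u 1) *
          jet n (tmk (planePt z)) u 2) := by
      simp only [map_neg, map_mul, Complex.conj_ofReal, Complex.ofReal_mul,
        Complex.normSq_eq_conj_mul_self]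
      simp only [Fin.succ_zero_eq_one, Fin.succ_one_eq_two]
      ring
    rw [this, Complex.im_ofReal_mul, htd, mul_zero]
  · change -trigPoly c₀ _ z = c
    have h1 : trigPoly u (fun l => σ l - l₀) z = c + trigPoly c₀ (fun l => σ l - l₀) z := by
      simp only [trigPoly]
      rw [← Finset.add_sum_erase _ _ (Finset.mem_univ m),
        ← Finset.add_sum_erase _ _ (Finset.mem_univ m), ← add_assoc]
      congr 1
      · rw [hum, hmm]; simp [hc₀, phase]
      · refine Finset.sum_congr rfl fun l hl => ?_
        rw [hul l (Finset.ne_of_mem_erase hl)]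
    rw [hz1] at h1
    linear_combination h1

end Degenerate

/-! ### Squares, local inversion and the covering of the torus -/

section ZeroCount

open Filter Topology

/-- The closed square of half-side `ε`. -/
def closedSquare (ε : ℝ) : Set ℂ := {c | |c.re| ≤ ε ∧ |c.im| ≤ ε}

theorem closedSquare_eq_preimage (ε : ℝ) : closedSquare ε = Complex.measurableEquivRealProd ⁻¹'
    (Set.Icc (-ε) ε ×ˢ Set.Icc (-ε) ε) := by
  ext c
  simp [closedSquare, abs_le, Complex.measurableEquivRealProd_apply]
  tauto

theorem measurableSet_closedSquare (ε : ℝ) : MeasurableSet (closedSquare ε) := by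
  rw [closedSquare_eq_preimage]
  exact Complex.measurableEquivRealProd.measurable (measurableSet_Icc.prod measurableSet_Icc)

theorem volume_real_closedSquare {ε : ℝ} (hε : 0 ≤ ε) : volume.real (closedSquare ε) = (2 * ε) ^ 2 := by
  rw [Measure.real, closedSquare_eq_preimage, Complex.volume_preserving_equiv_real_prod.measure_preimage
    (measurableSet_Icc.prod measurableSet_Icc).nullMeasurableSet, Measure.volume_eq_prod,
    Measure.prod_prod, ENNReal.toReal_mul, Real.volume_Icc, ENNReal.toReal_ofReal (by linarith)]
  ring

theorem norm_le_of_mem_closedSquare {ε : ℝ} {c : ℂ} (hc : c ∈ closedSquare ε) : ‖c‖ ≤ 2 * ε :=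
  (Complex.norm_le_abs_re_add_abs_im c).trans (by linarith [hc.1, hc.2])

theorem exists_isOpen_injOn {g : ℂ → ℂ} {g' : ℂ →L[ℝ] ℂ} {z : ℂ} (hg : HasStrictFDerivAt g g' z)
    (hdet : g'.det ≠ 0) {V : Set ℂ} (hV : IsOpen V) (hz : z ∈ V) :
    ∃ U ⊆ V, IsOpen U ∧ z ∈ U ∧ Set.InjOn g U ∧ IsOpen (g '' U) := by
  have h1 : HasStrictFDerivAt g (g'.toContinuousLinearEquivOfDetNeZero hdet : ℂ →L[ℝ] ℂ) z := by
    rwa [ContinuousLinearMap.coe_toContinuousLinearEquivOfDetNeZero]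
  set e := h1.toOpenPartialHomeomorph g
  have he : (e : ℂ → ℂ) = g := h1.toOpenPartialHomeomorph_coe
  have hU : IsOpen (e.source ∩ V) := e.open_source.inter hV
  refine ⟨e.source ∩ V, Set.inter_subset_right, hU,
    ⟨h1.mem_toOpenPartialHomeomorph_source, hz⟩, ?_, ?_⟩
  · rw [← he]; exact e.injOn.mono Set.inter_subset_left
  · rw [← he]; exact e.isOpen_image_of_subset_source hU Set.inter_subset_left

/-- By the area formula, the density integrates over `U` to the normalised area of the square, which
is 1 once the injective image covers it. -/
theorem setIntegral_closedSquare_density {g : ℂ → ℂ} {g' : ℂ → ℂ →L[ℝ] ℂ} (hg : ∀ z, HasFDerivAt g (g' z) z)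
    {U : Set ℂ} (hU : MeasurableSet U) (hinj : Set.InjOn g U) {ε : ℝ} (hε : 0 < ε)
    (hsub : closedSquare ε ⊆ g '' U) :
    ∫ z in U, |(g' z).det| • (closedSquare ε).indicator (fun _ => ((2 * ε) ^ 2)⁻¹) (g z) = 1 := by
  rw [← integral_image_eq_integral_abs_det_fderiv_smul volume hU
    (fun z _ => (hg z).hasFDerivWithinAt) hinj, setIntegral_indicator (measurableSet_closedSquare ε),
    Set.inter_eq_self_of_subset_right hsub, setIntegral_const, volume_real_closedSquare hε.le, smul_eq_mul,
    mul_inv_cancel₀ (by positivity)]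

theorem isOpenMap_tmk : IsOpenMap tmk :=
  IsOpenMap.piMap (fun _ => QuotientAddGroup.isOpenMap_coe)
    (Eventually.of_forall fun _ => QuotientAddGroup.mk_surjective)

theorem continuous_planePt : Continuous planePt :=
  continuous_pi fun i => by fin_cases i; exacts [Complex.continuous_re, Complex.continuous_im]

theorem measurePreserving_planePt : MeasurePreserving planePt volume volume :=
  Complex.volume_preserving_equiv_pi

theorem isOpenMap_planePt : IsOpenMap planePt := by
  have h : ∀ x : Fin 2 → ℝ, planePt (⟨x 0, x 1⟩ : ℂ) = x := fun x => by
    funext i; fin_cases i <;> rfl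
  refine IsOpenMap.of_inverse (f' := fun x => Complex.equivRealProdCLM.symm (x 0, x 1))
    (by fun_prop) (fun x => ?_) fun z => ?_
  · exact h x
  · rfl

/-- The covering map from the complex plane to the torus. -/
def torusPt (z : ℂ) : Torus := tmk (planePt z)

theorem continuous_torusPt : Continuous torusPt := continuous_tmk.comp continuous_planePt

theorem isOpenMap_torusPt : IsOpenMap torusPt := isOpenMap_tmk.comp isOpenMap_planePt

/-- The open unit square centred at `z₀`. -/
def unitSquare (z₀ : ℂ) : Set ℂ := planePt ⁻¹' (Set.univ.pi fun i =>
  Set.Ioo (planePt z₀ i - 1 / 2) (planePt z₀ i + 1 / 2))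

theorem isOpen_unitSquare (z₀ : ℂ) : IsOpen (unitSquare z₀) :=
  (isOpen_set_pi Set.finite_univ fun _ _ => isOpen_Ioo).preimage continuous_planePt

theorem mem_unitSquare (z₀ : ℂ) : z₀ ∈ unitSquare z₀ := fun i _ => by
  constructor <;> linarith

theorem injOn_tmk_box (t : Fin 2 → ℝ) : Set.InjOn tmk (box t) := by
  intro x hx y hy hxy
  funext i
  have h1 : (x i : UnitAddCircle) = y i := congrFun hxy i
  exact congrArg Subtype.val ((AddCircle.equivIoc 1 (t i)).symm.injective
    (a₁ := ⟨x i, hx i trivial⟩) (a₂ := ⟨y i, hy i trivial⟩) h1)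

theorem setIntegral_torusPt_image {z₀ : ℂ} {U : Set ℂ} (hU : IsOpen U) (hsub : U ⊆ unitSquare z₀)
    {φ : Torus → ℝ} (hφ : Measurable φ) :
    ∫ t in torusPt '' U, φ t = ∫ z in U, φ (torusPt z) := by
  set a : Fin 2 → ℝ := fun i => planePt z₀ i - 1 / 2
  have hbox : U ⊆ planePt ⁻¹' box a := fun z hz i _ => by
    have := hsub hz i trivial
    constructor <;> simp only [a] <;> linarith [this.1, this.2]
  have hWm : MeasurableSet (torusPt '' U) := (isOpenMap_torusPt U hU).measurableSet
  have hmp : MeasurePreserving torusPt (volume.restrict (planePt ⁻¹' box a)) volume :=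
    (measurePreserving_tmk a).comp
      (measurePreserving_planePt.restrict_preimage (measurableSet_box a))
  have hinj : Set.InjOn torusPt (planePt ⁻¹' box a) := fun x hx y hy hxy =>
    Complex.measurableEquivPi.injective (injOn_tmk_box a hx hy hxy)
  have hpre : torusPt ⁻¹' (torusPt '' U) ∩ planePt ⁻¹' box a = U := by
    ext z
    refine ⟨?_, fun hz => ⟨⟨z, hz, rfl⟩, hbox hz⟩⟩
    rintro ⟨⟨y, hy, hyz⟩, hz⟩
    rwa [← hinj (hbox hy) hz hyz]
  rw [← integral_indicator hWm, ← hmp.map_eq, integral_map hmp.measurable.aemeasurable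
    (hφ.indicator hWm).aestronglyMeasurable]
  have h2 : ∀ z, (torusPt '' U).indicator φ (torusPt z) =
      (torusPt ⁻¹' (torusPt '' U)).indicator (fun z => φ (torusPt z)) z := fun z => rfl
  simp_rw [h2]
  rw [integral_indicator (hmp.measurable hWm), Measure.restrict_restrict (hmp.measurable hWm), hpre]

end ZeroCount

/-! ### The approximate count is exact for small `ε` -/

section ZeroCount

open Filter Topology

variable {n : ℕ}

/-- The density, on the torus, of the approximate zero count. -/
def torusDensity (n : ℕ) (ε : ℝ) (w : CoeffSpace n) (t : Torus) : ℝ :=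
  energy n / 2 * zeroKernel ε (jet n t w)

theorem measurable_torusDensity (n : ℕ) (ε : ℝ) (w : CoeffSpace n) :
    Measurable (torusDensity n ε w) :=
  ((measurable_zeroKernel ε).comp
    ((continuous_jet_torus n).measurable.comp measurable_prodMk_left)).const_mul _

theorem integrable_torusDensity (hn : n ∈ sumTwoSq) (hn0 : n ≠ 0) (ε : ℝ) (w : CoeffSpace n) :
    Integrable (torusDensity n ε w) volume := by
  have h := (integrable_zeroDensity hn hn0 ε w (volume.restrict (box 0)))
  rw [← (measurePreserving_tmk 0).map_eq]
  exact (integrable_map_measure (measurable_torusDensity n ε w).aestronglyMeasurable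
    (measurePreserving_tmk 0).measurable.aemeasurable).2 h

theorem zeroMass_box_eq (n : ℕ) (ε : ℝ) (w : CoeffSpace n) :
    zeroMass n ε (volume.restrict (box 0)) w = ∫ t, torusDensity n ε w t := by
  rw [← (measurePreserving_tmk 0).map_eq, integral_map
    (measurePreserving_tmk 0).measurable.aemeasurable
    (measurable_torusDensity n ε w).aestronglyMeasurable]
  rfl

/-- The zeros of the wave with given coefficients. -/
def zerosOf (n : ℕ) (w : CoeffSpace n) : Set Torus := {t | jet n t w 0 = 0}

theorem continuous_value (n : ℕ) (w : CoeffSpace n) : Continuous fun t : Torus => jet n t w 0 := by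
  have h : Continuous fun t : Torus => jet n t w :=
    Continuous.comp (g := fun p : CoeffSpace n × Torus => jet n p.2 p.1) (f := fun t => (w, t))
      (continuous_jet_torus n) (by fun_prop)
  have h0 : Continuous fun z : JetSpace => z 0 := by fun_prop
  exact h0.comp h

theorem isClosed_zerosOf (n : ℕ) (w : CoeffSpace n) : IsClosed (zerosOf n w) :=
  isClosed_eq (continuous_value n w) continuous_const

/-- The differential of the wave in the plane. -/
def waveDeriv (n : ℕ) (w : CoeffSpace n) (z : ℂ) : ℂ →L[ℝ] ℂ :=
  realLin ((Real.pi * √2 * √n : ℝ) * jet n (torusPt z) w 1)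
    ((Real.pi * √2 * √n : ℝ) * jet n (torusPt z) w 2)

theorem hasStrictFDerivAt_value (hn : n ∈ sumTwoSq) (hn0 : n ≠ 0) (w : CoeffSpace n) (z : ℂ) :
    HasStrictFDerivAt (fun z => jet n (torusPt z) w 0) (waveDeriv n w z) z := by
  have hN : (√(numFreq n) : ℂ) ≠ 0 := by
    exact_mod_cast (Real.sqrt_pos.2 (by exact_mod_cast numFreq_pos hn)).ne'
  have h := (hasStrictFDerivAt_trigPoly w (fun l : freq n => (l : Fin 2 → ℤ)) z).const_mul
    ((√(numFreq n) : ℂ)⁻¹)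
  have h1 : (fun z => jet n (torusPt z) w 0) =
      fun z => (√(numFreq n) : ℂ)⁻¹ * trigPoly w (fun l : freq n => (l : Fin 2 → ℤ)) z := by
    funext z
    rw [trigPoly_eq_jet hn, ← mul_assoc, inv_mul_cancel₀ hN, one_mul]
    rfl
  rw [h1]
  refine h.congr_fderiv ?_
  ext v
  simp only [smul_apply, realLin_apply, waveDeriv, smul_eq_mul,
    trigPolyDeriv_eq_jet hn hn0, Fin.succ_zero_eq_one, Fin.succ_one_eq_two, torusPt]
  push_cast
  field_simp

theorem det_waveDeriv (n : ℕ) (w : CoeffSpace n) (z : ℂ) : (waveDeriv n w z).det =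
    energy n / 2 * (conj (jet n (torusPt z) w 1) * jet n (torusPt z) w 2).im := by
  rw [waveDeriv, det_realLin]
  have h : conj (((Real.pi * √2 * √n : ℝ) : ℂ) * jet n (torusPt z) w 1) *
      (((Real.pi * √2 * √n : ℝ) : ℂ) * jet n (torusPt z) w 2) =
      ((energy n / 2 : ℝ) : ℂ) * (conj (jet n (torusPt z) w 1) * jet n (torusPt z) w 2) := by
    have h1 : energy n / 2 = (Real.pi * √2 * √n) * (Real.pi * √2 * √n) := by
      have h2 : √2 * √2 = 2 := Real.mul_self_sqrt (by norm_num)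
      have h3 : √(n : ℝ) * √n = n := Real.mul_self_sqrt (by positivity)
      rw [energy]
      linear_combination (-(Real.pi ^ 2 * √n * √n)) * h2 - 2 * Real.pi ^ 2 * h3
    rw [h1, map_mul, Complex.conj_ofReal]
    push_cast
    ring
  rw [h, Complex.im_ofReal_mul]

theorem torusDensity_torusPt (n : ℕ) (ε : ℝ) (w : CoeffSpace n) (z : ℂ) :
    torusDensity n ε w (torusPt z) = |(waveDeriv n w z).det| •
      (closedSquare ε).indicator (fun _ => ((2 * ε) ^ 2)⁻¹) (jet n (torusPt z) w 0) := by
  rw [det_waveDeriv, abs_mul, abs_of_nonneg (div_nonneg (energy_nonneg n) zero_le_two),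
    torusDensity, zeroKernel]
  split_ifs with h
  · rw [Set.indicator_of_mem (show _ ∈ closedSquare ε from h), smul_eq_mul]
    ring
  · rw [Set.indicator_of_notMem (show _ ∉ closedSquare ε from h), smul_zero, mul_zero]

/-- A nondegenerate zero has a neighbourhood on which the wave is a diffeomorphism onto a
neighbourhood of 0; there the zero is unique and carries approximate mass exactly 1 for small `ε`.
-/
theorem exists_zero_nhds (hn : n ∈ sumTwoSq) (hn0 : n ≠ 0) {w : CoeffSpace n}
    (hw : w ∉ degenerateSet n) {p : Torus} (hp : p ∈ zerosOf n w) {O : Set Torus} (hO : IsOpen O)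
    (hpO : p ∈ O) : ∃ W ⊆ O, IsOpen W ∧ p ∈ W ∧ (∀ t ∈ W, t ∈ zerosOf n w → t = p) ∧
      ∀ᶠ ε in 𝓝[>] (0 : ℝ), ∫ t in W, torusDensity n ε w t = 1 := by
  obtain ⟨z₀, hz₀⟩ := tmk_planePt_surjective p
  change torusPt z₀ = p at hz₀
  subst hz₀
  have hdet : (waveDeriv n w z₀).det ≠ 0 := by
    rw [det_waveDeriv]
    refine mul_ne_zero (div_ne_zero ?_ two_ne_zero) fun h => hw ⟨_, hp, h⟩
    have : (n : ℝ) ≠ 0 := by exact_mod_cast hn0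
    rw [energy]
    positivity
  obtain ⟨U, hUV, hU, hzU, hinj, hopen⟩ := exists_isOpen_injOn (hasStrictFDerivAt_value hn hn0 w z₀)
    hdet ((hO.preimage continuous_torusPt).inter (isOpen_unitSquare z₀)) ⟨hpO, mem_unitSquare z₀⟩
  refine ⟨torusPt '' U, ?_, isOpenMap_torusPt U hU, ⟨z₀, hzU, rfl⟩, ?_, ?_⟩
  · rintro _ ⟨z, hz, rfl⟩
    exact (hUV hz).1
  · rintro _ ⟨z, hz, rfl⟩ hz0
    rw [hinj hz hzU (hz0.trans hp.symm)]
  · have h0 : (fun z => jet n (torusPt z) w 0) '' U ∈ 𝓝 (0 : ℂ) :=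
      hopen.mem_nhds ⟨z₀, hzU, hp⟩
    obtain ⟨δ, hδ, hball⟩ := Metric.mem_nhds_iff.1 h0
    -- The square of half-side `ε` lies within distance `2ε` of 0, hence the threshold `δ/2`.
    filter_upwards [Ioo_mem_nhdsGT (half_pos hδ)] with ε hε
    rw [setIntegral_torusPt_image hU (fun z hz => (hUV hz).2) (measurable_torusDensity n ε w)]
    simp_rw [torusDensity_torusPt]
    refine setIntegral_closedSquare_density (fun z => (hasStrictFDerivAt_value hn hn0 w z).hasFDerivAt)
      hU.measurableSet hinj hε.1 fun c hc => hball ?_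
    rw [mem_ball_zero_iff]
    linarith [norm_le_of_mem_closedSquare hc, hε.2]

theorem finite_zerosOf (hn : n ∈ sumTwoSq) (hn0 : n ≠ 0) {w : CoeffSpace n}
    (hw : w ∉ degenerateSet n) : (zerosOf n w).Finite := by
  have h : ∀ p ∈ zerosOf n w, ∃ W : Set Torus, W ∈ 𝓝 p ∧ ∀ t ∈ W, t ∈ zerosOf n w → t = p := by
    intro p hp
    obtain ⟨W, -, hW, hpW, huniq, -⟩ := exists_zero_nhds hn hn0 hw hp isOpen_univ trivial
    exact ⟨W, hW.mem_nhds hpW, huniq⟩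
  choose! W hW huniq using h
  obtain ⟨s, hs, hcov⟩ := (isClosed_zerosOf n w).isCompact.elim_nhds_subcover W hW
  refine s.finite_toSet.subset fun t ht => ?_
  obtain ⟨p, hps, htp⟩ := Set.mem_iUnion₂.1 (hcov ht)
  rw [huniq p (hs p hps) t htp ht]
  exact hps

/-- Disjoint neighbourhoods of the finitely many zeros contribute 1 each. Off their union the wave
is bounded below by compactness, so the density vanishes there once `ε` is small. -/
theorem eventually_zeroMass_eq (hn : n ∈ sumTwoSq) (hn0 : n ≠ 0) {w : CoeffSpace n}
    (hw : w ∉ degenerateSet n) : ∀ᶠ ε in 𝓝[>] (0 : ℝ),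
      zeroMass n ε (volume.restrict (box 0)) w = (zerosOf n w).ncard := by
  have hfin := finite_zerosOf hn hn0 hw
  obtain ⟨O, hO, hdisj⟩ := hfin.t2_separation
  have h := fun p (hp : p ∈ zerosOf n w) => exists_zero_nhds hn hn0 hw hp (hO p).2 (hO p).1
  choose! W hWO hW hpW huniq hint using h
  set s := hfin.toFinset with hs
  have hmem : ∀ p, p ∈ s ↔ p ∈ zerosOf n w := fun p => hfin.mem_toFinset
  have hVo : IsOpen (⋃ p ∈ s, W p) :=
    isOpen_biUnion fun p hp => hW p ((hmem p).1 hp)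
  have hpos : ∃ δ > 0, ∀ t ∈ (⋃ p ∈ s, W p)ᶜ, δ ≤ ‖jet n t w 0‖ := by
    rcases (⋃ p ∈ s, W p)ᶜ.eq_empty_or_nonempty with he | hne
    · exact ⟨1, one_pos, fun t ht => by rw [he] at ht; exact ht.elim⟩
    · obtain ⟨t₀, ht₀, hmin⟩ := hVo.isClosed_compl.isCompact.exists_isMinOn hne
        (continuous_value n w).norm.continuousOn
      refine ⟨‖jet n t₀ w 0‖, norm_pos_iff.2 fun h0 => ht₀ ?_, fun t ht => hmin ht⟩
      exact Set.mem_biUnion ((hmem t₀).2 h0) (hpW t₀ h0)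
  obtain ⟨δ, hδ, hlow⟩ := hpos
  have hall : ∀ᶠ ε in 𝓝[>] (0 : ℝ), ∀ p ∈ s, ∫ t in W p, torusDensity n ε w t = 1 :=
    (Filter.eventually_all_finset s).2 fun p hp => hint p ((hmem p).1 hp)
  filter_upwards [hall, Ioo_mem_nhdsGT (half_pos hδ)] with ε h1 hε
  have hzero : ∀ t, t ∉ (⋃ p ∈ s, W p) → torusDensity n ε w t = 0 := by
    intro t ht
    rw [torusDensity, zeroKernel, if_neg, mul_zero]
    intro hc
    have := norm_le_of_mem_closedSquare (show jet n t w 0 ∈ closedSquare ε from hc)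
    linarith [hlow t ht, hε.2]
  rw [zeroMass_box_eq, ← setIntegral_eq_integral_of_forall_compl_eq_zero hzero,
    integral_biUnion_finset s (fun p hp => (hW p ((hmem p).1 hp)).measurableSet) ?_
      (fun p _ => (integrable_torusDensity hn hn0 ε w).integrableOn),
    Finset.sum_congr rfl h1, Finset.sum_const, nsmul_one, Set.ncard_eq_toFinset_card _ hfin]
  intro p hp q hq hpq
  have hp' := (hmem p).1 hp
  have hq' := (hmem q).1 hq
  exact (hdisj hp' hq' hpq).mono (hWO p hp') (hWO q hq')

end ZeroCount

/-! ### Passage to the limit `ε → 0` -/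

section Limit

open Filter Topology
open scoped RealInnerProductSpace

/-- `F k - f` is supported where the two differ, so `g` may be cut off to that set. The cut-off
tends to 0 in `L²` by dominated convergence, while `F k - f` stays bounded. -/
theorem tendsto_inner_of_eventually_eq {α : Type*} [MeasurableSpace α] {μ : Measure α}
    {F : ℕ → Lp ℝ 2 μ} {f : Lp ℝ 2 μ} {B : ℝ} (hB : ∀ k, ‖F k‖ ≤ B)
    (h : ∀ᵐ x ∂μ, ∀ᶠ k in atTop, F k x = f x) (g : Lp ℝ 2 μ) :
    Tendsto (fun k => ⟪F k, g⟫) atTop (𝓝 ⟪f, g⟫) := by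
  set A : ℕ → Set α := fun k => {x | F k x = f x}ᶜ with hA
  have hAm : ∀ k, MeasurableSet (A k) := fun k =>
    (measurableSet_eq_fun (Lp.stronglyMeasurable (F k)).measurable
      (Lp.stronglyMeasurable f).measurable).compl
  have hg : MemLp g 2 μ := Lp.memLp g
  set G : ℕ → Lp ℝ 2 μ := fun k => (hg.indicator (hAm k)).toLp ((A k).indicator g) with hG
  have hGc : ∀ k, G k =ᵐ[μ] (A k).indicator g := fun k => (hg.indicator (hAm k)).coeFn_toLp
  have h1 : ∀ k, ⟪F k - f, g⟫ = ⟪F k - f, G k⟫ := by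
    intro k
    rw [inner_eq_integral (Lp.coeFn_sub (F k) f), inner_eq_integral (Lp.coeFn_sub (F k) f)]
    refine integral_congr_ae ?_
    filter_upwards [hGc k] with x hGx
    rw [hGx]
    by_cases hx : F k x = f x
    · simp [hx]
    · simp [hA, hx]
  have h2 : Tendsto (fun k => ‖G k‖ ^ 2) atTop (𝓝 0) := by
    have e1 : ∀ k, ‖G k‖ ^ 2 = ∫ x, (A k).indicator (fun x => g x ^ 2) x ∂μ := by
      intro k
      rw [← real_inner_self_eq_norm_sq, inner_eq_integral (hGc k)]
      refine integral_congr_ae ?_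
      filter_upwards [hGc k] with x hGx
      rw [hGx]
      by_cases hx : x ∈ A k
      · simp [hx, sq]
      · simp [hx]
    simp_rw [e1]
    have e2 : (0 : ℝ) = ∫ _ : α, (0 : ℝ) ∂μ := by simp
    rw [e2]
    refine tendsto_integral_of_dominated_convergence (fun x => g x ^ 2)
      (fun k => (hg.integrable_sq.aestronglyMeasurable.indicator (hAm k))) hg.integrable_sq
      (fun k => Eventually.of_forall fun x => ?_) ?_
    · by_cases hx : x ∈ A k
      · simp [hx]
      · simp [hx, sq_nonneg]
    · filter_upwards [h] with x hx
      refine tendsto_const_nhds.congr' ?_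
      filter_upwards [hx] with k hk
      simp [hA, hk]
  have h3 : Tendsto (fun k => ‖G k‖) atTop (𝓝 0) := by
    have := h2.sqrt
    simpa [Real.sqrt_sq (norm_nonneg _)] using this
  rw [tendsto_iff_norm_sub_tendsto_zero]
  refine squeeze_zero (fun k => norm_nonneg _) (fun k => ?_)
    (by simpa using h3.const_mul (B + ‖f‖))
  rw [← inner_sub_left, h1]
  refine (norm_inner_le_norm _ _).trans (mul_le_mul_of_nonneg_right ?_ (norm_nonneg _))
  exact (norm_sub_le _ _).trans (by linarith [hB k])

variable {n : ℕ}

/-- The number of zeros of the wave with given coefficients. -/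
def zeroCount (n : ℕ) (w : CoeffSpace n) : ℝ := (zerosOf n w).ncard

/-- A sequence of scales decreasing to zero. -/
def scale (k : ℕ) : ℝ := 1 / ((k : ℝ) + 1)

theorem scale_pos (k : ℕ) : 0 < scale k := Nat.one_div_pos_of_nat

theorem scale_le_one (k : ℕ) : scale k ≤ 1 := by
  rw [scale, div_le_one (by positivity)]
  linarith [(Nat.cast_nonneg k : (0 : ℝ) ≤ k)]

theorem tendsto_scale : Tendsto scale atTop (𝓝[>] 0) :=
  tendsto_nhdsWithin_iff.2 ⟨tendsto_one_div_add_atTop_nhds_zero_nat,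
    Eventually.of_forall scale_pos⟩

theorem ae_eventually_zeroMassLp_eq (hn : n ∈ sumTwoSq) (hn0 : n ≠ 0) :
    ∀ᵐ w ∂(stdGaussian (CoeffSpace n)), ∀ᶠ k in atTop,
      zeroMassLp hn hn0 (scale k) (volume.restrict (box 0)) w = zeroCount n w := by
  filter_upwards [ae_notMem_degenerateSet hn hn0, ae_all_iff.2 fun k =>
    coeFn_zeroMassLp hn hn0 (scale k) (volume.restrict (box 0))] with w hw h
  filter_upwards [tendsto_scale.eventually (eventually_zeroMass_eq hn hn0 hw)] with k hk
  rw [h k, hk, zeroCount]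

theorem exists_norm_zeroMassLp_box_le (hn : n ∈ sumTwoSq) (hn0 : n ≠ 0) :
    ∃ B : ℝ, ∀ k, ‖zeroMassLp hn hn0 (scale k) (volume.restrict (box 0))‖ ≤ B := by
  obtain ⟨C, hC0, hC⟩ := exists_lintegral_sq_cell_le
  set M : ℕ := ⌈4 * Real.pi * √n⌉₊ + 1 with hM
  have hM0 : 0 < M := Nat.succ_pos _
  have hM' : (0 : ℝ) < M := by exact_mod_cast hM0
  have hle : 4 * Real.pi * √n * (1 / M) ≤ 1 := by
    rw [mul_one_div, div_le_one hM', hM]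
    push_cast
    linarith [Nat.le_ceil (4 * Real.pi * √n)]
  refine ⟨∑ _k : Fin 2 → Fin M, √C, fun k => ?_⟩
  rw [zeroMassLp_box_eq_sum hn hn0 _ hM0]
  refine (norm_sum_le _ _).trans (Finset.sum_le_sum fun j _ => Real.le_sqrt_of_sq_le ?_)
  exact norm_zeroMassLp_sq_le hn hn0 hC0 _
    (hC n hn hn0 _ _ (by positivity) hle _ (scale_pos k) (scale_le_one k))

/-- Fatou, with norms bounded uniformly in the scale by summing the cell bounds. This bound may
depend on `n`. -/
theorem memLp_zeroCount (hn : n ∈ sumTwoSq) (hn0 : n ≠ 0) :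
    MemLp (zeroCount n) 2 (stdGaussian (CoeffSpace n)) := by
  obtain ⟨B, hB⟩ := exists_norm_zeroMassLp_box_le hn hn0
  have hlim : ∀ᵐ w ∂(stdGaussian (CoeffSpace n)), Tendsto (fun k =>
      zeroMassLp hn hn0 (scale k) (volume.restrict (box 0)) w) atTop (𝓝 (zeroCount n w)) := by
    filter_upwards [ae_eventually_zeroMassLp_eq hn hn0] with w hw
    refine tendsto_const_nhds.congr' ?_
    filter_upwards [hw] with k hk using hk.symm
  have hm : ∀ k, AEStronglyMeasurable (zeroMassLp hn hn0 (scale k) (volume.restrict (box 0)))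
      (stdGaussian (CoeffSpace n)) := fun k => Lp.aestronglyMeasurable _
  refine ⟨aestronglyMeasurable_of_tendsto_ae atTop hm hlim, ?_⟩
  refine (Lp.eLpNorm_lim_le_liminf_eLpNorm hm _ hlim).trans_lt ?_
  refine lt_of_le_of_lt (liminf_le_of_frequently_le' (Frequently.of_forall fun k => ?_))
    (ENNReal.ofReal_lt_top (r := B))
  rw [← ENNReal.ofReal_toReal (Lp.eLpNorm_ne_top _), ← Lp.norm_def]
  exact ENNReal.ofReal_le_ofReal (hB k)

theorem exists_norm_chaosSum_zeroCount_le : ∃ C : ℝ, 0 ≤ C ∧ ∀ n (hn : n ∈ sumTwoSq)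
    (hn0 : n ≠ 0) (S : Finset ℕ), (∀ q ∈ S, 6 ≤ q) →
    ‖chaosSum S ((memLp_zeroCount hn hn0).toLp (zeroCount n))‖ ^ 2 ≤
      C * (energy n ^ 2 * sixthMoment n) := by
  obtain ⟨C, hC0, hC⟩ := exists_norm_chaosSum_zeroMassLp_box_le
  refine ⟨C, hC0, fun n hn hn0 S hS => ?_⟩
  set f := (memLp_zeroCount hn hn0).toLp (zeroCount n)
  set F : ℕ → Lp ℝ 2 (stdGaussian (CoeffSpace n)) := fun k =>
    zeroMassLp hn hn0 (scale k) (volume.restrict (box 0))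
  set K := C * (energy n ^ 2 * sixthMoment n)
  obtain ⟨B, hB⟩ := exists_norm_zeroMassLp_box_le hn hn0
  -- Testing against the projection applied twice makes the limit equal to `‖chaosSum S f‖²`; the
  -- approximants obey the bound `√K ‖chaosSum S f‖`, and dividing gives the estimate.
  have hlim := tendsto_inner_of_eventually_eq (F := F) (f := f) hB (by
    filter_upwards [ae_eventually_zeroMassLp_eq hn hn0,
      (memLp_zeroCount hn hn0).coeFn_toLp] with w h1 h2
    filter_upwards [h1] with k hk
    exact hk.trans h2.symm) (chaosSum S (chaosSum S f))
  rw [← inner_chaosSum_comm, real_inner_self_eq_norm_sq] at hlim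
  have hK : ∀ k, ‖chaosSum S (F k)‖ ≤ √K := fun k =>
    Real.le_sqrt_of_sq_le (hC n hn hn0 _ (scale_pos k) (scale_le_one k) S hS)
  have hK0 : 0 ≤ K := (sq_nonneg _).trans (hC n hn hn0 _ (scale_pos 0) (scale_le_one 0) S hS)
  have h1 : ‖chaosSum S f‖ ^ 2 ≤ √K * ‖chaosSum S f‖ := by
    refine le_of_tendsto hlim (Eventually.of_forall fun k => ?_)
    rw [← inner_chaosSum_comm]
    exact (real_inner_le_norm _ _).trans (mul_le_mul_of_nonneg_right (hK k) (norm_nonneg _))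
  have h2 : ‖chaosSum S f‖ ≤ √K := by
    rcases (norm_nonneg (chaosSum S f)).eq_or_lt with h | h
    · rw [← h]; exact Real.sqrt_nonneg K
    · rw [sq] at h1
      exact le_of_mul_le_mul_right h1 h
  calc _ ≤ √K ^ 2 := pow_le_pow_left₀ (norm_nonneg _) h2 2
    _ = K := Real.sq_sqrt hK0

theorem sum_norm_gaussProj_sq {E : Type*} [NormedAddCommGroup E] [InnerProductSpace ℝ E]
    [FiniteDimensional ℝ E] [MeasurableSpace E] [BorelSpace E] (S : Finset ℕ)
    (f : Lp ℝ 2 (stdGaussian E)) : ∑ q ∈ S, ‖gaussProj q f‖ ^ 2 = ‖chaosSum S f‖ ^ 2 := by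
  rw [norm_chaosSum_sq, chaosSum_apply, sum_inner]
  simp_rw [inner_gaussProj_self]

end Limit

/-! ### Return to the random wave on the probability space -/

section Transfer

variable {Ω : Type*} [MeasurableSpace Ω] {P : Measure Ω} {v : (Fin 2 → ℤ) → Ω → ℂ} {n : ℕ}

theorem zeroSet_eq_zerosOf (v : (Fin 2 → ℤ) → Ω → ℂ) (n : ℕ) (ω : Ω) :
    zeroSet v n ω = zerosOf n (coeffVec v n ω) := by
  ext x
  have h : jet n x (coeffVec v n ω) 0 = wave v n ω x := by
    rw [jet_apply, wave, Finset.mul_sum, ← Finset.sum_coe_sort (freq n)]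
    refine Finset.sum_congr rfl fun l _ => ?_
    simp only [jetAt, jetCoeff, Matrix.cons_val_zero, coeffVec]
    ring
  change wave v n ω x = 0 ↔ jet n x (coeffVec v n ω) 0 = 0
  rw [h]

theorem IsGaussianFamily.ae_finite_zeroSet [IsProbabilityMeasure P] (hv : IsGaussianFamily P v)
    (hn : n ∈ sumTwoSq) (hn0 : n ≠ 0) : ∀ᵐ ω ∂P, (zeroSet v n ω).Finite := by
  filter_upwards [(hv.measurePreserving_coeffVec n).quasiMeasurePreserving.ae
    (ae_notMem_degenerateSet hn hn0)] with ω hω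
  rw [zeroSet_eq_zerosOf]
  exact finite_zerosOf hn hn0 hω

theorem numZeros_eq_comp (v : (Fin 2 → ℤ) → Ω → ℂ) (n : ℕ) :
    numZeros v n = zeroCount n ∘ coeffVec v n := by
  funext ω
  rw [numZeros, zeroSet_eq_zerosOf]
  rfl

theorem IsGaussianFamily.memLp_numZeros [IsProbabilityMeasure P] (hv : IsGaussianFamily P v)
    (hn : n ∈ sumTwoSq) (hn0 : n ≠ 0) : MemLp (numZeros v n) 2 P := by
  rw [numZeros_eq_comp]
  exact (memLp_zeroCount hn hn0).comp_measurePreserving (hv.measurePreserving_coeffVec n)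

theorem IsGaussianFamily.toLp_numZeros [IsProbabilityMeasure P] (hv : IsGaussianFamily P v)
    (hn : n ∈ sumTwoSq) (hn0 : n ≠ 0) (hI : MemLp (numZeros v n) 2 P) :
    hI.toLp (numZeros v n) = pull (hv.measurePreserving_coeffVec n)
      ((memLp_zeroCount hn hn0).toLp (zeroCount n)) := by
  have hc := hv.measurePreserving_coeffVec n
  refine Lp.ext (hI.coeFn_toLp.trans ?_)
  refine Filter.EventuallyEq.trans ?_ (coeFn_pull hc _).symm
  rw [numZeros_eq_comp]
  exact hc.quasiMeasurePreserving.ae_eq_comp (memLp_zeroCount hn hn0).coeFn_toLp.symm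

theorem IsGaussianFamily.sum_variance_chaosProj_le [IsProbabilityMeasure P]
    (hv : IsGaussianFamily P v) (hn : n ∈ sumTwoSq) (hn0 : n ≠ 0)
    (hI : MemLp (numZeros v n) 2 P) {K : ℝ}
    (hK : ∀ S : Finset ℕ, (∀ q ∈ S, 6 ≤ q) →
      ‖chaosSum S ((memLp_zeroCount hn hn0).toLp (zeroCount n))‖ ^ 2 ≤ K) (m : ℕ) :
    ∑ q ∈ Finset.range m,
      variance (chaosProj P v (2 * (q + 3)) (hI.toLp (numZeros v n))) P ≤ K := by
  have hinj : Set.InjOn (fun q : ℕ => 2 * (q + 3)) (Finset.range m) := fun a _ b _ h => by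
    have : 2 * (a + 3) = 2 * (b + 3) := h
    omega
  calc _ ≤ ∑ q ∈ Finset.range m,
        ‖gaussProj (2 * (q + 3)) ((memLp_zeroCount hn hn0).toLp (zeroCount n))‖ ^ 2 := by
        refine Finset.sum_le_sum fun q _ => ?_
        rw [hv.toLp_numZeros hn hn0]
        exact hv.variance_chaosProj_le n _ _
    _ = ‖chaosSum ((Finset.range m).image fun q => 2 * (q + 3))
          ((memLp_zeroCount hn hn0).toLp (zeroCount n))‖ ^ 2 := by
        rw [← sum_norm_gaussProj_sq, Finset.sum_image hinj]
    _ ≤ K := hK _ fun q hq => by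
        obtain ⟨a, -, rfl⟩ := Finset.mem_image.1 hq
        omega

/-- The only frequency of order 0 is 0, so the wave is the constant `v 0`, almost surely nonzero. -/
theorem IsGaussianFamily.ae_zeroSet_zero [IsProbabilityMeasure P] (hv : IsGaussianFamily P v) :
    ∀ᵐ ω ∂P, zeroSet v 0 ω = ∅ := by
  have h1 : ∀ᵐ x ∂(P.map fun ω => (v 0 ω).re), x ≠ 0 := by
    rw [hv.law_re 0]
    have := nullSingletonClass_gaussianReal (μ := 0) one_ne_zero
    exact compl_mem_ae_iff.2 (measure_singleton 0)
  filter_upwards [ae_of_ae_map (Complex.measurable_re.comp (hv.measurable 0)).aemeasurable h1]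
    with ω hω
  have hf : freq 0 = {0} := by
    ext l
    rw [mem_freq, Finset.mem_singleton]
    constructor
    · intro h
      push_cast at h
      funext i
      fin_cases i
      · exact pow_eq_zero_iff two_ne_zero |>.1 (le_antisymm (show l 0 ^ 2 ≤ 0 by linarith [sq_nonneg (l 1)]) (sq_nonneg _))
      · exact pow_eq_zero_iff two_ne_zero |>.1 (le_antisymm (show l 1 ^ 2 ≤ 0 by linarith [sq_nonneg (l 0)]) (sq_nonneg _))
    · rintro rfl
      simp
  refine Set.eq_empty_of_forall_notMem fun x hx => hω ?_
  have hx' : wave v 0 ω x = 0 := hx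
  rw [wave, numFreq, hf] at hx'
  simp [UnitAddTorus.mFourier_zero] at hx'
  simp [hx']

end Transfer

end ArithWave

end

theorem proposition3p2 :
    ∃ (C : ℝ) (K : ℕ), ∀ (Ω : Type*) [MeasurableSpace Ω] (P : Measure Ω) [IsProbabilityMeasure P]
      (v : (Fin 2 → ℤ) → Ω → ℂ), ArithWave.IsGaussianFamily P v →
      ∀ n ∈ ArithWave.sumTwoSq,
        (∀ᵐ ω ∂P, (ArithWave.zeroSet v n ω).Finite) ∧
        ∃ hI : MemLp (ArithWave.numZeros v n) 2 P,
          Summable (fun q : ℕ =>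
            variance (ArithWave.chaosProj P v (2 * (q + 3)) hI.toLp) P) ∧
          (K ≤ ArithWave.numFreq n →
            ∑' q : ℕ, variance (ArithWave.chaosProj P v (2 * (q + 3)) hI.toLp) P ≤
              C * (ArithWave.energy n ^ 2 * ArithWave.sixthMoment n)) := by
  obtain ⟨C, hC0, hC⟩ := ArithWave.exists_norm_chaosSum_zeroCount_le
  -- The bound is uniform over all orders, so the threshold on `𝒩_n` can be 0.
  refine ⟨C, 0, fun Ω _ P _ v hv n hn => ?_⟩
  -- Order 0 is separate because the gradient is normalised by `√n`; there the number of zeros and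
  -- all its chaos components vanish.
  by_cases hn0 : n = 0
  · subst hn0
    refine ⟨hv.ae_zeroSet_zero.mono fun ω hω => by rw [hω]; exact Set.finite_empty, ?_⟩
    have h0 : ArithWave.numZeros v 0 =ᵐ[P] 0 := hv.ae_zeroSet_zero.mono fun ω hω => by
      simp [ArithWave.numZeros, hω]
    have hI : MemLp (ArithWave.numZeros v 0) 2 P := (memLp_congr_ae h0).2 MemLp.zero
    have hI0 : hI.toLp (ArithWave.numZeros v 0) = 0 := Lp.ext (hI.coeFn_toLp.trans (h0.trans (Lp.coeFn_zero ℝ 2 P).symm))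
    have hvar : ∀ q, variance (ArithWave.chaosProj P v q (hI.toLp (ArithWave.numZeros v 0))) P = 0 := by
      intro q
      rw [hI0, ArithWave.chaosProj, map_zero, variance_congr (Lp.coeFn_zero ℝ 2 P), variance_zero]
    refine ⟨hI, ?_, fun _ => ?_⟩
    · simp_rw [hvar]
      exact summable_zero
    · simp_rw [hvar]
      simp [ArithWave.energy]
  · have hI := hv.memLp_numZeros hn hn0
    have hle := hv.sum_variance_chaosProj_le hn hn0 hI (hC n hn hn0)
    exact ⟨hv.ae_finite_zeroSet hn hn0, hI,
      summable_of_sum_range_le (fun _ => variance_nonneg _ _) hle,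
      fun _ => Real.tsum_le_of_sum_range_le (fun _ => variance_nonneg _ _) hle⟩
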